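/- Let $F$ be a number field with ring of integers $\mathbb{Z}_F$, let $A$ be a quaternion algebra over $F$ (a central simple $F$-algebra of dimension $4$) with reduced norm $\mathrm{nrd}$, and let $\mathcal{O}$ be a maximal order in $A$. A lattice in $A$ is a finitely generated $\mathbb{Z}_F$-submodule $I$ with $FI=A$; its left and right orders are $\mathcal{O}_l(I)=\{x\in A: xI\subset I\}$ and $\mathcal{O}_r(I)=\{x\in A: Ix\subset I\}$. A right $\mathcal{O}$-ideal is a lattice $I$ with $\mathcal{O}_r(I)=\mathcal{O}$; it is integral if $I\subset\mathcal{O}$; and $\mathrm{nrd}(I)$ is the fractional ideal of $F$ generated by the reduced norms of the elements of $I$. Let $\mathfrak{p}$ be a prime of $\mathbb{Z}_F$ that splits in $A$, with valuation $v_{\mathfrak p}$ and completion $F_{\mathfrak p}$, whose ring of integers is $R$; fix an isomorphism $A\otimes_F F_{\mathfrak p}\cong M_2(F_{\mathfrak p})$, and write $I_{\mathfrak p}$ for the $R$-module generated by $I$ in $A\otimes_F F_{\mathfrak p}$. Let $\mathcal{T}_{\mathfrak p}$ be the Bruhat–Tits tree, whose vertices are the homothety classes of $R$-lattices of rank $2$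 in $F_{\mathfrak p}^2$, with an edge between any two vertices at distance $1$; the group $A^\times$ acts on it through the fixed isomorphism. A $\mathfrak p$-reduction structure consists of the following data, where $\mathcal{O}_0=\mathcal{O}$: the left order $\mathcal{O}_1$ of some integral right $\mathcal{O}$-ideal of reduced norm $\mathfrak p$; for each $b\in\{0,1\}$ a vertex $P_b$ of $\mathcal{T}_{\mathfrak p}$ fixed by $\mathcal{O}_b^\times$; and, for each $b\in\{0,1\}$ and each vertex $P$ at distance $1$ from $P_b$, an element $g\in\mathcal{O}_b^\times$ with $g\cdot P=P_{1-b}$. Given such a structure and an integral right $\mathcal{O}$-ideal $I$, the algorithm PReduce does the following. 1. Let $r$ be the largest integer with $I\subset\mathcal{O}\mathfrak p^r$, and put $J\leftarrow I\mathfrak p^{-r}$, $k\leftarrow v_{\mathfrak p}(\mathrm{nrd}(J))$, $c\leftarrow 1$, $b\leftarrow 0$. Choose any $x\in I$ with $I_{\mathfrak p}=x\mathcal{O}_{\mathfrak p}$ and put $Q\leftarrow x\cdot P_0$. If $k=0$, return $c,J,r$. 2. Let $P$ be the vertex at distance $1$ from $P_b$ in the segment $P_bQ$ and let $g\in\mathcal{O}_b^\times$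 be the element of the structure with $g\cdot P=P_{1-b}$. Replace $(c,J,Q)$ by $(gc,gJ,g\cdot Q)$. If $b=1$, replace $J$ by $J\mathfrak p^{-1}$, $r$ by $r+1$ and $k$ by $k-2$. Replace $b$ by $1-b$. If $k<2$, return $c,J,r$; otherwise repeat step 2. Then PReduce is correct: an element $x$ as in step 1 exists; for every choice of $x$ the vertex $P$ exists each time step 2 is executed and the algorithm terminates; and its output consists of an element $c\in A^\times$, an integral right $\mathcal{O}$-ideal $J$ and an integer $r$ such that $cI=J\mathfrak p^r$ and $v_{\mathfrak p}(\mathrm{nrd}(J))\in\{0,1\}$. -/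

import Mathlib

open scoped NumberField TensorProduct nonZeroDivisors
open IsDedekindDomain

noncomputable section

/-! ## The Bruhat–Tits tree of a discrete valuation ring -/

namespace BruhatTits

variable (R K : Type*) [CommRing R] [Field K] [Algebra R K]

/-- `R`-lattices of rank two in `K²`. -/
def Lattice : Type _ :=
  {L : Submodule R (Fin 2 → K) // L.FG ∧ Submodule.span K (L : Set (Fin 2 → K)) = ⊤}

/-- Image of an `R`-submodule of `K²` under a matrix with coefficients in `K`. -/
def matMap (g : Matrix (Fin 2) (Fin 2) K) (L : Submodule R (Fin 2 → K)) :
    Submodule R (Fin 2 → K) :=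
  L.map ((Matrix.toLin' g).restrictScalars R)

theorem matMap_mul (g h : Matrix (Fin 2) (Fin 2) K) (L : Submodule R (Fin 2 → K)) :
    matMap R K (g * h) L = matMap R K g (matMap R K h L) := by
  unfold matMap
  rw [← Submodule.map_comp]
  congr 1
  ext1 v
  simp [Matrix.toLin'_mul]

variable {R K} in
/-- The action of `GL₂(K)` on lattices. -/
def Lattice.act (g : GL (Fin 2) K) (L : Lattice R K) : Lattice R K :=
  ⟨matMap R K (g : Matrix (Fin 2) (Fin 2) K) L.1, L.2.1.map _, by
    have h : (matMap R K (g : Matrix (Fin 2) (Fin 2) K) L.1 : Set (Fin 2 → K))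
        = (Matrix.toLin' (g : Matrix (Fin 2) (Fin 2) K)) '' (L.1 : Set (Fin 2 → K)) := rfl
    rw [h, Submodule.span_image, L.2.2, Submodule.map_top, LinearMap.range_eq_top]
    intro v
    refine ⟨Matrix.toLin' ((g⁻¹ : GL (Fin 2) K) : Matrix (Fin 2) (Fin 2) K) v, ?_⟩
    rw [← LinearMap.comp_apply, ← Matrix.toLin'_mul, ← Units.val_mul, mul_inv_cancel]
    simp⟩

/-- Two lattices are homothetic if they differ by multiplication by a nonzero scalar. -/
def homothety : Setoid (Lattice R K) where
  r L L' := ∃ c : Kˣ, L'.1 = matMap R K (Matrix.scalar (Fin 2) (c : K)) L.1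
  iseqv :=
    { refl := fun L => ⟨1, by simp [matMap]⟩
      symm := by
        rintro L L' ⟨c, h⟩
        refine ⟨c⁻¹, ?_⟩
        rw [h, ← matMap_mul, ← map_mul, ← Units.val_mul, inv_mul_cancel]
        simp [matMap]
      trans := by
        rintro L L' L'' ⟨c, h⟩ ⟨d, h'⟩
        refine ⟨d * c, ?_⟩
        rw [h', h, ← matMap_mul, ← map_mul, ← Units.val_mul] }

/-- Vertices of the tree: homothety classes of lattices. -/
def Vertex : Type _ := Quotient (homothety R K)

variable {R K} in
/-- The action of `GL₂(K)` on the vertices. -/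
def Vertex.act (g : GL (Fin 2) K) : Vertex R K → Vertex R K :=
  Quotient.map (Lattice.act g) (by
    rintro L L' ⟨c, h⟩
    refine ⟨c, ?_⟩
    change matMap R K _ L'.1 = matMap R K _ (matMap R K _ L.1)
    rw [h, ← matMap_mul, ← matMap_mul]
    congr 1
    exact ((Matrix.scalar_commute (c : K) (fun _ => mul_comm _ _) _).eq).symm)

variable [IsDomain R] [IsDiscreteValuationRing R] [IsFractionRing R K]

variable {R K} in
/-- `P` and `Q` are at distance `n`: for suitable lattices `L ∈ P`, `L' ∈ Q` and a uniformizer `π`,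
there is an `R`-basis `(e₀, e₁)` of `L` such that `(π ^ i • e₀, π ^ j • e₁)` is an `R`-basis of
`L'`, and `n = |i - j|`. -/
def AtDistance (P Q : Vertex R K) (n : ℕ) : Prop :=
  ∃ (L L' : Lattice R K) (π : R) (e : Module.Basis (Fin 2) K (Fin 2 → K)) (i j : ℤ),
    Quotient.mk (homothety R K) L = P ∧ Quotient.mk (homothety R K) L' = Q ∧
    Irreducible π ∧
    L.1 = Submodule.span R {e 0, e 1} ∧
    L'.1 = Submodule.span R {(algebraMap R K π) ^ i • e 0, (algebraMap R K π) ^ j • e 1} ∧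
    (i - j).natAbs = n

/-- The Bruhat–Tits tree: an edge between every pair of vertices at distance one.
(`fromRel` symmetrizes the relation, which is already symmetric and irreflexive.) -/
def tree : SimpleGraph (Vertex R K) :=
  SimpleGraph.fromRel (fun P Q => AtDistance P Q 1)

variable {R K} in
/-- The segment `PQ`: the vertices on a path of minimum length from `P` to `Q`. -/
def segment (P Q : Vertex R K) : Set (Vertex R K) :=
  {V | ∃ w : (tree R K).Walk P Q, w.length = (tree R K).dist P Q ∧ V ∈ w.support}

end BruhatTits

/-! ## Lattices, orders and ideals in a quaternion algebra over a number field -/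

namespace Quat

variable {F A : Type*} [Field F] [NumberField F] [Ring A] [Algebra F A]

variable (F A) in
/-- A quaternion algebra over `F`: a central simple algebra of dimension four. -/
structure IsQuaternion : Prop where
  central : Algebra.IsCentral F A
  simple : IsSimpleRing A
  finrank_eq : Module.finrank F A = 4

variable (F) in
/-- The reduced trace of a quaternion algebra: half the trace of left multiplication. -/
def trd : A →ₗ[F] F := (2 : F)⁻¹ • (LinearMap.trace F A ∘ₗ LinearMap.mul F A)

variable (F) in
/-- The canonical involution of a quaternion algebra. -/
def conj (x : A) : A := algebraMap F A (trd F x) - x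

variable (F) in
/-- The reduced norm of a quaternion algebra: the element `n` of `F` such that `x x̄ = n`. Since
the reduced trace of `n` is `2 n`, it is half the reduced trace of `x x̄`. -/
def nrd (x : A) : F := trd F (x * conj F x) / 2

/-- A lattice: a finitely generated `𝓞 F`-submodule that spans the algebra over `F`. -/
def IsLattice (I : Submodule (𝓞 F) A) : Prop :=
  I.FG ∧ Submodule.span F (I : Set A) = ⊤

/-- An order: a lattice that is also a subring. -/
def IsOrder (O : Subalgebra (𝓞 F) A) : Prop :=
  IsLattice (Subalgebra.toSubmodule O)

/-- A maximal order. -/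
def IsMaximalOrder (O : Subalgebra (𝓞 F) A) : Prop :=
  Maximal IsOrder O

/-- The right order `{x | I x ⊆ I}`. -/
def rightOrder (I : Submodule (𝓞 F) A) : Subalgebra (𝓞 F) A where
  carrier := {x | ∀ y ∈ I, y * x ∈ I}
  mul_mem' {x x'} hx hx' y hy := by rw [← mul_assoc]; exact hx' _ (hx _ hy)
  add_mem' {x x'} hx hx' y hy := by rw [mul_add]; exact I.add_mem (hx _ hy) (hx' _ hy)
  algebraMap_mem' r y hy := by
    rw [← Algebra.commutes, ← Algebra.smul_def]; exact I.smul_mem r hy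

/-- The left order `{x | x I ⊆ I}`. -/
def leftOrder (I : Submodule (𝓞 F) A) : Subalgebra (𝓞 F) A where
  carrier := {x | ∀ y ∈ I, x * y ∈ I}
  mul_mem' {x x'} hx hx' y hy := by rw [mul_assoc]; exact hx _ (hx' _ hy)
  add_mem' {x x'} hx hx' y hy := by rw [add_mul]; exact I.add_mem (hx _ hy) (hx' _ hy)
  algebraMap_mem' r y hy := by
    rw [← Algebra.smul_def]; exact I.smul_mem r hy

/-- A right `O`-ideal: a lattice whose right order is `O`. -/
def IsRightIdeal (O : Subalgebra (𝓞 F) A) (I : Submodule (𝓞 F) A) : Prop :=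
  IsLattice I ∧ rightOrder I = O

/-- An integral right `O`-ideal: a right `O`-ideal contained in `O`. -/
def IsIntegralRightIdeal (O : Subalgebra (𝓞 F) A) (I : Submodule (𝓞 F) A) :
    Prop :=
  IsRightIdeal O I ∧ I ≤ Subalgebra.toSubmodule O

/-- The reduced norm of `I`: the `𝓞 F`-module generated by the reduced norms of elements. -/
def nrdIdeal (I : Submodule (𝓞 F) A) : Submodule (𝓞 F) F :=
  Submodule.span (𝓞 F) (nrd F '' (I : Set A))

/-- The reduced norm of a finitely generated module is a fractional ideal. -/
theorem isFractional_nrdIdeal {I : Submodule (𝓞 F) A} (hI : I.FG) :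
    IsFractional (𝓞 F)⁰ (nrdIdeal I) := by
  let B : A →ₗ[F] A →ₗ[F] F := (2 : F)⁻¹ •
    ((LinearMap.mul F F).compl₁₂ (trd F) (trd F) - (LinearMap.mul F A).compr₂ (trd F))
  have hB : ∀ x, nrd F x = B x x := fun x => by
    simp only [nrd, conj, mul_sub, map_sub, ← Algebra.commutes, ← Algebra.smul_def, map_smul, B,
      LinearMap.smul_apply, LinearMap.sub_apply, LinearMap.compl₁₂_apply, LinearMap.compr₂_apply,
      LinearMap.mul_apply', smul_eq_mul]
    ring
  let B' : A →ₗ[𝓞 F] A →ₗ[𝓞 F] F := B.restrictScalars₁₂ (𝓞 F) (𝓞 F)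
  refine FractionalIdeal.isFractional_of_le (J := ⟨Submodule.map₂ B' I I,
    FractionalIdeal.isFractional_of_fg (hI.map₂ B' hI)⟩) ?_
  refine Submodule.span_le.2 ?_
  rintro _ ⟨x, hx, rfl⟩
  rw [hB]
  exact Submodule.apply_mem_map₂ B' hx hx

open Classical in
/-- The `p`-adic valuation of a fractional ideal `M` (with value `0` if `M` is not one). -/
def ordAt (p : HeightOneSpectrum (𝓞 F)) (M : Submodule (𝓞 F) F) : ℤ :=
  if h : IsFractional (𝓞 F)⁰ M then FractionalIdeal.count F p ⟨M, h⟩ else 0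

/-- The fractional ideal `p ^ r` of `F`, for an integer `r`. -/
def primePow (p : HeightOneSpectrum (𝓞 F)) (r : ℤ) : Submodule (𝓞 F) F :=
  (((p.asIdeal : FractionalIdeal (𝓞 F)⁰ F) ^ r : FractionalIdeal (𝓞 F)⁰ F) :
    Submodule (𝓞 F) F)

/-- The product `I p ^ r`. -/
def mulPrimePow (I : Submodule (𝓞 F) A) (p : HeightOneSpectrum (𝓞 F)) (r : ℤ) :
    Submodule (𝓞 F) A :=
  I * (primePow p r).map ((Algebra.linearMap F A).restrictScalars (𝓞 F))

/-- The product `c I`. -/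
def leftMul (c : A) (I : Submodule (𝓞 F) A) : Submodule (𝓞 F) A :=
  I.map (LinearMap.mulLeft (𝓞 F) c)

/-! ## Completion at a prime -/

variable (A) in
/-- The completion `A_p = F_p ⊗ A`. -/
abbrev Completion (p : HeightOneSpectrum (𝓞 F)) : Type _ :=
  p.adicCompletion F ⊗[F] A

variable (A) in
/-- A splitting of `A` at `p`, that is an isomorphism `A_p ≅ M₂(F_p)`. -/
abbrev Splitting (p : HeightOneSpectrum (𝓞 F)) : Type _ :=
  Completion A p ≃ₐ[p.adicCompletion F] Matrix (Fin 2) (Fin 2) (p.adicCompletion F)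

/-- The completion `I_p`, the module over the `p`-adic integers generated by `I` in `A_p`. -/
def completeAt (p : HeightOneSpectrum (𝓞 F)) (I : Submodule (𝓞 F) A) :
    Submodule (p.adicCompletionIntegers F) (Completion A p) :=
  Submodule.span _ ((fun x => (1 : p.adicCompletion F) ⊗ₜ[F] x) '' (I : Set A))

/-- `x` is a local generator at `p` of the right `O`-ideal `I`: `x ∈ I` and `I_p = x O_p`. -/
def IsLocalGenerator (O : Subalgebra (𝓞 F) A) (p : HeightOneSpectrum (𝓞 F))
    (I : Submodule (𝓞 F) A) (x : A) : Prop :=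
  x ∈ I ∧ completeAt p I = (completeAt p (Subalgebra.toSubmodule O)).map
    (LinearMap.mulLeft (p.adicCompletionIntegers F) ((1 : p.adicCompletion F) ⊗ₜ[F] x))

variable {p : HeightOneSpectrum (𝓞 F)}

/-- Vertices of the Bruhat–Tits tree of `F_p`. -/
abbrev PVertex (p : HeightOneSpectrum (𝓞 F)) : Type _ :=
  BruhatTits.Vertex (p.adicCompletionIntegers F) (p.adicCompletion F)

/-- The Bruhat–Tits tree of `F_p`. -/
abbrev pTree (p : HeightOneSpectrum (𝓞 F)) : SimpleGraph (PVertex p) :=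
  BruhatTits.tree (p.adicCompletionIntegers F) (p.adicCompletion F)

/-- The homomorphism `Aˣ → GL₂(F_p)` given by a splitting. -/
def toGL (φ : Splitting A p) : Aˣ →* GL (Fin 2) (p.adicCompletion F) :=
  Units.map ((φ.toAlgHom.restrictScalars F).comp
    (Algebra.TensorProduct.includeRight : A →ₐ[F] Completion A p) :
      A →* Matrix (Fin 2) (Fin 2) (p.adicCompletion F))

/-- The action of `Aˣ` on the vertices of the tree through a splitting. -/
def act (φ : Splitting A p) (x : Aˣ) (P : PVertex p) : PVertex p :=
  BruhatTits.Vertex.act (toGL φ x) P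

/-! ## The local reduction -/

/-- A `p`-reduction structure. The data are indexed by `i ∈ {0, 1}`, and `1 - i` is computed in
`Fin 2`. -/
structure PReductionStructure (O : Subalgebra (𝓞 F) A) (p : HeightOneSpectrum (𝓞 F))
    (φ : Splitting A p) where
  /-- the orders `O₀` and `O₁` -/
  order : Fin 2 → Subalgebra (𝓞 F) A
  order_zero : order 0 = O
  /-- `O₁` is the left order of an integral right `O`-ideal of norm `p` -/
  order_one : ∃ I, IsIntegralRightIdeal O I ∧ nrdIdeal I = primePow p 1 ∧ order 1 = leftOrder I
  /-- the vertices `P₀` and `P₁` -/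
  point : Fin 2 → PVertex p
  /-- `Pᵢ` is the fixed point of the unit group of `Oᵢ` (the rotations below force this fixed
  point to be unique) -/
  point_fixed : ∀ i, ∀ u ∈ (order i).toSubmonoid.units, act φ u (point i) = point i
  /-- for every vertex `P` adjacent to `Pᵢ`, a unit of `Oᵢ` -/
  rot : ∀ i P, (pTree p).Adj (point i) P → Aˣ
  rot_mem : ∀ i P h, rot i P h ∈ (order i).toSubmonoid.units
  /-- which sends `P` to the other of the two vertices `P₀`, `P₁` -/
  rot_act : ∀ i P h, act φ (rot i P h) P = point (1 - i)

variable (A p) in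
/-- The variables of the algorithm `PReduce`, and a flag telling whether the loop is over. -/
structure State where
  c : Aˣ
  J : Submodule (𝓞 F) A
  Q : PVertex p
  r : ℤ
  k : ℤ
  i : Fin 2
  halted : Bool

/-- The initialization of `PReduce` on the input `I`: `r` is the largest integer such that
`I ⊆ O p ^ r`, `J = I p ^ (-r)`, `k = v_p (nrd J)`, `c = 1`, `i = 0` and `Q = x P₀` where `x` is an
arbitrary local generator of `I` at `p` (such an element is necessarily invertible in the algebra).
The loop is entered unless `k = 0`. -/
def Init {O : Subalgebra (𝓞 F) A} {φ : Splitting A p} (S : PReductionStructure O p φ)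
    (I : Submodule (𝓞 F) A) (s : State A p) : Prop :=
  IsGreatest {r : ℤ | I ≤ mulPrimePow (Subalgebra.toSubmodule O) p r} s.r ∧
  s.J = mulPrimePow I p (-s.r) ∧
  s.k = ordAt p (nrdIdeal s.J) ∧
  s.c = 1 ∧
  s.i = 0 ∧
  (∃ x : Aˣ, IsLocalGenerator O p I x ∧ s.Q = act φ x (S.point 0)) ∧
  s.halted = decide (s.k = 0)

/-- One execution of the body of the loop of `PReduce`, where `P` is the point at distance one from
`Pᵢ` in the segment `Pᵢ Q`; the loop is over as soon as `k < 2` after the execution. -/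
def Step {O : Subalgebra (𝓞 F) A} {φ : Splitting A p} (S : PReductionStructure O p φ)
    (s s' : State A p) : Prop :=
  s.halted = false ∧
  ∃ (P : PVertex p) (h : (pTree p).Adj (S.point s.i) P),
    P ∈ BruhatTits.segment (S.point s.i) s.Q ∧
    s'.c = S.rot s.i P h * s.c ∧
    s'.Q = act φ (S.rot s.i P h) s.Q ∧
    (s.i = 0 → s'.J = leftMul (S.rot s.i P h : A) s.J ∧ s'.r = s.r ∧ s'.k = s.k) ∧
    (s.i = 1 → s'.J = mulPrimePow (leftMul (S.rot s.i P h : A) s.J) p (-1) ∧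
      s'.r = s.r + 1 ∧ s'.k = s.k - 2) ∧
    s'.i = 1 - s.i ∧
    s'.halted = decide (s'.k < 2)

/-- `s` occurs in an execution of `PReduce` on the input `I`. -/
def Reachable {O : Subalgebra (𝓞 F) A} {φ : Splitting A p}
    (S : PReductionStructure O p φ) (I : Submodule (𝓞 F) A) (s : State A p) : Prop :=
  ∃ s₀, Init S I s₀ ∧ Relation.ReflTransGen (Step S) s₀ s

end Quat

end

/-! Let R be the ring of p-adic integers and π a uniformizer. The columns of the elements of `O`
generate a lattice h R² stable under `O`, so conjugating the splitting by h puts `O` inside M₂(R)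
(`exists_forall_mem_pInt`). Maximality then makes `O` dense in M₂(R) and makes membership in `O` a
local condition (`mem_of_mem_pInt`). Consequently every right `O`-ideal J is generated locally at p
by a single unit y of the algebra (`exists_local_generator`).

The vertex P₀ is only assumed to be fixed by the units of `O`, but the rotations force it to be the
class of h R² (`eq_vtx_of_fixed`). Otherwise the units would also fix the neighbour V of P₀ in the
direction of h R². Since some unit sends V to P₁, this gives V = P₁; a neighbour on the other side,
which some unit also sends to P₁, would then be equal to V.

The dictionary between ideals and the tree is the Smith normal form (`exists_dist_act_eq`). If y has
elementary divisors π^i and π^j with respect to h R², then the distance from P₀ to y P₀ is |i - j|,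
the valuation of nrd y is i + j, and the largest power of π dividing y is π^min(i, j). At the start,
r is maximal, so min(i, j) = 0 and the distance from P₀ to Q = y P₀ is k, the valuation of nrd J.

The loop preserves d(P₀, Q) = k and, when the current index is 1, d(P₁, Q) = k - 1
(`Invariant.step`). At index 0 the rotation fixes P₀ and moves the first vertex of the segment to
P₁, so the distance to P₁ becomes k - 1. At index 1 the distance to P₀ becomes k - 2, while the norm
of gJ still has valuation k: hence i + j = k and |i - j| = k - 2, so min(i, j) = 1 and gJ is
divisible by p at p. At the other primes O₁ lies in `O`, so gJ p⁻¹ is integral. The quantity k minus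
the index drops by one at each step, which gives termination. Only shortest walks are used;
acyclicity of the tree plays no role. -/

namespace BruhatTits

open scoped Matrix

/-! ### Integral matrices and the scaled-divisibility relation `Within`. -/

section Matrices

variable (R K : Type*) [CommRing R] [Field K] [Algebra R K]

/-- The ring of matrices with coefficients in `R`. -/
def intMat : Subring (Matrix (Fin 2) (Fin 2) K) := (algebraMap R K).mapMatrix.range

variable {R K}

theorem mem_intMat {m : Matrix (Fin 2) (Fin 2) K} :
    m ∈ intMat R K ↔ ∀ i j, m i j ∈ (algebraMap R K).range := by
  constructor
  · rintro ⟨n, rfl⟩ i j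
    exact ⟨n i j, rfl⟩
  · intro h
    choose n hn using h
    exact ⟨Matrix.of n, by ext i j; exact hn i j⟩

theorem intMat_of {a b c d : K} (ha : a ∈ (algebraMap R K).range) (hb : b ∈ (algebraMap R K).range)
    (hc : c ∈ (algebraMap R K).range) (hd : d ∈ (algebraMap R K).range) :
    !![a, b; c, d] ∈ intMat R K := by
  rw [mem_intMat]
  intro i j
  fin_cases i <;> fin_cases j <;> assumption

theorem smul_mem_intMat {c : K} (hc : c ∈ (algebraMap R K).range) {m : Matrix (Fin 2) (Fin 2) K}
    (hm : m ∈ intMat R K) : c • m ∈ intMat R K := by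
  rw [mem_intMat] at *
  exact fun i j => mul_mem hc (hm i j)

theorem det_mem_of_mem_intMat {m : Matrix (Fin 2) (Fin 2) K} (hm : m ∈ intMat R K) :
    m.det ∈ (algebraMap R K).range := by
  obtain ⟨n, rfl⟩ := hm
  exact ⟨n.det, RingHom.map_det _ _⟩

theorem trace_mem_of_mem_intMat {m : Matrix (Fin 2) (Fin 2) K} (hm : m ∈ intMat R K) :
    m.trace ∈ (algebraMap R K).range := by
  rw [mem_intMat] at hm
  rw [Matrix.trace_fin_two]
  exact add_mem (hm 0 0) (hm 1 1)

variable (R K) in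
/-- The group `GL₂(R)` as a subgroup of `GL₂(K)`. -/
def intGL : Subgroup (GL (Fin 2) K) := (intMat R K).toSubmonoid.units

theorem mem_intGL {g : GL (Fin 2) K} :
    g ∈ intGL R K ↔ (g : Matrix (Fin 2) (Fin 2) K) ∈ intMat R K ∧
      ((g⁻¹ : GL (Fin 2) K) : Matrix (Fin 2) (Fin 2) K) ∈ intMat R K :=
  Iff.rfl

theorem mem_intGL_of_det {g : GL (Fin 2) K}
    (hg : (g : Matrix (Fin 2) (Fin 2) K) ∈ intMat R K)
    (hd : (g : Matrix (Fin 2) (Fin 2) K).det⁻¹ ∈ (algebraMap R K).range) : g ∈ intGL R K := by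
  refine mem_intGL.2 ⟨hg, ?_⟩
  rw [Matrix.coe_units_inv, Matrix.inv_def, Ring.inverse_eq_inv']
  refine smul_mem_intMat hd ?_
  rw [Matrix.adjugate_fin_two]
  rw [mem_intMat] at hg
  exact intMat_of (hg _ _) (neg_mem (hg _ _)) (neg_mem (hg _ _)) (hg _ _)

theorem exists_intGL_eq (g : Matrix (Fin 2) (Fin 2) K) (hg : g ∈ intMat R K)
    (h0 : g.det ≠ 0) (hd : g.det⁻¹ ∈ (algebraMap R K).range) :
    ∃ U ∈ intGL R K, (U : Matrix (Fin 2) (Fin 2) K) = g :=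
  ⟨Matrix.GeneralLinearGroup.mkOfDetNeZero g h0, mem_intGL_of_det hg hd, rfl⟩

/-- `π ^ n` divides the matrix `m` after scaling, and conversely. -/
def Within (π : R) (n : ℕ) (m : GL (Fin 2) K) : Prop :=
  ∃ c : Kˣ, (c : K) • (m : Matrix (Fin 2) (Fin 2) K) ∈ intMat R K ∧
    ((algebraMap R K π) ^ n * (c⁻¹ : Kˣ)) • ((m⁻¹ : GL (Fin 2) K) : Matrix (Fin 2) (Fin 2) K)
      ∈ intMat R K

/-- A triangle inequality: for m = g⁻¹h, `Within π n m` says that some homothetic copy of h R² lies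
between π^n g R² and g R². -/
theorem Within.mul {π : R} {n n' : ℕ} {m m' : GL (Fin 2) K} (h : Within π n m)
    (h' : Within π n' m') : Within π (n + n') (m * m') := by
  obtain ⟨c, h1, h2⟩ := h
  obtain ⟨c', h1', h2'⟩ := h'
  refine ⟨c * c', ?_, ?_⟩
  · have := mul_mem h1 h1'
    rwa [smul_mul_smul_comm] at this
  · have := mul_mem h2' h2
    rw [smul_mul_smul_comm, ← Units.val_mul, ← mul_inv_rev m m'] at this
    convert this using 2
    push_cast [mul_inv_rev]
    ring

theorem within_zero_of_mem_intGL (π : R) {m : GL (Fin 2) K} (h : m ∈ intGL R K) :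
    Within π 0 m :=
  ⟨1, by simpa using (mem_intGL.1 h).1, by simpa using (mem_intGL.1 h).2⟩

end Matrices

/-! ### Vertices of the tree as cosets of matrices. -/

section Vertices

variable {R K : Type*} [CommRing R] [Field K] [Algebra R K]

variable (R K) in
/-- The lattice `R²`. -/
def std : Submodule R (Fin 2 → K) := Submodule.span R {Pi.single 0 1, Pi.single 1 1}

theorem mem_std {v : Fin 2 → K} : v ∈ std R K ↔ ∀ i, v i ∈ (algebraMap R K).range := by
  rw [std, Submodule.mem_span_pair]
  constructor
  · rintro ⟨a, b, rfl⟩ i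
    fin_cases i
    · exact ⟨a, by simp [Algebra.smul_def]⟩
    · exact ⟨b, by simp [Algebra.smul_def]⟩
  · intro h
    obtain ⟨a, ha⟩ := h 0
    obtain ⟨b, hb⟩ := h 1
    refine ⟨a, b, ?_⟩
    ext i
    fin_cases i
    · simp [Algebra.smul_def, ha]
    · simp [Algebra.smul_def, hb]

theorem matMap_std (g : Matrix (Fin 2) (Fin 2) K) :
    matMap R K g (std R K) = Submodule.span R {g.col 0, g.col 1} := by
  rw [matMap, std, Submodule.map_span, Set.image_pair]
  congr 2
  · exact Matrix.mulVec_single_one g 0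
  · congr 1
    exact Matrix.mulVec_single_one g 1

theorem matMap_mono (g : Matrix (Fin 2) (Fin 2) K) {L L' : Submodule R (Fin 2 → K)}
    (h : L ≤ L') : matMap R K g L ≤ matMap R K g L' :=
  Submodule.map_mono h

theorem matMap_one (L : Submodule R (Fin 2 → K)) : matMap R K 1 L = L := by
  simp [matMap]

theorem matMap_std_le_std {g : Matrix (Fin 2) (Fin 2) K} :
    matMap R K g (std R K) ≤ std R K ↔ g ∈ intMat R K := by
  rw [matMap_std, Submodule.span_le, Set.insert_subset_iff, Set.singleton_subset_iff,
    mem_intMat]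
  simp only [SetLike.mem_coe, mem_std, Matrix.col_apply, Fin.forall_fin_two]
  tauto

theorem matMap_le_iff (g : GL (Fin 2) K) {L L' : Submodule R (Fin 2 → K)} :
    matMap R K g L ≤ L' ↔ L ≤ matMap R K ((g⁻¹ : GL (Fin 2) K) : Matrix (Fin 2) (Fin 2) K) L' := by
  constructor
  · intro h
    have := matMap_mono ((g⁻¹ : GL (Fin 2) K) : Matrix (Fin 2) (Fin 2) K) h
    rwa [← matMap_mul, ← Units.val_mul, inv_mul_cancel, Units.val_one, matMap_one] at this
  · intro h
    have := matMap_mono (g : Matrix (Fin 2) (Fin 2) K) h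
    rwa [← matMap_mul, ← Units.val_mul, mul_inv_cancel, Units.val_one, matMap_one] at this

variable (R K) in
/-- The lattice `R²` as an element of the type of lattices. -/
def stdLattice : Lattice R K :=
  ⟨std R K, Submodule.fg_span (by simp), by
    rw [std, Submodule.span_span_of_tower, eq_top_iff]
    intro v _
    rw [Submodule.mem_span_pair]
    refine ⟨v 0, v 1, ?_⟩
    ext i
    fin_cases i <;> simp⟩

variable (R) in
/-- The class of the lattice `g R²`. -/
def vtx (g : GL (Fin 2) K) : Vertex R K :=
  Quotient.mk (homothety R K) ((stdLattice R K).act g)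

theorem act_vtx (g h : GL (Fin 2) K) : (vtx R h).act g = vtx R (g * h) := by
  refine congrArg (Quotient.mk (homothety R K)) (Subtype.ext ?_)
  exact (matMap_mul R K _ _ _).symm

theorem matMap_smul (c : K) (g : Matrix (Fin 2) (Fin 2) K) (L : Submodule R (Fin 2 → K)) :
    matMap R K (c • g) L = matMap R K (Matrix.scalar (Fin 2) c) (matMap R K g L) := by
  rw [← matMap_mul]
  congr 1
  simp [Matrix.smul_eq_diagonal_mul]

/-- Homothety of g R² and h R² means that a scalar multiple of g⁻¹h lies in GL₂(R). The element π is
a dummy here, because it occurs with exponent 0. -/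
theorem vtx_eq_iff (π : R) {g h : GL (Fin 2) K} :
    vtx R g = vtx R h ↔ Within π 0 (g⁻¹ * h) := by
  have key : vtx R g = vtx R h ↔ ∃ c : Kˣ, matMap R K (h : Matrix (Fin 2) (Fin 2) K) (std R K)
      = matMap R K ((c : K) • (g : Matrix (Fin 2) (Fin 2) K)) (std R K) := by
    refine Quotient.eq.trans (exists_congr fun c => ?_)
    rw [matMap_smul]
    rfl
  have hs : ∀ (c : Kˣ) (x : GL (Fin 2) K), ∃ y : GL (Fin 2) K,
      (y : Matrix (Fin 2) (Fin 2) K) = (c : K) • (x : Matrix (Fin 2) (Fin 2) K) ∧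
      ((y⁻¹ : GL (Fin 2) K) : Matrix (Fin 2) (Fin 2) K) =
        ((c⁻¹ : Kˣ) : K) • ((x⁻¹ : GL (Fin 2) K) : Matrix (Fin 2) (Fin 2) K) := fun c x =>
    ⟨⟨(c : K) • (x : Matrix (Fin 2) (Fin 2) K),
      ((c⁻¹ : Kˣ) : K) • ((x⁻¹ : GL (Fin 2) K) : Matrix (Fin 2) (Fin 2) K),
      by rw [smul_mul_smul_comm, ← Units.val_mul, ← Units.val_mul]; simp,
      by rw [smul_mul_smul_comm, ← Units.val_mul, ← Units.val_mul]; simp⟩, rfl, rfl⟩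
  rw [key]
  unfold Within
  simp only [pow_zero, one_mul]
  constructor
  · rintro ⟨c, hc⟩
    obtain ⟨y, hy, hy'⟩ := hs c g
    rw [← hy] at hc
    refine ⟨c⁻¹, ?_, ?_⟩
    · rw [← matMap_std_le_std, Units.val_mul, ← smul_mul_assoc, ← hy', matMap_mul, hc,
        matMap_le_iff, inv_inv]
    · rw [← matMap_std_le_std, inv_inv, mul_inv_rev, inv_inv, Units.val_mul, ← mul_smul_comm,
        ← hy, matMap_mul, ← hc, matMap_le_iff, inv_inv]
  · rintro ⟨c, hc, hc'⟩
    obtain ⟨y, hy, hy'⟩ := hs c⁻¹ g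
    refine ⟨c⁻¹, ?_⟩
    rw [← hy]
    rw [inv_inv] at hy'
    apply le_antisymm
    · rw [← matMap_std_le_std, Units.val_mul, ← smul_mul_assoc, ← hy', matMap_mul, matMap_le_iff,
        inv_inv] at hc
      exact hc
    · rw [← matMap_std_le_std, mul_inv_rev, inv_inv, Units.val_mul, ← mul_smul_comm, ← hy,
        matMap_mul, matMap_le_iff, inv_inv] at hc'
      exact hc'

theorem vtx_mul_of_mem {g U : GL (Fin 2) K} (hU : U ∈ intGL R K) : vtx R (g * U) = vtx R g := by
  refine ((vtx_eq_iff (0 : R)).2 ?_).symm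
  rw [inv_mul_cancel_left]
  exact within_zero_of_mem_intGL _ hU

theorem act_act (g : GL (Fin 2) K) (P : Vertex R K) (h : GL (Fin 2) K) :
    (P.act h).act g = P.act (g * h) := by
  induction P using Quotient.inductionOn with
  | h L =>
    refine congrArg (Quotient.mk (homothety R K)) (Subtype.ext ?_)
    exact (matMap_mul R K _ _ _).symm

theorem one_act (P : Vertex R K) : P.act 1 = P := by
  induction P using Quotient.inductionOn with
  | h L =>
    refine congrArg (Quotient.mk (homothety R K)) (Subtype.ext ?_)
    exact matMap_one _

variable [IsDomain R] [IsPrincipalIdealRing R] [IsFractionRing R K]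

/-- A lattice over a principal ideal domain is free of rank two; a basis supplies the columns of g.
-/
theorem exists_eq_matMap_std {L : Submodule R (Fin 2 → K)} (hL : L.FG)
    (hL' : Submodule.span K (L : Set (Fin 2 → K)) = ⊤) :
    ∃ g : GL (Fin 2) K, L = matMap R K g (std R K) := by
  have : L.IsLattice K := ⟨hL, hL'⟩
  let b0 := Module.Free.chooseBasis R L
  let b : Module.Basis (Fin 2) R L := b0.reindex
    (Fintype.equivFinOfCardEq (by
      rw [← Module.finrank_eq_card_chooseBasisIndex, Submodule.IsLattice.finrank_of_pi (K := K)]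
      simp))
  let e := b.extendOfIsLattice K
  have hdet : IsUnit ((Pi.basisFun K (Fin 2)).toMatrix e) :=
    @isUnit_of_invertible _ _ _ ((Pi.basisFun K (Fin 2)).invertibleToMatrix e)
  refine ⟨hdet.unit, ?_⟩
  rw [matMap_std]
  have hc : ∀ i, (hdet.unit : Matrix (Fin 2) (Fin 2) K).col i = (b i : Fin 2 → K) := by
    intro i
    ext j
    rw [IsUnit.unit_spec, Matrix.col_apply, Module.Basis.toMatrix_apply, Pi.basisFun_repr]
    simp [e]
  rw [hc, hc]
  have h1 := congrArg (Submodule.map L.subtype) b.span_eq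
  rw [Submodule.map_span, Submodule.map_top, Submodule.range_subtype] at h1
  refine h1.symm.trans (congrArg _ ?_)
  ext v
  simp [Fin.exists_fin_two, eq_comm]

theorem exists_eq_vtx (P : Vertex R K) : ∃ g, P = vtx R g := by
  induction P using Quotient.inductionOn with
  | h L =>
    obtain ⟨g, hg⟩ := exists_eq_matMap_std L.2.1 L.2.2
    exact ⟨g, congrArg (Quotient.mk (homothety R K)) (Subtype.ext hg)⟩

end Vertices

end BruhatTits

namespace BruhatTits

open scoped Matrix

/-! ### Smith normal form over a discrete valuation ring. -/

section Smith

variable {R K : Type*} [CommRing R] [Field K] [Algebra R K]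

/-- A diagonal element of `GL₂(K)`. -/
def diagGL (x y : Kˣ) : GL (Fin 2) K where
  val := !![(x : K), 0; 0, (y : K)]
  inv := !![((x⁻¹ : Kˣ) : K), 0; 0, ((y⁻¹ : Kˣ) : K)]
  val_inv := by simp [Matrix.one_fin_two]
  inv_val := by simp [Matrix.one_fin_two]

theorem coe_diagGL (x y : Kˣ) :
    (diagGL x y : Matrix (Fin 2) (Fin 2) K) = !![(x : K), 0; 0, (y : K)] := rfl

theorem diagGL_mul (x y x' y' : Kˣ) :
    diagGL x y * diagGL x' y' = diagGL (x * x') (y * y') := by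
  apply Units.ext
  rw [Units.val_mul, coe_diagGL, coe_diagGL, coe_diagGL, Matrix.mul_fin_two]
  simp

theorem diagGL_one : diagGL (1 : Kˣ) 1 = 1 := by
  apply Units.ext
  simp [coe_diagGL, Matrix.one_fin_two]

theorem diagGL_inv (x y : Kˣ) : (diagGL x y)⁻¹ = diagGL x⁻¹ y⁻¹ := by
  rw [inv_eq_iff_mul_eq_one, diagGL_mul, mul_inv_cancel, mul_inv_cancel, diagGL_one]

theorem det_diagGL (x y : Kˣ) : (diagGL x y : Matrix (Fin 2) (Fin 2) K).det = x * y := by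
  rw [coe_diagGL, Matrix.det_fin_two_of]
  ring

theorem diagGL_mem_intMat {x y : Kˣ} : (diagGL x y : Matrix (Fin 2) (Fin 2) K) ∈ intMat R K ↔
    (x : K) ∈ (algebraMap R K).range ∧ (y : K) ∈ (algebraMap R K).range := by
  rw [coe_diagGL]
  constructor
  · intro h
    rw [mem_intMat] at h
    exact ⟨h 0 0, h 1 1⟩
  · rintro ⟨hx, hy⟩
    exact intMat_of hx (zero_mem _) (zero_mem _) hy

theorem smul_diagGL_mem_intMat {c : K} {x y : Kˣ} :
    c • (diagGL x y : Matrix (Fin 2) (Fin 2) K) ∈ intMat R K ↔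
      c * x ∈ (algebraMap R K).range ∧ c * y ∈ (algebraMap R K).range := by
  have : c • (diagGL x y : Matrix (Fin 2) (Fin 2) K) = !![c * x, 0; 0, c * y] := by
    simp [coe_diagGL]
  rw [this]
  constructor
  · intro h
    rw [mem_intMat] at h
    exact ⟨h 0 0, h 1 1⟩
  · rintro ⟨hx, hy⟩
    exact intMat_of hx (zero_mem _) (zero_mem _) hy

theorem diagGL_mem_intGL (u v : Rˣ) :
    diagGL (Units.map (algebraMap R K).toMonoidHom u) (Units.map (algebraMap R K).toMonoidHom v)
      ∈ intGL R K := by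
  rw [mem_intGL, diagGL_inv, ← map_inv, ← map_inv, diagGL_mem_intMat, diagGL_mem_intMat]
  exact ⟨⟨⟨_, rfl⟩, ⟨_, rfl⟩⟩, ⟨⟨_, rfl⟩, ⟨_, rfl⟩⟩⟩

theorem vtx_mul_diagGL_self (g : GL (Fin 2) K) (c : Kˣ) : vtx R (g * diagGL c c) = vtx R g := by
  refine ((vtx_eq_iff (0 : R)).2 ⟨c⁻¹, ?_, ?_⟩).symm
  · rw [inv_mul_cancel_left, smul_diagGL_mem_intMat, ← Units.val_mul, inv_mul_cancel]
    exact ⟨one_mem _, one_mem _⟩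
  · rw [inv_mul_cancel_left, diagGL_inv, smul_diagGL_mem_intMat, pow_zero, one_mul, inv_inv,
      ← Units.val_mul, mul_inv_cancel]
    exact ⟨one_mem _, one_mem _⟩

variable [IsDomain R] [IsFractionRing R K]

theorem exists_mul_eq_or [ValuationRing R] (a b : K) :
    ∃ r ∈ (algebraMap R K).range, b = r * a ∨ a = r * b := by
  rcases eq_or_ne a 0 with rfl | ha
  · exact ⟨0, zero_mem _, Or.inr (by simp)⟩
  rcases eq_or_ne b 0 with rfl | hb
  · exact ⟨0, zero_mem _, Or.inl (by simp)⟩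
  rcases ValuationRing.isInteger_or_isInteger R (b / a) with ⟨r, hr⟩ | ⟨r, hr⟩
  · exact ⟨_, ⟨r, rfl⟩, Or.inl (by rw [hr]; field_simp)⟩
  · exact ⟨_, ⟨r, rfl⟩, Or.inr (by rw [hr]; field_simp)⟩

/-- Of two elements of K one is an R-multiple of the other, so each elimination needs a single row
or column operation. No invertibility of m is required. -/
theorem exists_intGL_mul_diag_mul [ValuationRing R] (m : Matrix (Fin 2) (Fin 2) K) :
    ∃ U ∈ intGL R K, ∃ V ∈ intGL R K, ∃ x y : K,
      (U : Matrix (Fin 2) (Fin 2) K) * m * (V : Matrix (Fin 2) (Fin 2) K) = !![x, 0; 0, y] := by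
  have h1 : (1 : K) ∈ (algebraMap R K).range := one_mem _
  have h0 : (0 : K) ∈ (algebraMap R K).range := zero_mem _
  have hU : ∀ {a b c d : K}, a ∈ (algebraMap R K).range → b ∈ (algebraMap R K).range →
      c ∈ (algebraMap R K).range → d ∈ (algebraMap R K).range →
      (a * d - b * c = 1 ∨ a * d - b * c = -1) →
      ∃ U ∈ intGL R K, (U : Matrix (Fin 2) (Fin 2) K) = !![a, b; c, d] := by
    intro a b c d ha hb hc hd h
    refine exists_intGL_eq _ (intMat_of ha hb hc hd) ?_ ?_
    · rw [Matrix.det_fin_two_of]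
      rcases h with h | h <;> simp [h]
    · rw [Matrix.det_fin_two_of]
      rcases h with h | h <;> rw [h]
      · simp [one_mem]
      · rw [inv_neg, inv_one]
        exact neg_mem h1
  have first : ∃ V ∈ intGL R K, ∃ a c d : K,
      m * (V : Matrix (Fin 2) (Fin 2) K) = !![a, 0; c, d] := by
    obtain ⟨r, hr, h | h⟩ := exists_mul_eq_or (R := R) (m 0 0) (m 0 1)
    · obtain ⟨V, hV, hV'⟩ := hU h1 (neg_mem hr) h0 h1 (by simp)
      refine ⟨V, hV, m 0 0, m 1 0, - r * m 1 0 + m 1 1, ?_⟩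
      rw [hV', Matrix.eta_fin_two m, Matrix.mul_fin_two, h]
      ext i j
      fin_cases i <;> fin_cases j <;> simp <;> ring
    · obtain ⟨V, hV, hV'⟩ := hU h0 h1 h1 (neg_mem hr) (by simp)
      refine ⟨V, hV, m 0 1, m 1 1, m 1 0 - r * m 1 1, ?_⟩
      rw [hV', Matrix.eta_fin_two m, Matrix.mul_fin_two, h]
      ext i j
      fin_cases i <;> fin_cases j <;> simp <;> ring
  obtain ⟨V, hV, a, c, d, hm⟩ := first
  obtain ⟨r, hr, h | h⟩ := exists_mul_eq_or (R := R) a c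
  · obtain ⟨U, hU', hU''⟩ := hU h1 h0 (neg_mem hr) h1 (by simp)
    refine ⟨U, hU', V, hV, a, d, ?_⟩
    rw [mul_assoc, hm, hU'', h, Matrix.mul_fin_two]
    ext i j
    fin_cases i <;> fin_cases j <;> simp
  -- Now c divides a. If c also divides d, it is moved to the corner and clears its row and column;
  -- otherwise d divides c and a column operation removes c.
  obtain ⟨s, hs, h' | h'⟩ := exists_mul_eq_or (R := R) c d
  · obtain ⟨U, hU', hU''⟩ := hU h0 h1 h1 (neg_mem hr) (by simp)
    obtain ⟨V', hV', hV''⟩ := hU h1 (neg_mem hs) h0 h1 (by simp)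
    refine ⟨U, hU', V * V', mul_mem hV hV', c, - r * d, ?_⟩
    rw [Units.val_mul, mul_assoc, ← mul_assoc m, hm, hU'', hV'', Matrix.mul_fin_two,
      Matrix.mul_fin_two]
    ext i j
    fin_cases i <;> fin_cases j <;> simp [h, h'] <;> ring
  · obtain ⟨V', hV', hV''⟩ := hU h1 h0 (neg_mem hs) h1 (by simp)
    refine ⟨1, one_mem _, V * V', mul_mem hV hV', a, d, ?_⟩
    rw [Units.val_mul, mul_assoc, ← mul_assoc m, hm, hV'', Matrix.mul_fin_two, Units.val_one,
      one_mul]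
    ext i j
    fin_cases i <;> fin_cases j <;> simp [h']
    ring

variable [IsDiscreteValuationRing R]

/-- A nonzero element of a domain as a unit of the fraction field. -/
def toUnit (K : Type*) [Field K] [Algebra R K] [IsFractionRing R K] {π : R} (hπ : Irreducible π) :
    Kˣ :=
  Units.mk0 (algebraMap R K π) (by simpa using hπ.ne_zero)

/-- The diagonal matrix with entries `π ^ i` and `π ^ j`. -/
def powGL (K : Type*) [Field K] [Algebra R K] [IsFractionRing R K] {π : R} (hπ : Irreducible π)
    (i j : ℤ) : GL (Fin 2) K :=
  diagGL (toUnit K hπ ^ i) (toUnit K hπ ^ j)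

variable {π : R} (hπ : Irreducible π)

omit [IsDomain R] [IsDiscreteValuationRing R] in
theorem powGL_mul (i j i' j' : ℤ) :
    powGL K hπ i j * powGL K hπ i' j' = powGL K hπ (i + i') (j + j') := by
  rw [powGL, powGL, diagGL_mul, ← zpow_add, ← zpow_add, powGL]

omit [IsDomain R] [IsDiscreteValuationRing R] in
theorem powGL_inv (i j : ℤ) : (powGL K hπ i j)⁻¹ = powGL K hπ (-i) (-j) := by
  rw [powGL, diagGL_inv, powGL, zpow_neg, zpow_neg]

omit [IsDomain R] [IsDiscreteValuationRing R] in
include hπ in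
theorem zpow_mem_range {k : ℤ} :
    (algebraMap R K π) ^ k ∈ (algebraMap R K).range ↔ 0 ≤ k := by
  have h0 : algebraMap R K π ≠ 0 := by simpa using hπ.ne_zero
  constructor
  · rintro ⟨r, hr⟩
    by_contra hk
    push Not at hk
    obtain ⟨n, rfl⟩ : ∃ n : ℕ, k = -(n + 1 : ℕ) := ⟨(-k - 1).toNat, by omega⟩
    rw [zpow_neg, zpow_natCast, ← mul_eq_one_iff_eq_inv₀ (pow_ne_zero _ h0), ← map_pow, ← map_mul,
      map_eq_one_iff _ (IsFractionRing.injective R K)] at hr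
    apply hπ.not_isUnit
    rw [pow_succ, ← mul_assoc] at hr
    exact IsUnit.of_mul_eq_one_right _ hr
  · intro hk
    lift k to ℕ using hk
    rw [zpow_natCast, ← map_pow]
    exact ⟨_, rfl⟩

include hπ in
theorem exists_unit_mul_zpow (x : Kˣ) :
    ∃ (u : Rˣ) (n : ℤ), x = Units.map (algebraMap R K).toMonoidHom u * toUnit K hπ ^ n := by
  obtain ⟨n, u, hu⟩ := IsDiscreteValuationRing.exists_units_eq_smul_zpow_of_irreducible (K := K) hπ
    x.ne_zero
  refine ⟨u, n, Units.ext ?_⟩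
  rw [hu]
  simp [toUnit, Units.smul_def, Algebra.smul_def]

/-- The Smith normal form of an invertible `2 × 2` matrix over a discretely valued field. -/
theorem exists_smith (m : GL (Fin 2) K) :
    ∃ U ∈ intGL R K, ∃ V ∈ intGL R K, ∃ i j : ℤ, m = U * powGL K hπ i j * V := by
  obtain ⟨U, hU, V, hV, x, y, h⟩ := exists_intGL_mul_diag_mul (R := R)
    (m : Matrix (Fin 2) (Fin 2) K)
  have hdet : x * y ≠ 0 := by
    have h1 := (U * m * V).isUnit
    rw [Matrix.isUnit_iff_isUnit_det, Units.val_mul, Units.val_mul, h, Matrix.det_fin_two_of] at h1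
    simpa using h1.ne_zero
  obtain ⟨u, i, hi⟩ := exists_unit_mul_zpow hπ (Units.mk0 x (left_ne_zero_of_mul hdet))
  obtain ⟨v, j, hj⟩ := exists_unit_mul_zpow hπ (Units.mk0 y (right_ne_zero_of_mul hdet))
  refine ⟨U⁻¹ * diagGL _ _, mul_mem (inv_mem hU) (diagGL_mem_intGL u v), V⁻¹, inv_mem hV, i, j, ?_⟩
  have : U * m * V = diagGL (Units.mk0 x (left_ne_zero_of_mul hdet))
      (Units.mk0 y (right_ne_zero_of_mul hdet)) := Units.ext h
  rw [mul_assoc U⁻¹, powGL, diagGL_mul, ← hi, ← hj, ← this]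
  group

-- The product of one diagonal entry of c m with the other diagonal entry of π^n c⁻¹ m⁻¹ is free of
-- the unknown scalar c: it is π^(n ± (i - j)), and it is integral.
omit [IsDomain R] [IsDiscreteValuationRing R] in
theorem Within.le {n : ℕ} {i j : ℤ} (h : Within π n (powGL K hπ i j)) : (i - j).natAbs ≤ n := by
  obtain ⟨c, h1, h2⟩ := h
  have h0 : algebraMap R K π ≠ 0 := by simpa using hπ.ne_zero
  rw [powGL, smul_diagGL_mem_intMat] at h1
  rw [powGL, diagGL_inv, smul_diagGL_mem_intMat] at h2
  obtain ⟨a0, a1⟩ := h1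
  obtain ⟨b0, b1⟩ := h2
  simp only [toUnit, ← zpow_neg, Units.val_zpow_eq_zpow_val, Units.val_mk0, Units.val_inv_eq_inv_val]
    at a0 a1 b0 b1
  have e1 := zpow_mem_range (K := K) hπ (k := n + i - j) |>.1 (by
    obtain ⟨r, hr⟩ := a0
    obtain ⟨s, hs⟩ := b1
    refine ⟨r * s, ?_⟩
    rw [map_mul, hr, hs, sub_eq_add_neg, zpow_add₀ h0, zpow_add₀ h0, zpow_natCast]
    have := c.ne_zero
    field_simp)
  have e2 := zpow_mem_range (K := K) hπ (k := n + j - i) |>.1 (by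
    obtain ⟨r, hr⟩ := a1
    obtain ⟨s, hs⟩ := b0
    refine ⟨r * s, ?_⟩
    rw [map_mul, hr, hs, sub_eq_add_neg, zpow_add₀ h0, zpow_add₀ h0, zpow_natCast]
    have := c.ne_zero
    field_simp)
  omega

omit [IsDomain R] [IsDiscreteValuationRing R] in
theorem within_powGL (i j : ℤ) : Within π (i - j).natAbs (powGL K hπ i j) := by
  have h0 : algebraMap R K π ≠ 0 := by simpa using hπ.ne_zero
  -- This scalar makes the diagonal matrix primitive: its entries become 1 and π^|i - j|.
  refine ⟨toUnit K hπ ^ (-(min i j)), ?_, ?_⟩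
  · rw [powGL, smul_diagGL_mem_intMat]
    simp only [toUnit, Units.val_zpow_eq_zpow_val, Units.val_mk0]
    rw [← zpow_add₀ h0, ← zpow_add₀ h0, zpow_mem_range hπ, zpow_mem_range hπ]
    omega
  · rw [powGL, diagGL_inv, smul_diagGL_mem_intMat]
    simp only [toUnit, Units.val_zpow_eq_zpow_val, Units.val_mk0, ← zpow_neg]
    rw [← zpow_natCast, ← zpow_add₀ h0, ← zpow_add₀ h0, ← zpow_add₀ h0, zpow_mem_range hπ,
      zpow_mem_range hπ]
    omega

end Smith

/-! ### The combinatorial distance is the distance in the graph. -/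

section Distance

variable {R K : Type*} [CommRing R] [Field K] [Algebra R K]
variable [IsDomain R] [IsDiscreteValuationRing R] [IsFractionRing R K]
variable {π : R} (hπ : Irreducible π)

omit [IsDomain R] [IsDiscreteValuationRing R] in
theorem atDistance_powGL (g : GL (Fin 2) K) (i j : ℤ) :
    AtDistance (vtx R g) (vtx R (g * powGL K hπ i j)) (i - j).natAbs := by
  let e : Module.Basis (Fin 2) K (Fin 2 → K) :=
    (Pi.basisFun K (Fin 2)).map (Matrix.GeneralLinearGroup.toLin g).toLinearEquiv
  have he : ∀ k, e k = (g : Matrix (Fin 2) (Fin 2) K).col k := fun k => by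
    simp [e, Matrix.GeneralLinearGroup.toLin]
  refine ⟨(stdLattice R K).act g, (stdLattice R K).act (g * powGL K hπ i j), π, e, i, j, rfl, rfl,
    hπ, ?_, ?_, rfl⟩
  · rw [he, he]
    exact matMap_std _
  · rw [he, he]
    refine (matMap_std _).trans ?_
    rw [powGL, Units.val_mul, coe_diagGL]
    congr 2
    · ext k
      simp [Matrix.mul_apply, toUnit, mul_comm]
    · congr 1
      ext k
      simp [Matrix.mul_apply, toUnit, mul_comm]

-- The definition allows any uniformizer; two of them differ by a unit, and the resulting diagonal
-- matrix of units is absorbed by R². Hence one fixed π suffices.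
include hπ in
theorem atDistance_iff {P Q : Vertex R K} {n : ℕ} : AtDistance P Q n ↔
    ∃ (g : GL (Fin 2) K) (i j : ℤ), P = vtx R g ∧ Q = vtx R (g * powGL K hπ i j) ∧
      (i - j).natAbs = n := by
  constructor
  · rintro ⟨L, L', π', e, i, j, rfl, rfl, hπ', hL, hL', rfl⟩
    have hdet : IsUnit ((Pi.basisFun K (Fin 2)).toMatrix e) :=
      @isUnit_of_invertible _ _ _ ((Pi.basisFun K (Fin 2)).invertibleToMatrix e)
    obtain ⟨g, hg⟩ := hdet
    have hc : ∀ i, (g : Matrix (Fin 2) (Fin 2) K).col i = e i := by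
      intro i
      ext j
      rw [hg, Matrix.col_apply, Module.Basis.toMatrix_apply, Pi.basisFun_repr]
    refine ⟨g, i, j, ?_, ?_, rfl⟩
    · refine congrArg (Quotient.mk (homothety R K)) (Subtype.ext ?_)
      rw [hL, ← hc, ← hc]
      exact (matMap_std _).symm
    · have h1 : Quotient.mk (homothety R K) L' = vtx R (g * powGL K hπ' i j) := by
        refine congrArg (Quotient.mk (homothety R K)) (Subtype.ext ?_)
        rw [hL', ← hc, ← hc]
        refine Eq.trans ?_ (matMap_std _).symm
        rw [powGL, Units.val_mul, coe_diagGL]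
        congr 2
        · ext k
          simp [Matrix.mul_apply, toUnit, mul_comm]
        · congr 1
          ext k
          simp [Matrix.mul_apply, toUnit, mul_comm]
      obtain ⟨u, hu⟩ := IsDiscreteValuationRing.associated_of_irreducible R hπ hπ'
      have h2 : toUnit K hπ' = toUnit K hπ * Units.map (algebraMap R K).toMonoidHom u := by
        apply Units.ext
        simp [toUnit, ← hu]
      have h3 : powGL K hπ' i j = powGL K hπ i j *
          diagGL (Units.map (algebraMap R K).toMonoidHom (u ^ i))
            (Units.map (algebraMap R K).toMonoidHom (u ^ j)) := by
        rw [powGL, powGL, diagGL_mul, h2, mul_zpow, mul_zpow, map_zpow, map_zpow]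
      rw [h1, h3, ← mul_assoc, vtx_mul_of_mem (diagGL_mem_intGL _ _)]
  · rintro ⟨g, i, j, rfl, rfl, rfl⟩
    exact atDistance_powGL hπ g i j

theorem AtDistance.symm {P Q : Vertex R K} {n : ℕ} (h : AtDistance P Q n) : AtDistance Q P n := by
  obtain ⟨π, hπ⟩ := IsDiscreteValuationRing.exists_irreducible R
  obtain ⟨g, i, j, rfl, rfl, rfl⟩ := (atDistance_iff hπ).1 h
  refine (atDistance_iff hπ).2 ⟨_, -i, -j, rfl, ?_, by omega⟩
  rw [← powGL_inv, mul_inv_cancel_right]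

theorem AtDistance.act {P Q : Vertex R K} {n : ℕ} (h : AtDistance P Q n) (g : GL (Fin 2) K) :
    AtDistance (P.act g) (Q.act g) n := by
  obtain ⟨π, hπ⟩ := IsDiscreteValuationRing.exists_irreducible R
  obtain ⟨g', i, j, rfl, rfl, rfl⟩ := (atDistance_iff hπ).1 h
  refine (atDistance_iff hπ).2 ⟨g * g', i, j, act_vtx _ _, ?_, rfl⟩
  rw [act_vtx, mul_assoc]

theorem exists_atDistance (P Q : Vertex R K) : ∃ n, AtDistance P Q n := by
  obtain ⟨π, hπ⟩ := IsDiscreteValuationRing.exists_irreducible R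
  obtain ⟨g, rfl⟩ := exists_eq_vtx P
  obtain ⟨h, rfl⟩ := exists_eq_vtx Q
  obtain ⟨U, hU, V, hV, i, j, hm⟩ := exists_smith hπ (g⁻¹ * h)
  refine ⟨_, (atDistance_iff hπ).2 ⟨g * U, i, j, (vtx_mul_of_mem hU).symm, ?_, rfl⟩⟩
  rw [inv_mul_eq_iff_eq_mul] at hm
  rw [hm, ← mul_assoc, ← mul_assoc, vtx_mul_of_mem hV]

include hπ in
theorem AtDistance.within {g h : GL (Fin 2) K} {n : ℕ} (H : AtDistance (vtx R g) (vtx R h) n) :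
    Within π n (g⁻¹ * h) := by
  obtain ⟨g', i, j, h1, h2, rfl⟩ := (atDistance_iff hπ).1 H
  rw [vtx_eq_iff π] at h1
  rw [eq_comm, vtx_eq_iff π] at h2
  have := (h1.mul (within_powGL hπ i j)).mul h2
  rw [zero_add, add_zero] at this
  convert this using 1
  group

-- Together with `AtDistance.within`, this shows that the distance is the least m for which `Within
-- π m` holds; in particular it is well defined.
include hπ in
theorem AtDistance.le_of_within {g h : GL (Fin 2) K} {n m : ℕ}
    (H : AtDistance (vtx R g) (vtx R h) n) (hw : Within π m (g⁻¹ * h)) : n ≤ m := by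
  obtain ⟨g', i, j, h1, h2, rfl⟩ := (atDistance_iff hπ).1 H
  rw [eq_comm, vtx_eq_iff π] at h1
  rw [vtx_eq_iff π] at h2
  have := (h1.mul hw).mul h2
  rw [zero_add, add_zero] at this
  refine Within.le (K := K) hπ ?_
  convert this using 1
  group

theorem tree_adj {P Q : Vertex R K} : (tree R K).Adj P Q ↔ AtDistance P Q 1 := by
  rw [tree, SimpleGraph.fromRel_adj]
  constructor
  · rintro ⟨-, h | h⟩
    · exact h
    · exact h.symm
  · intro h
    refine ⟨?_, Or.inl h⟩
    rintro rfl
    obtain ⟨π, hπ⟩ := IsDiscreteValuationRing.exists_irreducible R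
    obtain ⟨g, rfl⟩ := exists_eq_vtx P
    have := h.le_of_within hπ (m := 0) (by
      rw [inv_mul_cancel]
      exact within_zero_of_mem_intGL π (one_mem _))
    omega

-- The lower bound for the graph distance: each edge contributes a factor π, by submultiplicativity
-- of `Within`.
include hπ in
theorem within_of_walk {P Q : Vertex R K} (w : (tree R K).Walk P Q) {g h : GL (Fin 2) K}
    (hg : P = vtx R g) (hh : Q = vtx R h) : Within π w.length (g⁻¹ * h) := by
  induction w generalizing g with
  | nil =>
    rw [hg] at hh
    exact (vtx_eq_iff π).1 hh
  | @cons u v w a p ih =>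
    obtain ⟨g', rfl⟩ := exists_eq_vtx v
    subst hg
    have := ((tree_adj.1 a).within hπ).mul (ih rfl hh)
    rw [SimpleGraph.Walk.length_cons, add_comm]
    convert this using 1
    group

include hπ in
theorem exists_walk (g : GL (Fin 2) K) (n : ℕ) : ∀ i j : ℤ, (i - j).natAbs = n →
    ∃ w : (tree R K).Walk (vtx R g) (vtx R (g * powGL K hπ i j)), w.length = n := by
  induction n with
  | zero =>
    intro i j hij
    obtain rfl : i = j := by omega
    rw [powGL, vtx_mul_diagGL_self]
    exact ⟨.nil, rfl⟩
  | succ n ih =>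
    intro i j hij
    obtain ⟨i', j', h1, h2⟩ : ∃ i' j' : ℤ, (i' - j').natAbs = n ∧
        ((i - i') - (j - j')).natAbs = 1 := by
      -- Raising the smaller exponent by one gives a vertex one step nearer to the start.
      rcases lt_or_ge i j with h | h
      · exact ⟨i + 1, j, by omega, by omega⟩
      · exact ⟨i, j + 1, by omega, by omega⟩
    obtain ⟨w, hw⟩ := ih i' j' h1
    have ha := atDistance_powGL hπ (g * powGL K hπ i' j') (i - i') (j - j')
    rw [h2, mul_assoc, powGL_mul, add_sub_cancel, add_sub_cancel, ← tree_adj] at ha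
    exact ⟨w.concat ha, by rw [SimpleGraph.Walk.length_concat, hw]⟩

theorem AtDistance.exists_walk {P Q : Vertex R K} {n : ℕ} (h : AtDistance P Q n) :
    ∃ w : (tree R K).Walk P Q, w.length = n := by
  obtain ⟨π, hπ⟩ := IsDiscreteValuationRing.exists_irreducible R
  obtain ⟨g, i, j, rfl, rfl, rfl⟩ := (atDistance_iff hπ).1 h
  exact BruhatTits.exists_walk hπ g _ i j rfl

variable (R K) in
theorem tree_preconnected : (tree R K).Preconnected := by
  intro P Q
  obtain ⟨n, hn⟩ := exists_atDistance P Q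
  exact hn.exists_walk.choose.reachable

theorem AtDistance.dist_eq {P Q : Vertex R K} {n : ℕ} (h : AtDistance P Q n) :
    (tree R K).dist P Q = n := by
  apply le_antisymm
  · obtain ⟨w, hw⟩ := h.exists_walk
    exact hw ▸ SimpleGraph.dist_le w
  · obtain ⟨π, hπ⟩ := IsDiscreteValuationRing.exists_irreducible R
    -- `SimpleGraph.dist` is 0 for unreachable vertices, so connectedness is needed to have a walk
    -- realizing it.
    obtain ⟨w, hw⟩ := (tree_preconnected R K P Q).exists_walk_length_eq_dist
    obtain ⟨g, rfl⟩ := exists_eq_vtx P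
    obtain ⟨g', rfl⟩ := exists_eq_vtx Q
    rw [← hw]
    exact h.le_of_within hπ (within_of_walk hπ w rfl rfl)

theorem dist_act (P Q : Vertex R K) (g : GL (Fin 2) K) :
    (tree R K).dist (P.act g) (Q.act g) = (tree R K).dist P Q := by
  obtain ⟨n, hn⟩ := exists_atDistance P Q
  rw [hn.dist_eq, (hn.act g).dist_eq]

theorem exists_adj_mem_segment {P Q : Vertex R K} (h : (tree R K).dist P Q ≠ 0) :
    ∃ V, (tree R K).Adj P V ∧ V ∈ segment P Q := by
  obtain ⟨w, hw⟩ := (tree_preconnected R K P Q).exists_walk_length_eq_dist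
  cases w with
  | nil => exact absurd hw.symm h
  | @cons _ v _ a p => exact ⟨v, a, .cons a p, hw, by simp⟩

theorem dist_of_adj_of_mem_segment {P Q V : Vertex R K} (ha : (tree R K).Adj P V)
    (hV : V ∈ segment P Q) : (tree R K).dist P Q = (tree R K).dist V Q + 1 := by
  classical
  obtain ⟨w, hw, hV⟩ := hV
  apply le_antisymm
  · obtain ⟨w', hw'⟩ := (tree_preconnected R K V Q).exists_walk_length_eq_dist
    rw [← hw']
    exact SimpleGraph.dist_le (.cons ha w')
  · have h1 := congrArg SimpleGraph.Walk.length (w.take_spec hV)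
    rw [SimpleGraph.Walk.length_append, hw] at h1
    have h2 := SimpleGraph.dist_le (w.dropUntil V hV)
    have h3 : (w.takeUntil V hV).length ≠ 0 := fun h =>
      ha.ne (SimpleGraph.Walk.eq_of_length_eq_zero h)
    omega

end Distance

end BruhatTits

namespace BruhatTits

open scoped Matrix

/-! ### Vertices fixed by a group of units. -/

section Fixed

variable {R K : Type*} [CommRing R] [Field K] [Algebra R K]

theorem exists_unit_of_mem_of_inv_mem [IsDomain R] [IsFractionRing R K] {x : K} (hx0 : x ≠ 0)
    (hx : x ∈ (algebraMap R K).range) (hx' : x⁻¹ ∈ (algebraMap R K).range) :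
    ∃ u : Rˣ, x = algebraMap R K u := by
  obtain ⟨a, rfl⟩ := hx
  obtain ⟨b, hb⟩ := hx'
  have hab : a * b = 1 := IsFractionRing.injective R K (by
    rw [map_mul, hb, map_one, mul_inv_cancel₀ hx0])
  exact ⟨⟨a, b, hab, by rw [mul_comm, hab]⟩, rfl⟩

theorem exists_unit_det [IsDomain R] [IsFractionRing R K] {U : GL (Fin 2) K}
    (hU : U ∈ intGL R K) :
    ∃ u : Rˣ, (U : Matrix (Fin 2) (Fin 2) K).det = algebraMap R K u := by
  rw [mem_intGL] at hU
  refine exists_unit_of_mem_of_inv_mem ?_ (det_mem_of_mem_intMat hU.1) ?_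
  · exact (Matrix.isUnits_det_units U).ne_zero
  · have h := det_mem_of_mem_intMat hU.2
    rwa [Matrix.coe_units_inv, Matrix.det_nonsing_inv, Ring.inverse_eq_inv'] at h

theorem smul_mem_intMat_iff_of_mul {U V : GL (Fin 2) K} (hU : U ∈ intGL R K) (hV : V ∈ intGL R K)
    (c : K) (m : GL (Fin 2) K) : c • ((U * m * V : GL (Fin 2) K) : Matrix (Fin 2) (Fin 2) K)
      ∈ intMat R K ↔ c • (m : Matrix (Fin 2) (Fin 2) K) ∈ intMat R K := by
  rw [mem_intGL] at hU hV
  constructor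
  · intro h
    have := mul_mem (mul_mem hU.2 h) hV.2
    rw [mul_smul_comm, smul_mul_assoc, ← Units.val_mul, ← Units.val_mul] at this
    convert this using 3
    group
  · intro h
    have := mul_mem (mul_mem hU.1 h) hV.1
    rwa [mul_smul_comm, smul_mul_assoc, ← Units.val_mul, ← Units.val_mul] at this

variable [IsDomain R] [IsDiscreteValuationRing R] [IsFractionRing R K]
variable {π : R} (hπ : Irreducible π)

include hπ in
/-- The distance from `g R²` to `g m R²` in terms of the elementary divisors of `m`. -/
theorem exists_dist_eq (g m : GL (Fin 2) K) : ∃ i j : ℤ,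
    (tree R K).dist (vtx R g) (vtx R (g * m)) = (i - j).natAbs ∧
    (∃ u : Rˣ, (m : Matrix (Fin 2) (Fin 2) K).det =
      algebraMap R K u * (algebraMap R K π) ^ (i + j)) ∧
    ∀ n : ℤ, (algebraMap R K π) ^ (-n) • (m : Matrix (Fin 2) (Fin 2) K) ∈ intMat R K ↔
      n ≤ i ∧ n ≤ j := by
  have h0 : algebraMap R K π ≠ 0 := by simpa using hπ.ne_zero
  obtain ⟨U, hU, V, hV, i, j, rfl⟩ := exists_smith hπ m
  refine ⟨i, j, ?_, ?_, ?_⟩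
  · rw [← mul_assoc, vtx_mul_of_mem hV, ← mul_assoc, ← vtx_mul_of_mem (g := g) hU]
    exact (atDistance_powGL hπ _ i j).dist_eq
  · obtain ⟨u, hu⟩ := exists_unit_det hU
    obtain ⟨v, hv⟩ := exists_unit_det hV
    refine ⟨u * v, ?_⟩
    rw [Units.val_mul, Units.val_mul, Matrix.det_mul, Matrix.det_mul, hu, hv, powGL, det_diagGL]
    simp only [toUnit, Units.val_zpow_eq_zpow_val, Units.val_mk0, zpow_add₀ h0, Units.val_mul,
      map_mul]
    ring
  · intro n
    rw [smul_mem_intMat_iff_of_mul hU hV, powGL, smul_diagGL_mem_intMat]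
    simp only [toUnit, Units.val_zpow_eq_zpow_val, Units.val_mk0]
    rw [← zpow_add₀ h0, ← zpow_add₀ h0, zpow_mem_range hπ, zpow_mem_range hπ]
    omega

/-- An element with unit determinant which fixes the vertex of `h R²` is conjugate under `h` to an
element of `GL₂(R)`. -/
theorem conj_mem_intGL_of_fixed {h y : GL (Fin 2) K} (hfix : (vtx R h).act y = vtx R h)
    {u : Rˣ} (hy : (y : Matrix (Fin 2) (Fin 2) K).det = algebraMap R K u) :
    h⁻¹ * y * h ∈ intGL R K := by
  obtain ⟨π, hπ⟩ := IsDiscreteValuationRing.exists_irreducible R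
  rw [act_vtx, eq_comm, vtx_eq_iff π, ← mul_assoc] at hfix
  obtain ⟨c, hc, hc'⟩ := hfix
  set x := h⁻¹ * y * h with hx
  have hdet : (x : Matrix (Fin 2) (Fin 2) K).det = algebraMap R K u := by
    rw [hx, Units.val_mul, Units.val_mul, Matrix.det_mul, Matrix.det_mul, hy, mul_comm, ← mul_assoc,
      ← Matrix.det_mul, ← Units.val_mul, mul_inv_cancel]
    simp
  have hu0 : algebraMap R K u ≠ 0 := by simp
  have huinv : (algebraMap R K u)⁻¹ = algebraMap R K (u⁻¹ : Rˣ) :=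
    inv_eq_of_mul_eq_one_right (by rw [← map_mul, Units.mul_inv, map_one])
  obtain ⟨v, n, rfl⟩ := exists_unit_mul_zpow hπ c
  have h0 : algebraMap R K π ≠ 0 := by simpa using hπ.ne_zero
  have hv0 : algebraMap R K v ≠ 0 := by simp
  have hvinv : (algebraMap R K v)⁻¹ = algebraMap R K (v⁻¹ : Rˣ) :=
    inv_eq_of_mul_eq_one_right (by rw [← map_mul, Units.mul_inv, map_one])
  have d1 := det_mem_of_mem_intMat hc
  have d2 := det_mem_of_mem_intMat hc'
  rw [Matrix.det_smul, hdet] at d1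
  rw [Matrix.det_smul, Matrix.coe_units_inv, Matrix.det_nonsing_inv, Ring.inverse_eq_inv',
    hdet] at d2
  -- Both the scaled matrix and its inverse have integral determinant, and the unscaled determinant
  -- is a unit. So the square of the scalar c is a unit, and the exponent n of π in c is 0.
  have n1 : 0 ≤ 2 * n := by
    rw [← zpow_mem_range (K := K) hπ]
    have := mul_mem d1 (⟨_, rfl⟩ : algebraMap R K ((v⁻¹ : Rˣ) ^ 2 * (u⁻¹ : Rˣ)) ∈
      (algebraMap R K).range)
    convert this using 1
    rw [map_mul, map_pow, ← hvinv, ← huinv, two_mul, zpow_add₀ h0]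
    simp [toUnit]
    field_simp
  have n2 : 0 ≤ -(2 * n) := by
    rw [← zpow_mem_range (K := K) hπ]
    have := mul_mem d2 (⟨_, rfl⟩ : algebraMap R K ((v : R) ^ 2 * (u : R)) ∈
      (algebraMap R K).range)
    convert this using 1
    rw [map_mul, map_pow, two_mul, neg_add, zpow_add₀ h0, zpow_neg]
    simp [toUnit]
    field_simp
  obtain rfl : n = 0 := by omega
  refine mem_intGL_of_det ?_ (by rw [hdet, huinv]; exact ⟨_, rfl⟩)
  have := smul_mem_intMat (⟨_, rfl⟩ : algebraMap R K (v⁻¹ : Rˣ) ∈ (algebraMap R K).range) hc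
  rw [smul_smul, ← hvinv] at this
  simpa [hv0] using this

include hπ in
omit [IsDomain R] [IsDiscreteValuationRing R] in
theorem zpow_mul_mem_range_of_between {b : K} (hb : b ∈ (algebraMap R K).range) {k l : ℤ}
    (hl : (algebraMap R K π) ^ l * b ∈ (algebraMap R K).range) (h : 0 ≤ k ∨ l ≤ k) :
    (algebraMap R K π) ^ k * b ∈ (algebraMap R K).range := by
  have h0 : algebraMap R K π ≠ 0 := by simpa using hπ.ne_zero
  rcases h with h | h
  · exact mul_mem ((zpow_mem_range hπ).2 h) hb
  · have := mul_mem ((zpow_mem_range (K := K) hπ).2 (sub_nonneg.2 h)) hl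
    rwa [← mul_assoc, ← zpow_add₀ h0, sub_add_cancel] at this

omit [IsDomain R] [IsDiscreteValuationRing R] in
theorem conj_powGL (i j : ℤ) (w : GL (Fin 2) K) :
    (((powGL K hπ i j)⁻¹ * w * powGL K hπ i j : GL (Fin 2) K) : Matrix (Fin 2) (Fin 2) K) =
      !![w 0 0, (algebraMap R K π) ^ (j - i) * w 0 1;
        (algebraMap R K π) ^ (i - j) * w 1 0, w 1 1] := by
  have h0 : algebraMap R K π ≠ 0 := by simpa using hπ.ne_zero
  rw [Units.val_mul, Units.val_mul, powGL, diagGL_inv, coe_diagGL, coe_diagGL,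
    Matrix.eta_fin_two (w : Matrix (Fin 2) (Fin 2) K), Matrix.mul_fin_two, Matrix.mul_fin_two]
  ext a b
  fin_cases a <;> fin_cases b <;> simp [toUnit, zpow_sub₀ h0] <;> field_simp

/-- The fixed set is convex: conjugation multiplies the off-diagonal entries by opposite powers of
π, so integrality at both ends of a segment gives integrality in between. The disjunctions say that
j' - i' lies between 0 and j - i. -/
theorem conj_powGL_mem_of_between {i j i' j' : ℤ} {w : GL (Fin 2) K} (hw : w ∈ intGL R K)
    (h : (powGL K hπ i j)⁻¹ * w * powGL K hπ i j ∈ intGL R K)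
    (h1 : 0 ≤ j' - i' ∨ j - i ≤ j' - i') (h2 : 0 ≤ i' - j' ∨ i - j ≤ i' - j') :
    (powGL K hπ i' j')⁻¹ * w * powGL K hπ i' j' ∈ intGL R K := by
  have key : ∀ w : GL (Fin 2) K, (w : Matrix (Fin 2) (Fin 2) K) ∈ intMat R K →
      (((powGL K hπ i j)⁻¹ * w * powGL K hπ i j : GL (Fin 2) K) : Matrix (Fin 2) (Fin 2) K)
        ∈ intMat R K →
      (((powGL K hπ i' j')⁻¹ * w * powGL K hπ i' j' : GL (Fin 2) K) : Matrix (Fin 2) (Fin 2) K)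
        ∈ intMat R K := by
    intro w hw h
    rw [conj_powGL] at h ⊢
    rw [mem_intMat] at hw h
    exact intMat_of (hw 0 0) (zpow_mul_mem_range_of_between hπ (hw 0 1) (h 0 1) h1)
      (zpow_mul_mem_range_of_between hπ (hw 1 0) (h 1 0) h2) (hw 1 1)
  rw [mem_intGL] at hw h ⊢
  refine ⟨key w hw.1 h.1, ?_⟩
  have h3 := key w⁻¹ hw.2 (by
    convert h.2 using 2
    group)
  convert h3 using 2
  group

/-- If a set of elements stabilizing the lattice `g R²` fixes the vertex `P` and moves all
neighbours of `P` to one and the same vertex, then `P` is the class of `g R²`. -/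
theorem eq_vtx_of_fixed {H : Set (GL (Fin 2) K)} {g : GL (Fin 2) K}
    (hg : ∀ u ∈ H, g⁻¹ * u * g ∈ intGL R K) {P P' : Vertex R K} (hP : ∀ u ∈ H, P.act u = P)
    (hP' : ∀ V, (tree R K).Adj P V → ∃ u ∈ H, V.act u = P') : P = vtx R g := by
  obtain ⟨π, hπ⟩ := IsDiscreteValuationRing.exists_irreducible R
  obtain ⟨h, rfl⟩ := exists_eq_vtx P
  obtain ⟨U, hU, V, hV, i, j, hm⟩ := exists_smith hπ (g⁻¹ * h)
  have hh : vtx R h = vtx R (g * U * powGL K hπ i j) := by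
    rw [inv_mul_eq_iff_eq_mul] at hm
    rw [hm, ← mul_assoc, ← mul_assoc, vtx_mul_of_mem hV]
  rw [hh] at hP hP' ⊢
  set g' := g * U with hg'
  have hgu : ∀ u ∈ H, g'⁻¹ * u * g' ∈ intGL R K := by
    intro u hu
    have := mul_mem (mul_mem (inv_mem hU) (hg u hu)) hU
    convert this using 1
    rw [hg']
    group
  -- By convexity, `H` fixes every vertex of the segment from g R² to P.
  have hfix : ∀ i' j' : ℤ, (0 ≤ j' - i' ∨ j - i ≤ j' - i') → (0 ≤ i' - j' ∨ i - j ≤ i' - j') →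
      ∀ u ∈ H, (vtx R (g' * powGL K hπ i' j')).act u = vtx R (g' * powGL K hπ i' j') := by
    intro i' j' h1 h2 u hu
    obtain ⟨d, hd⟩ := exists_unit_det (hgu u hu)
    have h3 := conj_mem_intGL_of_fixed (hP u hu) (u := d) (by
      rw [← hd, Units.val_mul, Units.val_mul, Matrix.det_mul, Matrix.det_mul, mul_right_comm,
        ← Matrix.det_mul, ← Units.val_mul, inv_mul_cancel]
      simp)
    have h4 := conj_powGL_mem_of_between hπ (hgu u hu) (by
      convert h3 using 1
      group) h1 h2
    rw [act_vtx, ← vtx_mul_of_mem (g := g' * powGL K hπ i' j') h4]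
    congr 1
    group
  have hadj : ∀ i' j' : ℤ, ((i' - i) - (j' - j)).natAbs = 1 →
      (tree R K).Adj (vtx R (g' * powGL K hπ i j)) (vtx R (g' * powGL K hπ i' j')) := by
    intro i' j' h1
    have h2 := atDistance_powGL hπ (g' * powGL K hπ i j) (i' - i) (j' - j)
    rw [h1, mul_assoc g', powGL_mul, add_sub_cancel, add_sub_cancel] at h2
    exact tree_adj.2 h2
  -- If a neighbour V of P lies on the segment towards g R², it is fixed by `H`, hence equal to P'.
  -- Any other neighbour is sent to P' = V by an element that fixes V, so it is V as well and has
  -- the same distance to g R².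
  have main : ∀ i' j' i'' j'' : ℤ, ((i' - i) - (j' - j)).natAbs = 1 →
      ((i'' - i) - (j'' - j)).natAbs = 1 → (0 ≤ j' - i' ∨ j - i ≤ j' - i') →
      (0 ≤ i' - j' ∨ i - j ≤ i' - j') → (i' - j').natAbs = (i'' - j'').natAbs := by
    intro i' j' i'' j'' h1 h2 h3 h4
    obtain ⟨u, hu, hu'⟩ := hP' _ (hadj i' j' h1)
    obtain ⟨v, hv, hv'⟩ := hP' _ (hadj i'' j'' h2)
    rw [hfix i' j' h3 h4 u hu] at hu'
    rw [← hu', ← hfix i' j' h3 h4 v hv] at hv'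
    have h5 := congrArg (Vertex.act v⁻¹) hv'
    rw [act_act, act_act, inv_mul_cancel, one_act, one_act] at h5
    rw [← (atDistance_powGL hπ g' i' j').dist_eq, ← (atDistance_powGL hπ g' i'' j'').dist_eq, h5]
  -- For i ≠ j, one neighbour is nearer to g R² and another is farther, against `main`.
  rcases lt_trichotomy i j with hij | rfl | hij
  · have := main (i + 1) j (i - 1) j (by omega) (by omega) (by omega) (by omega)
    omega
  · rw [powGL, vtx_mul_diagGL_self, hg', vtx_mul_of_mem hU]
  · have := main i (j + 1) i (j - 1) (by omega) (by omega) (by omega) (by omega)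
    omega

end Fixed

end BruhatTits

namespace Quat

open BruhatTits WithZero

/-! ### Local facts about the completion at p. -/

section Field

variable {F : Type*} [Field F] [NumberField F] (p : HeightOneSpectrum (𝓞 F))

variable {p} in
theorem mem_range_iff {x : p.adicCompletion F} :
    x ∈ (algebraMap (p.adicCompletionIntegers F) (p.adicCompletion F)).range ↔
      Valued.v x ≤ 1 := by
  rw [← HeightOneSpectrum.mem_adicCompletionIntegers]
  exact ⟨fun ⟨r, hr⟩ => hr ▸ r.2, fun h => ⟨⟨x, h⟩, rfl⟩⟩

theorem valued_algebraMap (f : F) :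
    Valued.v (algebraMap F (p.adicCompletion F) f) = p.valuation F f :=
  HeightOneSpectrum.valuedAdicCompletion_eq_valuation' p f

theorem valued_algebraMap_int (s : 𝓞 F) :
    Valued.v (algebraMap F (p.adicCompletion F) (algebraMap (𝓞 F) F s)) = p.intValuation s := by
  rw [valued_algebraMap, HeightOneSpectrum.valuation_of_algebraMap]

theorem algebraMap_int_mem_range (s : 𝓞 F) :
    algebraMap F (p.adicCompletion F) (algebraMap (𝓞 F) F s) ∈
      (algebraMap (p.adicCompletionIntegers F) (p.adicCompletion F)).range := by
  rw [mem_range_iff, valued_algebraMap_int]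
  exact p.intValuation_le_one s

theorem exists_valued_sub_lt (x : p.adicCompletion F) :
    ∃ f : F, Valued.v (x - algebraMap F (p.adicCompletion F) f) < 1 := by
  have hd := HeightOneSpectrum.denseRange_algebraMap F p
  have hopen : IsOpen {y : p.adicCompletion F | Valued.v (x - y) < 1} := by
    have h1 : IsOpen {y : p.adicCompletion F | Valued.v y < 1} := by
      simpa only [Valuation.restrict_lt_one_iff] using Valued.isOpen_ball (p.adicCompletion F) 1
    exact h1.preimage (continuous_const.sub continuous_id)
  obtain ⟨f, hf⟩ := hd.exists_mem_open hopen ⟨x, by simp⟩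
  exact ⟨f, hf⟩

/-- A uniformizer at `p` in the ring of integers. -/
theorem exists_uniformizer : ∃ t : 𝓞 F, t ∈ p.asIdeal ∧ p.intValuation t = exp (-1 : ℤ) ∧
    Irreducible (algebraMap (𝓞 F) (p.adicCompletionIntegers F) t) := by
  obtain ⟨t, ht⟩ := p.intValuation_exists_uniformizer
  have hv : Valued.v ((algebraMap (𝓞 F) (p.adicCompletionIntegers F) t : p.adicCompletion F)) =
      exp (-1 : ℤ) := by
    rw [← ht]
    exact valued_algebraMap_int p t
  have h0 : (algebraMap (𝓞 F) (p.adicCompletionIntegers F) t : p.adicCompletion F) ≠ 0 := by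
    intro h
    rw [h, map_zero] at hv
    exact exp_ne_zero hv.symm
  refine ⟨t, ?_, ht, ?_⟩
  · rw [← HeightOneSpectrum.intValuation_lt_one_iff_mem, ht, ← exp_zero, exp_lt_exp]
    norm_num
  · rw [IsDiscreteValuationRing.irreducible_iff_uniformizer]
    ext x
    rw [IsLocalRing.mem_maximalIdeal, mem_nonunits_iff,
      HeightOneSpectrum.adicCompletionIntegers.isUnit_iff_valued_eq_one,
      Ideal.mem_span_singleton']
    have hx1 : Valued.v (x : p.adicCompletion F) ≤ 1 := x.2
    constructor
    · intro hx
      -- The value group is discrete, so being less than 1 means being at most exp(-1).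
      have hlt : Valued.v (x : p.adicCompletion F) ≤ exp (-1 : ℤ) := by
        rcases eq_or_ne (Valued.v (x : p.adicCompletion F)) 0 with h | h
        · rw [h]
          exact zero_le
        · have h2 := lt_of_le_of_ne hx1 hx
          rw [← exp_log h, ← exp_zero, exp_lt_exp] at h2
          rw [← exp_log h, exp_le_exp]
          omega
      refine ⟨⟨x * (algebraMap (𝓞 F) (p.adicCompletionIntegers F) t : p.adicCompletion F)⁻¹, ?_⟩, ?_⟩
      · rw [HeightOneSpectrum.mem_adicCompletionIntegers, map_mul, map_inv₀, hv]
        exact mul_inv_le_one_of_le₀ hlt zero_le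
      · apply Subtype.ext
        exact inv_mul_cancel_right₀ h0 _
    · rintro ⟨a, rfl⟩ h
      have ha : Valued.v (a : p.adicCompletion F) ≤ 1 := a.2
      change Valued.v ((a : p.adicCompletion F) *
        (algebraMap (𝓞 F) (p.adicCompletionIntegers F) t : p.adicCompletion F)) = 1 at h
      rw [map_mul, hv] at h
      have : (1 : ℤᵐ⁰) ≤ 1 * exp (-1 : ℤ) := by
        nth_rw 1 [← h]
        exact mul_le_mul_left ha _
      rw [one_mul, ← exp_zero, exp_le_exp] at this
      norm_num at this

theorem exists_notMem_of_ne {q : HeightOneSpectrum (𝓞 F)} (hq : q ≠ p) :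
    ∃ t ∈ p.asIdeal, t ∉ q.asIdeal := by
  by_contra! h
  exact hq (HeightOneSpectrum.ext (p.isMaximal.eq_of_le q.isPrime.ne_top h).symm)

end Field

/-! ### Reduced trace and norm as matrix trace and determinant. -/

section Trace

variable {F A : Type*} [Field F] [NumberField F] [Ring A] [Algebra F A]
variable {p : HeightOneSpectrum (𝓞 F)}

/-- The embedding of the algebra into the algebra of matrices given by a splitting. -/
noncomputable def loc (φ : Splitting A p) : A →ₐ[F] Matrix (Fin 2) (Fin 2) (p.adicCompletion F) :=
  (φ.toAlgHom.restrictScalars F).comp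
    (Algebra.TensorProduct.includeRight : A →ₐ[F] Completion A p)

theorem loc_apply (φ : Splitting A p) (a : A) : loc φ a = φ (1 ⊗ₜ a) := rfl

theorem loc_injective (φ : Splitting A p) : Function.Injective (loc φ) :=
  φ.injective.comp
    (Algebra.TensorProduct.includeRight_injective (algebraMap F (p.adicCompletion F)).injective)

theorem loc_smul (φ : Splitting A p) (f : F) (a : A) :
    loc φ (f • a) = algebraMap F (p.adicCompletion F) f • loc φ a := by
  rw [map_smul, algebraMap_smul]

theorem loc_smul_int (φ : Splitting A p) (s : 𝓞 F) (a : A) :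
    loc φ (s • a) = algebraMap F (p.adicCompletion F) (algebraMap (𝓞 F) F s) • loc φ a := by
  rw [← loc_smul, algebraMap_smul]

theorem loc_algebraMap (φ : Splitting A p) (f : F) :
    loc φ (algebraMap F A f) = algebraMap F (p.adicCompletion F) f • 1 := by
  rw [Algebra.algebraMap_eq_smul_one, loc_smul, map_one]

theorem algebraMap_injective (φ : Splitting A p) : Function.Injective (algebraMap F A) :=
  fun x y h => by
    have h' := congrArg (fun m => loc φ m 0 0) h
    simpa only [loc_algebraMap, Matrix.smul_apply, Matrix.one_apply_eq, smul_eq_mul, mul_one,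
      (algebraMap F (p.adicCompletion F)).injective.eq_iff] using h'

theorem trace_mulLeft_matrix {K : Type*} [Field K] (m : Matrix (Fin 2) (Fin 2) K) :
    LinearMap.trace K (Matrix (Fin 2) (Fin 2) K) (LinearMap.mul K _ m) = 2 * m.trace := by
  rw [LinearMap.trace_eq_matrix_trace K (Matrix.stdBasis K (Fin 2) (Fin 2)), Matrix.trace,
    Fintype.sum_prod_type]
  simp [LinearMap.toMatrix_apply, Matrix.stdBasis, Matrix.trace_fin_two, Matrix.mul_apply,
    Pi.single_apply, Matrix.of_apply]
  ring

theorem charZero_completion : CharZero (p.adicCompletion F) :=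
  charZero_of_injective_algebraMap (algebraMap F (p.adicCompletion F)).injective

/-- The trace of left multiplication is unchanged by base change and by transport through φ, and on
M₂ it is twice the matrix trace, one copy for each column. All identities for `conj` and `nrd` are
then read off from 2 × 2 matrices. -/
theorem algebraMap_trd [Module.Finite F A] (φ : Splitting A p) (a : A) :
    algebraMap F (p.adicCompletion F) (trd F a) = (loc φ a).trace := by
  have := charZero_completion (p := p)
  have h1 := LinearMap.trace_baseChange (LinearMap.mul F A a) (p.adicCompletion F)
  have h2 : (LinearMap.mul F A a).baseChange (p.adicCompletion F) =
      LinearMap.mul (p.adicCompletion F) (Completion A p) (1 ⊗ₜ a) := by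
    ext x
    simp
  have h3 := LinearMap.trace_conj' (LinearMap.mul (p.adicCompletion F) (Completion A p) (1 ⊗ₜ a))
    φ.toLinearEquiv
  have h4 : φ.toLinearEquiv.conj
      (LinearMap.mul (p.adicCompletion F) (Completion A p) (1 ⊗ₜ a)) =
      LinearMap.mul (p.adicCompletion F) _ (loc φ a) := by
    ext1 m
    simp [LinearEquiv.conj_apply, loc_apply]
  rw [h4, trace_mulLeft_matrix, ← h2, h1] at h3
  simp only [trd, LinearMap.smul_apply, LinearMap.comp_apply, smul_eq_mul, map_mul]
  rw [← h3, map_inv₀, map_ofNat, inv_mul_cancel_left₀ two_ne_zero]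

theorem loc_conj [Module.Finite F A] (φ : Splitting A p) (a : A) :
    loc φ (conj F a) = (loc φ a).adjugate := by
  rw [conj, map_sub, loc_algebraMap, algebraMap_trd φ, Matrix.adjugate_fin_two,
    Matrix.trace_fin_two]
  ext i j
  fin_cases i <;> fin_cases j <;> simp

theorem algebraMap_nrd [Module.Finite F A] (φ : Splitting A p) (a : A) :
    algebraMap F (p.adicCompletion F) (nrd F a) = (loc φ a).det := by
  rw [nrd, map_div₀, algebraMap_trd φ, map_mul, loc_conj, Matrix.mul_adjugate, Matrix.trace_smul,
    Matrix.trace_one]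
  have := charZero_completion (p := p)
  rw [map_ofNat]
  simp

theorem mul_conj [Module.Finite F A] (φ : Splitting A p) (a : A) :
    a * conj F a = algebraMap F A (nrd F a) := by
  apply loc_injective φ
  rw [map_mul, loc_conj, Matrix.mul_adjugate, loc_algebraMap, algebraMap_nrd φ]

theorem nrd_mul [Module.Finite F A] (φ : Splitting A p) (a b : A) :
    nrd F (a * b) = nrd F a * nrd F b := by
  apply (algebraMap F (p.adicCompletion F)).injective
  rw [map_mul, algebraMap_nrd φ, algebraMap_nrd φ, algebraMap_nrd φ, map_mul, Matrix.det_mul]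

theorem nrd_one [Module.Finite F A] (φ : Splitting A p) : nrd F (1 : A) = 1 := by
  apply (algebraMap F (p.adicCompletion F)).injective
  rw [algebraMap_nrd φ, map_one, Matrix.det_one, map_one]

omit [NumberField F] in
theorem isIntegral_of_mem_order {O : Subalgebra (𝓞 F) A} (hO : IsOrder O) {a : A} (ha : a ∈ O) :
    IsIntegral (𝓞 F) a := by
  have : Module.Finite (𝓞 F) O := Module.Finite.iff_fg.2 hO.1
  exact (IsIntegral.of_finite (𝓞 F) (⟨a, ha⟩ : O)).map O.val

open Polynomial in
/-- The reduced trace of an integral element is integral. -/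
theorem trd_mem_of_isIntegral [Module.Finite F A] (φ : Splitting A p) {a : A}
    (ha : IsIntegral (𝓞 F) a) : ∃ s : 𝓞 F, algebraMap (𝓞 F) F s = trd F a := by
  have hinj := algebraMap_injective φ
  by_cases haF : ∃ f : F, algebraMap F A f = a
  · obtain ⟨f, rfl⟩ := haF
    have hf : IsIntegral (𝓞 F) f := by
      rwa [isIntegral_algebraMap_iff hinj] at ha
    obtain ⟨s, rfl⟩ := IsIntegrallyClosed.isIntegral_iff.1 hf
    refine ⟨2 * s, (algebraMap F (p.adicCompletion F)).injective ?_⟩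
    rw [algebraMap_trd φ, loc_algebraMap, Matrix.trace_smul, Matrix.trace_one]
    rw [map_mul, map_ofNat, map_mul, map_ofNat]
    simp [mul_comm]
  · obtain ⟨P, hP, hPa⟩ := ha
    set χ : F[X] := X ^ 2 - C (trd F a) * X + C (nrd F a) with hχ
    have hχm : χ.Monic := by
      rw [hχ]
      monicity!
    have hdeg : χ.natDegree = 2 := by
      rw [hχ]
      compute_degree!
    have hχa : aeval a χ = 0 := by
      rw [hχ]
      simp only [map_add, map_sub, map_pow, map_mul, aeval_X, aeval_C, ← mul_conj φ, conj]
      rw [mul_sub, ← Algebra.commutes, ← sq]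
      abel
    -- The remainder has degree at most one and vanishes at the non-scalar a, so it is zero. As 𝓞 F
    -- is integrally closed, the monic divisor χ of the monic integral P has integral coefficients,
    -- among them minus the trace.
    have hdvd : χ ∣ P.map (algebraMap (𝓞 F) F) := by
      rw [← modByMonic_eq_zero_iff_dvd hχm]
      set Q := P.map (algebraMap (𝓞 F) F) %ₘ χ with hQ
      have hQa : aeval a Q = 0 := by
        have := congrArg (aeval a) (modByMonic_add_div (P.map (algebraMap (𝓞 F) F)) χ)
        rw [map_add, map_mul, hχa, zero_mul, add_zero, aeval_map_algebraMap] at this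
        rw [hQ, this]
        exact hPa
      have hQd : Q.natDegree ≤ 1 := by
        have := natDegree_modByMonic_lt (P.map (algebraMap (𝓞 F) F)) hχm (by
          intro h
          rw [h] at hdeg
          simp at hdeg)
        rw [← hQ] at this
        omega
      rw [eq_X_add_C_of_natDegree_le_one hQd] at hQa ⊢
      simp only [map_add, map_mul, aeval_C, aeval_X] at hQa
      have h1 : Q.coeff 1 = 0 := by
        by_contra h1
        refine haF ⟨-(Q.coeff 1)⁻¹ * Q.coeff 0, ?_⟩
        rw [← neg_eq_iff_add_eq_zero] at hQa
        rw [map_mul, ← hQa, mul_neg, ← mul_assoc, ← map_mul, ← neg_mul, ← map_neg, neg_mul, neg_neg,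
          inv_mul_cancel₀ h1, map_one, one_mul]
      rw [h1] at hQa ⊢
      rw [map_zero, zero_mul, zero_add, map_eq_zero_iff _ hinj] at hQa
      simp [hQa]
    obtain ⟨g, hg⟩ := IsIntegrallyClosed.eq_map_mul_C_of_dvd F hP hdvd
    rw [hχm.leadingCoeff, C_1, mul_one] at hg
    refine ⟨-g.coeff 1, ?_⟩
    have := congrArg (fun q => coeff q 1) hg
    simp only [coeff_map, hχ] at this
    rw [map_neg, this]
    simp [coeff_C]

end Trace

end Quat

namespace Quat

open BruhatTits WithZero

variable {F A : Type*} [Field F] [NumberField F] [Ring A] [Algebra F A]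
variable {p : HeightOneSpectrum (𝓞 F)}

/-- Matrices with `p`-integral coefficients. -/
noncomputable abbrev pInt (p : HeightOneSpectrum (𝓞 F)) : Subring (Matrix (Fin 2) (Fin 2) (p.adicCompletion F)) :=
  intMat (p.adicCompletionIntegers F) (p.adicCompletion F)

/-- The group `GL₂` of the `p`-adic integers. -/
noncomputable abbrev pGL (p : HeightOneSpectrum (𝓞 F)) : Subgroup (GL (Fin 2) (p.adicCompletion F)) :=
  intGL (p.adicCompletionIntegers F) (p.adicCompletion F)

/-! ### The local lattice attached to a module, and conjugation of the splitting. -/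

section LatticeOfModule

/-- The lattice generated by the columns of the matrices `a h` for `a ∈ J`. -/
noncomputable def locCol (φ : Splitting A p) (J : Submodule (𝓞 F) A)
    (h : Matrix (Fin 2) (Fin 2) (p.adicCompletion F)) :
    Submodule (p.adicCompletionIntegers F) (Fin 2 → p.adicCompletion F) :=
  ⨆ k, Submodule.span _ ((fun a => (loc φ a * h).col k) '' (J : Set A))

theorem col_mem_locCol (φ : Splitting A p) {J : Submodule (𝓞 F) A}
    (h : Matrix (Fin 2) (Fin 2) (p.adicCompletion F)) {a : A} (ha : a ∈ J) (k : Fin 2) :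
    (loc φ a * h).col k ∈ locCol φ J h :=
  Submodule.mem_iSup_of_mem k (Submodule.subset_span ⟨a, ha, rfl⟩)

theorem matMap_le_locCol (φ : Splitting A p) {J : Submodule (𝓞 F) A}
    (h : Matrix (Fin 2) (Fin 2) (p.adicCompletion F)) {a : A} (ha : a ∈ J) :
    matMap _ _ (loc φ a * h) (std (p.adicCompletionIntegers F) (p.adicCompletion F)) ≤
      locCol φ J h := by
  rw [matMap_std, Submodule.span_le, Set.insert_subset_iff, Set.singleton_subset_iff]
  exact ⟨col_mem_locCol φ h ha 0, col_mem_locCol φ h ha 1⟩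

theorem locCol_le (φ : Splitting A p) {J : Submodule (𝓞 F) A}
    {h : Matrix (Fin 2) (Fin 2) (p.adicCompletion F)}
    {L : Submodule (p.adicCompletionIntegers F) (Fin 2 → p.adicCompletion F)}
    (H : ∀ a ∈ J, ∀ k, (loc φ a * h).col k ∈ L) : locCol φ J h ≤ L := by
  refine iSup_le fun k => Submodule.span_le.2 ?_
  rintro _ ⟨a, ha, rfl⟩
  exact H a ha k

theorem locCol_fg (φ : Splitting A p) {J : Submodule (𝓞 F) A} (hJ : J.FG)
    (h : Matrix (Fin 2) (Fin 2) (p.adicCompletion F)) : (locCol φ J h).FG := by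
  refine Submodule.fg_iSup _ fun k => ?_
  obtain ⟨s, rfl⟩ := hJ
  have hs : ((fun a => (loc φ a * h).col k) '' (s : Set A)).Finite := s.finite_toSet.image _
  refine ⟨hs.toFinset, le_antisymm ?_ ?_⟩
  · rw [Set.Finite.coe_toFinset]
    exact Submodule.span_mono (Set.image_mono Submodule.subset_span)
  · rw [Set.Finite.coe_toFinset, Submodule.span_le]
    rintro _ ⟨a, ha, rfl⟩
    induction ha using Submodule.span_induction with
    | mem x hx => exact Submodule.subset_span ⟨x, hx, rfl⟩
    | zero =>
      simp only [map_zero, zero_mul]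
      exact Submodule.zero_mem _
    | add x y _ _ hx hy =>
      simp only [map_add, add_mul]
      exact Submodule.add_mem _ hx hy
    | smul c x _ hx =>
      simp only [loc_smul_int, smul_mul_assoc]
      exact Submodule.smul_mem _ (algebraMap (𝓞 F) (p.adicCompletionIntegers F) c) hx

theorem span_locCol (φ : Splitting A p) {J : Submodule (𝓞 F) A}
    (hJ : Submodule.span F (J : Set A) = ⊤) (h : GL (Fin 2) (p.adicCompletion F)) :
    Submodule.span (p.adicCompletion F) (locCol φ J h : Set (Fin 2 → p.adicCompletion F)) = ⊤ := by
  have hcol : ∀ (a : A) (k : Fin 2),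
      (loc φ a * (h : Matrix (Fin 2) (Fin 2) (p.adicCompletion F))).col k ∈
      Submodule.span (p.adicCompletion F) (locCol φ J h : Set (Fin 2 → p.adicCompletion F)) := by
    intro a k
    have ha : a ∈ Submodule.span F (J : Set A) := by
      rw [hJ]
      trivial
    induction ha using Submodule.span_induction with
    | mem x hx => exact Submodule.subset_span (col_mem_locCol φ _ hx k)
    | zero =>
      simp only [map_zero, zero_mul]
      exact Submodule.zero_mem _
    | add x y _ _ hx hy =>
      simp only [map_add, add_mul]
      exact Submodule.add_mem _ hx hy
    | smul c x _ hx =>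
      simp only [loc_smul, smul_mul_assoc]
      exact Submodule.smul_mem _ (algebraMap F (p.adicCompletion F) c) hx
  rw [eq_top_iff, ← ((stdLattice (p.adicCompletionIntegers F) (p.adicCompletion F)).act h).2.2,
    Submodule.span_le]
  rw [show ((stdLattice (p.adicCompletionIntegers F) (p.adicCompletion F)).act h).1 = _ from
    matMap_std _]
  intro v hv
  obtain ⟨a, b, rfl⟩ := Submodule.mem_span_pair.1 hv
  have h0 := hcol 1 0
  have h1 := hcol 1 1
  rw [map_one, one_mul] at h0 h1
  exact Submodule.add_mem _
    (Submodule.smul_mem _ (algebraMap _ (p.adicCompletion F) a) h0)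
    (Submodule.smul_mem _ (algebraMap _ (p.adicCompletion F) b) h1)

theorem exists_locCol_eq (φ : Splitting A p) {J : Submodule (𝓞 F) A} (hJ : IsLattice J)
    (h : GL (Fin 2) (p.adicCompletion F)) : ∃ g : GL (Fin 2) (p.adicCompletion F),
      locCol φ J h = matMap _ _ g (std (p.adicCompletionIntegers F) (p.adicCompletion F)) :=
  exists_eq_matMap_std (locCol_fg φ hJ.1 _) (span_locCol φ hJ.2 h)

/-- A splitting followed by conjugation. -/
noncomputable def conjSplitting (φ : Splitting A p) (h : GL (Fin 2) (p.adicCompletion F)) :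
    Splitting A p :=
  φ.trans (MulSemiringAction.toAlgEquiv (p.adicCompletion F) _ (ConjAct.toConjAct h⁻¹))

theorem loc_conjSplitting (φ : Splitting A p) (h : GL (Fin 2) (p.adicCompletion F)) (a : A) :
    loc (conjSplitting φ h) a =
      ((h⁻¹ : GL (Fin 2) (p.adicCompletion F)) : Matrix (Fin 2) (Fin 2) (p.adicCompletion F)) *
        loc φ a * h := by
  simp [loc_apply, conjSplitting, ConjAct.units_smul_def]

theorem inv_mul_mem_pInt {h : GL (Fin 2) (p.adicCompletion F)}
    {m : Matrix (Fin 2) (Fin 2) (p.adicCompletion F)}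
    (H : matMap _ _ m (std (p.adicCompletionIntegers F) (p.adicCompletion F)) ≤
      matMap _ _ h (std (p.adicCompletionIntegers F) (p.adicCompletion F))) :
    ((h⁻¹ : GL (Fin 2) (p.adicCompletion F)) : Matrix (Fin 2) (Fin 2) (p.adicCompletion F)) * m
      ∈ pInt p := by
  rw [← matMap_std_le_std, matMap_mul, matMap_le_iff, inv_inv]
  exact H

/-- An order is contained in a conjugate of the ring of integral matrices. -/
theorem exists_forall_mem_pInt (φ : Splitting A p) {O : Subalgebra (𝓞 F) A} (hO : IsOrder O) :
    ∃ h : GL (Fin 2) (p.adicCompletion F), ∀ a ∈ O, loc (conjSplitting φ h) a ∈ pInt p := by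
  -- The lattice h R² generated by the columns of `O` is stable under `O` because `O` is a ring.
  obtain ⟨h, hh⟩ := exists_locCol_eq φ hO 1
  refine ⟨h, fun a ha => ?_⟩
  rw [loc_conjSplitting, mul_assoc]
  refine inv_mul_mem_pInt ?_
  rw [matMap_mul, ← hh, matMap, Submodule.map_le_iff_le_comap]
  refine locCol_le φ fun b hb k => ?_
  have := col_mem_locCol φ (J := Subalgebra.toSubmodule O)
    ((1 : GL (Fin 2) (p.adicCompletion F)) : Matrix _ _ _) (O.mul_mem ha hb) k
  rw [Submodule.mem_comap]
  convert this using 1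
  rw [map_mul, mul_assoc]
  ext i
  simp [Matrix.mul_apply, Matrix.mulVec, dotProduct]

end LatticeOfModule

/-! ### Local description of a maximal order. -/

section MaximalOrder

variable {O : Subalgebra (𝓞 F) A}

theorem exists_smul_mem_of_span_eq_top {J : Submodule (𝓞 F) A}
    (hJ : Submodule.span F (J : Set A) = ⊤) (a : A) : ∃ d : 𝓞 F, d ≠ 0 ∧ d • a ∈ J := by
  have ha : a ∈ Submodule.span F (J : Set A) := by
    rw [hJ]
    trivial
  induction ha using Submodule.span_induction with
  | mem x hx => exact ⟨1, one_ne_zero, by simpa using hx⟩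
  | zero => exact ⟨1, one_ne_zero, by simp⟩
  | add x y _ _ hx hy =>
    obtain ⟨d, hd, hx⟩ := hx
    obtain ⟨e, he, hy⟩ := hy
    refine ⟨d * e, mul_ne_zero hd he, ?_⟩
    rw [smul_add]
    refine J.add_mem ?_ ?_
    · rw [mul_comm, mul_smul]
      exact J.smul_mem _ hx
    · rw [mul_smul]
      exact J.smul_mem _ hy
  | smul c x _ hx =>
    obtain ⟨d, hd, hx⟩ := hx
    obtain ⟨n, e, he, rfl⟩ := IsFractionRing.div_surjective (A := 𝓞 F) c
    have he0 : e ≠ 0 := nonZeroDivisors.ne_zero he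
    refine ⟨d * e, mul_ne_zero hd he0, ?_⟩
    have : (d * e) • (algebraMap (𝓞 F) F n / algebraMap (𝓞 F) F e) • x = n • d • x := by
      have he' : algebraMap (𝓞 F) F e ≠ 0 := by simpa using he0
      rw [← algebraMap_smul F (d * e), ← algebraMap_smul F n, ← algebraMap_smul F d, smul_smul,
        smul_smul]
      congr 1
      rw [map_mul]
      field_simp
    rw [this]
    exact J.smul_mem _ hx

/-- The trace form is nondegenerate. -/
theorem eq_zero_of_trd_mul_eq_zero [Module.Finite F A] (φ : Splitting A p) {a : A}
    (h : ∀ b, trd F (a * b) = 0) : a = 0 := by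
  apply loc_injective φ
  rw [map_zero, Matrix.ext_iff_trace_mul_right]
  intro m
  obtain ⟨w, rfl⟩ := φ.surjective m
  rw [zero_mul, Matrix.trace_zero]
  induction w using TensorProduct.induction_on with
  | zero => simp
  | add x y hx hy => rw [map_add, mul_add, Matrix.trace_add, hx, hy, add_zero]
  | tmul k b =>
    have : (k ⊗ₜ[F] b : Completion A p) = k • ((1 : p.adicCompletion F) ⊗ₜ[F] b) := by
      rw [TensorProduct.smul_tmul', smul_eq_mul, mul_one]
    rw [this, map_smul, ← loc_apply, mul_smul_comm, Matrix.trace_smul, ← map_mul,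
      ← algebraMap_trd φ, h, map_zero, smul_zero]

/-- A module on which the trace form with an order is integral is finitely generated. -/
theorem fg_of_forall_trd_mul_mem [Module.Finite F A] (φ : Splitting A p) (hO : IsOrder O)
    {J : Submodule (𝓞 F) A}
    (hJ : ∀ a ∈ J, ∀ b ∈ O, ∃ s : 𝓞 F, algebraMap (𝓞 F) F s = trd F (a * b)) : J.FG := by
  obtain ⟨S, hS⟩ := hO.1
  -- Pairing with generators of `O` embeds `J` in a finite free 𝓞 F-module, which is Noetherian;
  -- nondegeneracy of the trace form gives injectivity.
  let T : A →ₗ[𝓞 F] (S → F) := LinearMap.pi fun b =>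
    (trd F ∘ₗ LinearMap.mulRight F (b : A)).restrictScalars (𝓞 F)
  have hT : ∀ a b, T a b = trd F (a * (b : A)) := fun _ _ => rfl
  have hinj : Function.Injective T := by
    rw [injective_iff_map_eq_zero]
    intro a ha
    refine eq_zero_of_trd_mul_eq_zero φ fun b => ?_
    have hle : Submodule.span F (Subalgebra.toSubmodule O : Set A) ≤
        LinearMap.ker (trd F ∘ₗ LinearMap.mulLeft F a) := by
      rw [← hS, Submodule.span_span_of_tower, Submodule.span_le]
      intro c hc
      exact congrFun ha ⟨c, hc⟩
    rw [hO.2] at hle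
    exact hle (Submodule.mem_top (x := b))
  let N : (S → 𝓞 F) →ₗ[𝓞 F] (S → F) := (Algebra.linearMap (𝓞 F) F).compLeft S
  have hle : J.map T ≤ LinearMap.range N := by
    rintro _ ⟨a, ha, rfl⟩
    have : ∀ b : S, ∃ s : 𝓞 F, algebraMap (𝓞 F) F s = T a b := fun b =>
      hJ a ha b (by
        have : (b : A) ∈ Subalgebra.toSubmodule O := hS ▸ Submodule.subset_span b.2
        exact this)
    choose s hs using this
    exact ⟨s, funext hs⟩
  have : IsNoetherian (𝓞 F) (J.map T) := isNoetherian_of_le hle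
  exact Submodule.fg_of_fg_map_injective T hinj (Module.Finite.iff_fg.1 inferInstance)

omit [NumberField F] in
theorem mul_notMem {q : HeightOneSpectrum (𝓞 F)} {s t : 𝓞 F} (hs : s ∉ q.asIdeal)
    (ht : t ∉ q.asIdeal) : s * t ∉ q.asIdeal :=
  fun h => (q.isPrime.mem_or_mem h).elim hs ht

/-- The elements that are integral at `p` with respect to a splitting, and belong to `O` locally at
the other primes. -/
noncomputable def enlarge (O : Subalgebra (𝓞 F) A) (φ : Splitting A p) : Subalgebra (𝓞 F) A where
  carrier := {a | loc φ a ∈ pInt p ∧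
    ∀ q : HeightOneSpectrum (𝓞 F), q ≠ p → ∃ s ∉ q.asIdeal, s • a ∈ O}
  mul_mem' {a b} ha hb := by
    refine ⟨by rw [map_mul]; exact mul_mem ha.1 hb.1, fun q hq => ?_⟩
    obtain ⟨s, hs, hsa⟩ := ha.2 q hq
    obtain ⟨t, ht, htb⟩ := hb.2 q hq
    refine ⟨s * t, mul_notMem hs ht, ?_⟩
    rw [← smul_mul_smul_comm]
    exact mul_mem hsa htb
  add_mem' {a b} ha hb := by
    refine ⟨by rw [map_add]; exact add_mem ha.1 hb.1, fun q hq => ?_⟩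
    obtain ⟨s, hs, hsa⟩ := ha.2 q hq
    obtain ⟨t, ht, htb⟩ := hb.2 q hq
    refine ⟨s * t, mul_notMem hs ht, ?_⟩
    rw [smul_add]
    refine add_mem ?_ ?_
    · rw [mul_comm, mul_smul]
      exact O.smul_mem hsa t
    · rw [mul_smul]
      exact O.smul_mem htb s
  algebraMap_mem' r := by
    refine ⟨?_, fun q _ => ⟨1, fun h => q.isPrime.ne_top ((Ideal.eq_top_iff_one _).2 h), ?_⟩⟩
    · rw [Algebra.algebraMap_eq_smul_one, loc_smul_int, map_one]
      exact smul_mem_intMat (algebraMap_int_mem_range p r) (one_mem _)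
    · rw [one_smul]
      exact O.algebraMap_mem r

/-- Finite generation comes from integrality of traces, checked prime by prime: at p the trace of an
integral matrix is integral, and at q ≠ p a multiple by an element outside q lies in `O`. -/
theorem isOrder_enlarge [Module.Finite F A] (φ : Splitting A p) (hO : IsOrder O)
    (hφ : ∀ a ∈ O, loc φ a ∈ pInt p) : O ≤ enlarge O φ ∧ IsOrder (enlarge O φ) := by
  have hle : O ≤ enlarge O φ := fun a ha =>
    ⟨hφ a ha, fun q _ => ⟨1, fun h => q.isPrime.ne_top ((Ideal.eq_top_iff_one _).2 h), by simpa⟩⟩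
  refine ⟨hle, ?_, ?_⟩
  · refine fg_of_forall_trd_mul_mem φ hO fun a ha b hb => ?_
    have hab : a * b ∈ enlarge O φ := mul_mem ha (hle hb)
    obtain ⟨s, hs⟩ := HeightOneSpectrum.mem_integers_of_valuation_le_one F (trd F (a * b))
      (fun q => by
        by_cases hq : q = p
        · rw [hq, ← valued_algebraMap, algebraMap_trd φ, ← mem_range_iff]
          exact trace_mem_of_mem_intMat hab.1
        · obtain ⟨s, hs, hs'⟩ := hab.2 q hq
          obtain ⟨t, ht⟩ := trd_mem_of_isIntegral φ (isIntegral_of_mem_order hO hs')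
          rw [← algebraMap_smul F s, map_smul, smul_eq_mul] at ht
          have h1 : q.valuation F (algebraMap (𝓞 F) F t) ≤ 1 := q.valuation_le_one t
          rw [ht, map_mul, q.valuation_eq_one_iff_notMem.2 hs, one_mul] at h1
          exact h1)
    exact ⟨s, hs⟩
  · rw [eq_top_iff, ← hO.2]
    exact Submodule.span_mono hle

/-- Maximality absorbs `enlarge`. This is the local criterion by which elements are later shown to
lie in `O`. -/
theorem mem_of_mem_pInt [Module.Finite F A] (φ : Splitting A p) (hO : IsMaximalOrder O)
    (hφ : ∀ a ∈ O, loc φ a ∈ pInt p) {a : A} (ha : loc φ a ∈ pInt p)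
    (ha' : ∀ q : HeightOneSpectrum (𝓞 F), q ≠ p → ∃ s ∉ q.asIdeal, s • a ∈ O) : a ∈ O := by
  have h := isOrder_enlarge φ hO.1 hφ
  exact hO.2 h.2 h.1 ⟨ha, ha'⟩

/-- A maximal order is locally at `p` the ring of integral matrices. -/
theorem exists_smul_mem_of_mem_pInt [Module.Finite F A] (φ : Splitting A p) (hO : IsMaximalOrder O)
    (hφ : ∀ a ∈ O, loc φ a ∈ pInt p) {a : A} (ha : loc φ a ∈ pInt p) :
    ∃ s ∉ p.asIdeal, s • a ∈ O := by
  obtain ⟨d, hd, hda⟩ := exists_smul_mem_of_span_eq_top hO.1.2 a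
  -- Write (d) = p^m b with p not dividing b, and take s in b outside p. For q ≠ p and t in p
  -- outside q, the element t^m s is a multiple of d, so t^m s a lies in `O`.
  have hfin : FiniteMultiplicity p.asIdeal (Ideal.span {d}) :=
    FiniteMultiplicity.of_prime_left p.prime (by simpa using hd)
  obtain ⟨b, hb, hb'⟩ := hfin.exists_eq_pow_mul_and_not_dvd
  rw [Ideal.dvd_iff_le] at hb'
  obtain ⟨s, hs, hsp⟩ := SetLike.not_le_iff_exists.1 hb'
  refine ⟨s, hsp, mem_of_mem_pInt φ hO hφ ?_ fun q hq => ?_⟩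
  · rw [loc_smul_int]
    exact smul_mem_intMat (algebraMap_int_mem_range p s) ha
  · obtain ⟨t, ht, htq⟩ := exists_notMem_of_ne p hq
    refine ⟨t ^ multiplicity p.asIdeal (Ideal.span {d}),
      fun h => htq (q.isPrime.mem_of_pow_mem _ h), ?_⟩
    have h1 : t ^ multiplicity p.asIdeal (Ideal.span {d}) * s ∈ Ideal.span {d} := by
      have := Ideal.mul_mem_mul (Ideal.pow_mem_pow ht (multiplicity p.asIdeal (Ideal.span {d}))) hs
      rwa [← hb] at this
    obtain ⟨e, he⟩ := Ideal.mem_span_singleton'.1 h1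
    rw [smul_smul, ← he, mul_smul]
    exact O.smul_mem hda e

end MaximalOrder

end Quat

/-! ### Right ideals of integral matrices through their columns. -/

namespace BruhatTits

variable {R K : Type*} [CommRing R] [Field K] [Algebra R K]

theorem vecMulVec_single_mem (l k : Fin 2) :
    Matrix.vecMulVec (Pi.single l (1 : K)) (Pi.single k 1) ∈ intMat R K := by
  rw [mem_intMat]
  intro i j
  rw [Matrix.vecMulVec_apply, Pi.single_apply, Pi.single_apply]
  split_ifs <;> simp

/-- The vectors `v` such that the matrix with only nonzero column `g v` at `k` is in the right ideal
`B`. -/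
def columns (B : AddSubgroup (Matrix (Fin 2) (Fin 2) K))
    (hB : ∀ m ∈ B, ∀ z ∈ intMat R K, m * z ∈ B) (g : Matrix (Fin 2) (Fin 2) K) (k : Fin 2) :
    Submodule R (Fin 2 → K) where
  carrier := {v | Matrix.vecMulVec (g.mulVec v) (Pi.single k 1) ∈ B}
  zero_mem' := by
    rw [Set.mem_ofPred_eq, Matrix.mulVec_zero, Matrix.zero_vecMulVec]
    exact B.zero_mem
  add_mem' := by
    intro x y hx hy
    have := B.add_mem hx hy
    rwa [← Matrix.add_vecMulVec, ← Matrix.mulVec_add] at this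
  smul_mem' := by
    intro c x hx
    have hc : algebraMap R K c • (1 : Matrix (Fin 2) (Fin 2) K) ∈ intMat R K :=
      smul_mem_intMat ⟨c, rfl⟩ (one_mem _)
    have := hB _ hx _ hc
    rw [mul_smul_comm, mul_one, ← Matrix.smul_vecMulVec, ← Matrix.mulVec_smul,
      algebraMap_smul] at this
    exact this

theorem mem_columns {B : AddSubgroup (Matrix (Fin 2) (Fin 2) K)}
    {hB : ∀ m ∈ B, ∀ z ∈ intMat R K, m * z ∈ B} {g : Matrix (Fin 2) (Fin 2) K} {k : Fin 2}
    {v : Fin 2 → K} :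
    v ∈ columns B hB g k ↔ Matrix.vecMulVec (g.mulVec v) (Pi.single k 1) ∈ B := Iff.rfl

theorem col_mem_columns {B : AddSubgroup (Matrix (Fin 2) (Fin 2) K)}
    (hB : ∀ m ∈ B, ∀ z ∈ intMat R K, m * z ∈ B) {g m : Matrix (Fin 2) (Fin 2) K}
    (h : g * m ∈ B) (k l : Fin 2) : m.col l ∈ columns B hB g k := by
  rw [mem_columns, ← Matrix.mulVec_single_one, Matrix.mulVec_mulVec, ← Matrix.mul_vecMulVec]
  exact hB _ h _ (vecMulVec_single_mem _ _)

/-- The vector h e_k yields the matrix unit E_kk in `B`, and 1 = E₀₀ + E₁₁. -/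
theorem one_mem_of_le_columns {B : AddSubgroup (Matrix (Fin 2) (Fin 2) K)}
    (hB : ∀ m ∈ B, ∀ z ∈ intMat R K, m * z ∈ B) (h : GL (Fin 2) K)
    (H : ∀ k, matMap R K h (std R K) ≤
      columns B hB ((h⁻¹ : GL (Fin 2) K) : Matrix (Fin 2) (Fin 2) K) k) : 1 ∈ B := by
  have hcol : ∀ k : Fin 2, Matrix.vecMulVec (Pi.single k 1) (Pi.single k 1) ∈ B := by
    intro k
    have h1 : (h : Matrix (Fin 2) (Fin 2) K).mulVec (Pi.single k 1) ∈ matMap R K h (std R K) :=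
      ⟨Pi.single k 1, mem_std.2 fun i => by
        rw [Pi.single_apply]
        split_ifs <;> simp, rfl⟩
    have h2 := mem_columns.1 (H k h1)
    rwa [Matrix.mulVec_mulVec, ← Units.val_mul, inv_mul_cancel, Units.val_one,
      Matrix.one_mulVec] at h2
  have := B.add_mem (hcol 0) (hcol 1)
  convert this using 1
  ext i j
  fin_cases i <;> fin_cases j <;> simp [Matrix.vecMulVec_apply]

theorem det_one_sub_smul (c : K) (w : Matrix (Fin 2) (Fin 2) K) :
    (1 - c • w).det = 1 - c * (w.trace - c * w.det) := by
  rw [Matrix.det_fin_two, Matrix.det_fin_two, Matrix.trace_fin_two]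
  simp
  ring

end BruhatTits

/-! ### Local generators of right ideals. -/

namespace Quat

open BruhatTits WithZero

variable {F A : Type*} [Field F] [NumberField F] [Ring A] [Algebra F A]
variable {p : HeightOneSpectrum (𝓞 F)} {O : Subalgebra (𝓞 F) A}

/-- `O` spans the algebra over F and is integral at p, so approximating coefficients in F_p by
elements of F modulo R is enough. -/
theorem exists_sub_mem_pInt (φ : Splitting A p) (hO : IsOrder O)
    (hφ : ∀ a ∈ O, loc φ a ∈ pInt p) (z : Matrix (Fin 2) (Fin 2) (p.adicCompletion F)) :
    ∃ a, z - loc φ a ∈ pInt p := by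
  obtain ⟨w, rfl⟩ := φ.surjective z
  induction w using TensorProduct.induction_on with
  | zero => exact ⟨0, by simp [zero_mem]⟩
  | add x y hx hy =>
    obtain ⟨a, ha⟩ := hx
    obtain ⟨b, hb⟩ := hy
    refine ⟨a + b, ?_⟩
    rw [map_add, map_add, add_sub_add_comm]
    exact add_mem ha hb
  | tmul k b =>
    have : (k ⊗ₜ[F] b : Completion A p) = k • ((1 : p.adicCompletion F) ⊗ₜ[F] b) := by
      rw [TensorProduct.smul_tmul', smul_eq_mul, mul_one]
    rw [this, map_smul, ← loc_apply]
    clear this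
    have hb : b ∈ Submodule.span F (Subalgebra.toSubmodule O : Set A) := by
      rw [hO.2]
      trivial
    induction hb using Submodule.span_induction generalizing k with
    | mem x hx =>
      obtain ⟨f, hf⟩ := exists_valued_sub_lt p k
      refine ⟨f • x, ?_⟩
      rw [loc_smul, ← sub_smul]
      exact smul_mem_intMat (mem_range_iff.2 hf.le) (hφ x hx)
    | zero => exact ⟨0, by simp [zero_mem]⟩
    | add x y _ _ hx hy =>
      obtain ⟨a, ha⟩ := hx k
      obtain ⟨b, hb⟩ := hy k
      refine ⟨a + b, ?_⟩
      rw [map_add, map_add, smul_add, add_sub_add_comm]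
      exact add_mem ha hb
    | smul c x _ hx =>
      obtain ⟨a, ha⟩ := hx (k * algebraMap F (p.adicCompletion F) c)
      refine ⟨a, ?_⟩
      rwa [loc_smul, smul_smul]

theorem exists_inv_mod {s : 𝓞 F} (hs : s ∉ p.asIdeal) : ∃ r : 𝓞 F, 1 - r * s ∈ p.asIdeal := by
  obtain ⟨r, i, hi, h⟩ := p.isMaximal.exists_inv hs
  exact ⟨r, by rw [← h]; simpa⟩

/-- The image of an algebraic integer in the completion. -/
noncomputable abbrev toComp (p : HeightOneSpectrum (𝓞 F)) (s : 𝓞 F) : p.adicCompletion F :=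
  algebraMap F (p.adicCompletion F) (algebraMap (𝓞 F) F s)

theorem inv_toComp_mul_mem {t : 𝓞 F} (ht : p.intValuation t = exp (-1 : ℤ)) {s : 𝓞 F}
    (hs : s ∈ p.asIdeal) : (toComp p t)⁻¹ * toComp p s ∈
      (algebraMap (p.adicCompletionIntegers F) (p.adicCompletion F)).range := by
  rw [mem_range_iff, map_mul, map_inv₀, valued_algebraMap_int, valued_algebraMap_int, ht, mul_comm]
  refine mul_inv_le_one_of_le₀ ?_ zero_le
  rw [← pow_one p.asIdeal, ← HeightOneSpectrum.intValuation_le_pow_iff_mem] at hs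
  simpa using hs

theorem toComp_ne_zero {t : 𝓞 F} (ht : p.intValuation t = exp (-1 : ℤ)) : toComp p t ≠ 0 := by
  intro h
  have : Valued.v (toComp p t) = _ := valued_algebraMap_int p t
  rw [h, map_zero, ht] at this
  exact exp_ne_zero this.symm

/-- A maximal order is dense in the ring of integral matrices. -/
theorem exists_mem_order_add [Module.Finite F A] (φ : Splitting A p) (hO : IsMaximalOrder O)
    (hφ : ∀ a ∈ O, loc φ a ∈ pInt p) {t : 𝓞 F} (ht : p.intValuation t = exp (-1 : ℤ))
    {z : Matrix (Fin 2) (Fin 2) (p.adicCompletion F)} (hz : z ∈ pInt p) :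
    ∃ a ∈ O, ∃ w ∈ pInt p, z = loc φ a + toComp p t • w := by
  have h0 := toComp_ne_zero ht
  obtain ⟨b, hb⟩ := exists_sub_mem_pInt φ hO.1 hφ ((toComp p t)⁻¹ • z)
  have h1 : z - loc φ (t • b) = toComp p t • ((toComp p t)⁻¹ • z - loc φ b) := by
    rw [loc_smul_int, smul_sub, smul_inv_smul₀ h0]
  have h2 : loc φ (t • b) ∈ pInt p := by
    rw [← sub_sub_cancel z (loc φ (t • b)), h1]
    exact sub_mem hz (smul_mem_intMat (algebraMap_int_mem_range p t) hb)
  -- The element t b lies in `O` only locally at p. Multiplying it by r s, which is 1 modulo p,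
  -- brings it into `O` and changes it by an element of t M₂(R).
  obtain ⟨s, hs, hsO⟩ := exists_smul_mem_of_mem_pInt φ hO hφ h2
  obtain ⟨r, hr⟩ := exists_inv_mod hs
  refine ⟨r • s • t • b, O.smul_mem hsO r, _, add_mem hb
    (smul_mem_intMat (inv_toComp_mul_mem ht hr) h2), ?_⟩
  rw [smul_add, ← h1, smul_smul (toComp p t), mul_inv_cancel_left₀ h0, smul_smul r s,
    loc_smul_int _ (r * s), toComp, map_sub, map_sub, map_one, map_one, sub_smul, one_smul]
  abel

/-- An argument modulo t: by density of `O`, the set `B` = h⁻¹I + t M₂(R) is stable under right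
multiplication by M₂(R). Its columns fill the whole lattice, so it contains 1. -/
theorem exists_one_eq [Module.Finite F A] (φ : Splitting A p) (hO : IsMaximalOrder O)
    (hφ : ∀ a ∈ O, loc φ a ∈ pInt p) {t : 𝓞 F} (ht : p.intValuation t = exp (-1 : ℤ))
    {I : Submodule (𝓞 F) A} (hIR : ∀ a ∈ I, ∀ b ∈ O, a * b ∈ I) {h : GL (Fin 2) (p.adicCompletion F)}
    (hh : locCol φ I 1 = matMap _ _ h (std (p.adicCompletionIntegers F) (p.adicCompletion F)))
    (hI : ∀ a ∈ I, ((h⁻¹ : GL (Fin 2) (p.adicCompletion F)) : Matrix _ _ _) * loc φ a ∈ pInt p) :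
    ∃ a ∈ I, ∃ w ∈ pInt p, (1 : Matrix (Fin 2) (Fin 2) (p.adicCompletion F)) =
      ((h⁻¹ : GL (Fin 2) (p.adicCompletion F)) : Matrix _ _ _) * loc φ a + toComp p t • w := by
  set g := ((h⁻¹ : GL (Fin 2) (p.adicCompletion F)) : Matrix (Fin 2) (Fin 2) (p.adicCompletion F))
    with hg
  let B : AddSubgroup (Matrix (Fin 2) (Fin 2) (p.adicCompletion F)) :=
    { carrier := {m | ∃ a ∈ I, ∃ w ∈ pInt p, m = g * loc φ a + toComp p t • w}
      zero_mem' := ⟨0, I.zero_mem, 0, zero_mem _, by simp⟩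
      add_mem' := by
        rintro _ _ ⟨a, ha, w, hw, rfl⟩ ⟨b, hb, v, hv, rfl⟩
        refine ⟨a + b, I.add_mem ha hb, w + v, add_mem hw hv, ?_⟩
        rw [map_add, mul_add, smul_add]
        abel
      neg_mem' := by
        rintro _ ⟨a, ha, w, hw, rfl⟩
        refine ⟨-a, I.neg_mem ha, -w, neg_mem hw, ?_⟩
        rw [map_neg, mul_neg, smul_neg]
        abel }
  have hBmul : ∀ m ∈ B, ∀ z ∈ pInt p, m * z ∈ B := by
    rintro _ ⟨a, ha, w, hw, rfl⟩ z hz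
    obtain ⟨b, hb, v, hv, hzb⟩ := exists_mem_order_add φ hO hφ ht hz
    refine ⟨a * b, hIR a ha b hb, g * loc φ a * v + w * z,
      add_mem (mul_mem (hI a ha) hv) (mul_mem hw hz), ?_⟩
    rw [add_mul, smul_mul_assoc, smul_add, ← add_assoc, map_mul, ← mul_assoc]
    congr 1
    rw [hzb, mul_add, mul_smul_comm]
  have hBI : ∀ a ∈ I, g * loc φ a ∈ B := fun a ha => ⟨a, ha, 0, zero_mem _, by simp⟩
  refine one_mem_of_le_columns hBmul h fun k => ?_
  rw [← hh]
  refine locCol_le φ fun a ha l => ?_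
  rw [mul_one]
  exact col_mem_columns hBmul (hBI a ha) k l

theorem exists_unit_of_det_ne_zero [Module.Finite F A] (φ : Splitting A p) {a : A}
    (h : (loc φ a).det ≠ 0) : ∃ x : Aˣ, (x : A) = a := by
  have hn : nrd F a ≠ 0 := by
    intro h0
    rw [← algebraMap_nrd φ, h0, map_zero] at h
    exact h rfl
  have h1 : conj F a * a = algebraMap F A (nrd F a) := by
    apply loc_injective φ
    rw [map_mul, loc_conj, Matrix.adjugate_mul, loc_algebraMap, algebraMap_nrd φ]
  refine ⟨⟨a, (nrd F a)⁻¹ • conj F a, ?_, ?_⟩, rfl⟩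
  · rw [mul_smul_comm, mul_conj φ, Algebra.algebraMap_eq_smul_one, inv_smul_smul₀ hn]
  · rw [smul_mul_assoc, h1, Algebra.algebraMap_eq_smul_one, inv_smul_smul₀ hn]

/-- A right ideal of a maximal order is locally principal. -/
theorem exists_local_generator [Module.Finite F A] (φ : Splitting A p) (hO : IsMaximalOrder O)
    (hφ : ∀ a ∈ O, loc φ a ∈ pInt p) {I : Submodule (𝓞 F) A} (hI : IsLattice I)
    (hIR : ∀ a ∈ I, ∀ b ∈ O, a * b ∈ I) :
    ∃ x : Aˣ, (x : A) ∈ I ∧ ∀ a ∈ I, loc φ ((x⁻¹ : Aˣ) * a) ∈ pInt p := by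
  obtain ⟨t, htp, ht, -⟩ := exists_uniformizer p
  obtain ⟨h, hh⟩ := exists_locCol_eq φ hI 1
  have hI' : ∀ a ∈ I, ((h⁻¹ : GL (Fin 2) (p.adicCompletion F)) : Matrix _ _ _) * loc φ a
      ∈ pInt p := by
    intro a ha
    apply inv_mul_mem_pInt
    rw [← hh]
    simpa using matMap_le_locCol φ
      ((1 : GL (Fin 2) (p.adicCompletion F)) : Matrix _ _ _) ha
  obtain ⟨a, ha, w, hw, h1⟩ := exists_one_eq φ hO hφ ht hIR hh hI'
  set m := ((h⁻¹ : GL (Fin 2) (p.adicCompletion F)) : Matrix _ _ _) * loc φ a with hm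
  -- As m is 1 modulo t, its determinant is a unit, so m is in GL₂(R). Then a = h m generates what h
  -- does.
  have hv : Valued.v m.det = 1 := by
    have hmw : m = 1 - toComp p t • w := by
      rw [h1, add_sub_cancel_right]
    rw [hmw, det_one_sub_smul]
    apply Valuation.map_one_sub_of_lt
    rw [map_mul, valued_algebraMap_int, ht]
    have h2 : Valued.v (w.trace - toComp p t * w.det) ≤ 1 :=
      mem_range_iff.1 (sub_mem (trace_mem_of_mem_intMat hw)
        (mul_mem (algebraMap_int_mem_range p t) (det_mem_of_mem_intMat hw)))
    refine lt_of_le_of_lt (mul_le_mul_right h2 _) ?_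
    rw [mul_one, ← exp_zero, exp_lt_exp]
    norm_num
  have hm0 : m.det ≠ 0 := by
    intro h
    rw [h, map_zero] at hv
    exact zero_ne_one hv
  obtain ⟨x, rfl⟩ := exists_unit_of_det_ne_zero φ (a := a) (by
    rw [hm, Matrix.det_mul] at hm0
    exact right_ne_zero_of_mul hm0)
  obtain ⟨U, hU, hUm⟩ := exists_intGL_eq (R := p.adicCompletionIntegers F) m (hI' _ ha) hm0
    (mem_range_iff.2 (by rw [map_inv₀, hv, inv_one]))
  refine ⟨x, ha, fun b hb => ?_⟩
  have h3 : loc φ ((x⁻¹ : Aˣ) * b) = ((U⁻¹ : GL (Fin 2) (p.adicCompletion F)) : Matrix _ _ _) *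
      (((h⁻¹ : GL (Fin 2) (p.adicCompletion F)) : Matrix _ _ _) * loc φ b) := by
    apply U.isUnit.mul_left_cancel
    rw [← mul_assoc, ← Units.val_mul, mul_inv_cancel, Units.val_one, one_mul, hUm, hm, mul_assoc,
      ← map_mul, Units.mul_inv_cancel_left]
  rw [h3]
  exact mul_mem (mem_intGL.1 hU).2 (hI' b hb)

theorem completeAt_le_comap (φ : Splitting A p) (hφ : ∀ a ∈ O, loc φ a ∈ pInt p)
    {w : Completion A p} (hw : w ∈ completeAt p (Subalgebra.toSubmodule O)) : φ w ∈ pInt p := by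
  induction hw using Submodule.span_induction with
  | mem x hx =>
    obtain ⟨a, ha, rfl⟩ := hx
    exact hφ a ha
  | zero => simp [zero_mem]
  | add x y _ _ hx hy =>
    rw [map_add]
    exact add_mem hx hy
  | smul c x _ hx =>
    rw [← algebraMap_smul (p.adicCompletion F) c x, map_smul]
    exact smul_mem_intMat ⟨c, rfl⟩ hx

theorem tmul_mem_completeAt {J : Submodule (𝓞 F) A} {s : 𝓞 F} (hs : s ∉ p.asIdeal) {a : A}
    (ha : s • a ∈ J) : (1 : p.adicCompletion F) ⊗ₜ[F] a ∈ completeAt p J := by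
  have hv : Valued.v (toComp p s) = 1 := by
    rw [valued_algebraMap_int, HeightOneSpectrum.intValuation_eq_one_iff_mem_primeCompl]
    exact hs
  have h0 : toComp p s ≠ 0 := by
    intro h
    rw [h, map_zero] at hv
    exact zero_ne_one hv
  obtain ⟨c, hc⟩ := mem_range_iff.2 (show Valued.v (toComp p s)⁻¹ ≤ 1 by rw [map_inv₀, hv, inv_one])
  have : (1 : p.adicCompletion F) ⊗ₜ[F] a = c • ((1 : p.adicCompletion F) ⊗ₜ[F] (s • a)) := by
    rw [← algebraMap_smul (p.adicCompletion F) c, hc, ← algebraMap_smul F s a,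
      ← TensorProduct.smul_tmul, TensorProduct.smul_tmul', ← algebraMap_smul (p.adicCompletion F)
      (algebraMap (𝓞 F) F s) (1 : p.adicCompletion F), smul_smul, inv_mul_cancel₀ h0, one_smul]
  rw [this]
  exact Submodule.smul_mem _ c (Submodule.subset_span ⟨_, ha, rfl⟩)

/-- Replaces the equality of completions by the matrix condition used in the rest of the proof. The
return direction needs maximality: an element x⁻¹a that is integral at p lies in `O` after
multiplication by some s outside p. -/
theorem isLocalGenerator_iff [Module.Finite F A] (φ : Splitting A p) (hO : IsMaximalOrder O)
    (hφ : ∀ a ∈ O, loc φ a ∈ pInt p) {I : Submodule (𝓞 F) A}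
    (hIR : ∀ a ∈ I, ∀ b ∈ O, a * b ∈ I) {x : Aˣ} :
    IsLocalGenerator O p I x ↔
      (x : A) ∈ I ∧ ∀ a ∈ I, loc φ ((x⁻¹ : Aˣ) * a) ∈ pInt p := by
  refine and_congr_right fun hx => ⟨fun h a ha => ?_, fun h => le_antisymm ?_ ?_⟩
  · have h1 : (1 : p.adicCompletion F) ⊗ₜ[F] a ∈ completeAt p I :=
      Submodule.subset_span ⟨a, ha, rfl⟩
    rw [h] at h1
    obtain ⟨w, hw, hwa⟩ := h1
    have h2 : (1 : p.adicCompletion F) ⊗ₜ[F] (((x⁻¹ : Aˣ) : A) * a) = w := by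
      have h3 := congrArg (fun z => (1 : p.adicCompletion F) ⊗ₜ[F] ((x⁻¹ : Aˣ) : A) * z) hwa
      simp only [LinearMap.mulLeft_apply, ← mul_assoc, Algebra.TensorProduct.tmul_mul_tmul,
        Units.inv_mul, one_mul] at h3
      rw [← h3, ← Algebra.TensorProduct.one_def, one_mul]
    rw [loc_apply, h2]
    exact completeAt_le_comap φ hφ hw
  · refine Submodule.span_le.2 ?_
    rintro _ ⟨a, ha, rfl⟩
    obtain ⟨s, hs, hs'⟩ := exists_smul_mem_of_mem_pInt φ hO hφ (h a ha)
    refine ⟨_, tmul_mem_completeAt (J := Subalgebra.toSubmodule O) hs hs', ?_⟩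
    simp
  · rw [Submodule.map_le_iff_le_comap]
    refine Submodule.span_le.2 ?_
    rintro _ ⟨a, ha, rfl⟩
    refine Submodule.subset_span ⟨_, hIR x hx a ha, ?_⟩
    simp

end Quat

namespace Quat

open BruhatTits WithZero

variable {F A : Type*} [Field F] [NumberField F] [Ring A] [Algebra F A]
variable {p : HeightOneSpectrum (𝓞 F)} {O : Subalgebra (𝓞 F) A}

/-! ### Integral powers of p and their valuations. -/

section PrimePowers

theorem coeIdeal_ne_zero (p : HeightOneSpectrum (𝓞 F)) :
    (p.asIdeal : FractionalIdeal (𝓞 F)⁰ F) ≠ 0 :=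
  FractionalIdeal.coeIdeal_ne_zero.2 p.ne_bot

variable (p) in
theorem primePow_mul (r s : ℤ) : primePow p r * primePow p s = primePow p (r + s) := by
  rw [primePow, primePow, primePow, ← FractionalIdeal.coe_mul, ← zpow_add₀ (coeIdeal_ne_zero p)]

variable (p) in
theorem primePow_zero : primePow p 0 = 1 := by
  rw [primePow, zpow_zero, FractionalIdeal.coe_one]

theorem mem_primePow_nat {n : ℕ} {f : F} :
    f ∈ primePow p n ↔ ∃ s ∈ p.asIdeal ^ n, algebraMap (𝓞 F) F s = f := by
  rw [primePow, zpow_natCast, ← FractionalIdeal.coeIdeal_pow, FractionalIdeal.mem_coe,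
    FractionalIdeal.mem_coeIdeal]

theorem mul_mem_primePow {r s : ℤ} {f g : F} (hf : f ∈ primePow p r) (hg : g ∈ primePow p s) :
    f * g ∈ primePow p (r + s) := by
  rw [← primePow_mul]
  exact Submodule.mul_mem_mul hf hg

theorem algebraMap_pow_mem_primePow {t : 𝓞 F} (ht : t ∈ p.asIdeal) (n : ℕ) :
    algebraMap (𝓞 F) F (t ^ n) ∈ primePow p n :=
  mem_primePow_nat.2 ⟨_, Ideal.pow_mem_pow ht n, rfl⟩

theorem valuation_le_of_mem_primePow {r : ℤ} {f : F} (hf : f ∈ primePow p r) :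
    p.valuation F f ≤ exp (-r) := by
  obtain ⟨t, htp, ht, -⟩ := exists_uniformizer p
  -- Multiplying by t^|r| makes the exponent nonnegative, where membership is that of an ordinary
  -- ideal.
  have h1 := mul_mem_primePow hf (algebraMap_pow_mem_primePow htp r.natAbs)
  obtain ⟨n, hn⟩ : ∃ n : ℕ, r + r.natAbs = n := ⟨(r + r.natAbs).toNat, by omega⟩
  rw [hn] at h1
  obtain ⟨s, hs, hsf⟩ := mem_primePow_nat.1 h1
  have h2 := congrArg (p.valuation F) hsf
  rw [← HeightOneSpectrum.intValuation_le_pow_iff_mem] at hs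
  rw [HeightOneSpectrum.valuation_of_algebraMap, map_mul, HeightOneSpectrum.valuation_of_algebraMap,
    map_pow, ht, ← exp_nsmul] at h2
  rw [h2] at hs
  have h3 := mul_le_mul_left hs (exp (r.natAbs : ℤ))
  rw [mul_assoc, ← exp_add, ← exp_add] at h3
  convert h3 using 1
  · simp
  · congr 1
    omega

theorem valuation_le_one_of_mem_primePow {r : ℤ} {f : F} (hf : f ∈ primePow p r)
    {q : HeightOneSpectrum (𝓞 F)} (hq : q ≠ p) : q.valuation F f ≤ 1 := by
  obtain ⟨t, htp, htq⟩ := exists_notMem_of_ne p hq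
  have h1 := mul_mem_primePow hf (algebraMap_pow_mem_primePow htp r.natAbs)
  obtain ⟨n, hn⟩ : ∃ n : ℕ, r + r.natAbs = n := ⟨(r + r.natAbs).toNat, by omega⟩
  rw [hn] at h1
  obtain ⟨s, hs, hsf⟩ := mem_primePow_nat.1 h1
  have h2 := congrArg (q.valuation F) hsf
  rw [map_mul, map_pow, map_pow, (q.valuation_eq_one_iff_notMem).2 htq, one_pow, mul_one] at h2
  rw [← h2]
  exact q.valuation_le_one s

-- If all elements of p^r had valuation below exp(-r), all elements of p^r p^(-r) would have
-- valuation below 1; but that product contains 1.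
variable (p) in
theorem exists_mem_primePow (r : ℤ) : ∃ f ∈ primePow p r, p.valuation F f = exp (-r) := by
  by_contra! h
  have key : ∀ x ∈ primePow p r * primePow p (-r), p.valuation F x < 1 := by
    intro x hx
    induction hx using Submodule.mul_induction_on' with
    | mem_mul_mem f hf g hg =>
      have h1 := lt_of_le_of_ne (valuation_le_of_mem_primePow hf) (h f hf)
      have h2 := valuation_le_of_mem_primePow hg
      rw [map_mul]
      calc p.valuation F f * p.valuation F g ≤ p.valuation F f * exp (- -r) :=
            mul_le_mul_right h2 _
        _ < exp (-r) * exp (- -r) := mul_lt_mul_of_pos_right h1 exp_pos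
        _ = 1 := by rw [← exp_add, add_neg_cancel, exp_zero]
    | add x _ y _ hx hy => exact lt_of_le_of_lt (Valuation.map_add _ x y) (max_lt hx hy)
  rw [primePow_mul, add_neg_cancel, primePow_zero] at key
  simpa using key 1 (Submodule.one_le.1 le_rfl)

end PrimePowers

/-! ### The operations J ↦ J p^r and J ↦ cJ. -/

section MulPrimePow

theorem smul_mem_mulPrimePow {J : Submodule (𝓞 F) A} {r : ℤ} {f : F} {a : A} (ha : a ∈ J)
    (hf : f ∈ primePow p r) : f • a ∈ mulPrimePow J p r := by
  rw [Algebra.smul_def, Algebra.commutes]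
  exact Submodule.mul_mem_mul ha ⟨f, hf, rfl⟩

theorem mulPrimePow_le {J N : Submodule (𝓞 F) A} {r : ℤ} :
    mulPrimePow J p r ≤ N ↔ ∀ a ∈ J, ∀ f ∈ primePow p r, f • a ∈ N := by
  refine ⟨fun h a ha f hf => h (smul_mem_mulPrimePow ha hf), fun h => ?_⟩
  refine Submodule.mul_le.2 ?_
  rintro a ha _ ⟨f, hf, rfl⟩
  have := h a ha f hf
  rwa [Algebra.smul_def, Algebra.commutes] at this

theorem mulPrimePow_mono {J N : Submodule (𝓞 F) A} (h : J ≤ N) (r : ℤ) :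
    mulPrimePow J p r ≤ mulPrimePow N p r :=
  mulPrimePow_le.2 fun _ ha _ hf => smul_mem_mulPrimePow (h ha) hf

theorem mulPrimePow_mulPrimePow (J : Submodule (𝓞 F) A) (r s : ℤ) :
    mulPrimePow (mulPrimePow J p r) p s = mulPrimePow J p (r + s) := by
  rw [mulPrimePow, mulPrimePow, mulPrimePow, mul_assoc, ← primePow_mul]
  congr 1
  exact (Submodule.map_mul _ _ ((Algebra.ofId F A).restrictScalars (𝓞 F))).symm

theorem mulPrimePow_zero (J : Submodule (𝓞 F) A) : mulPrimePow J p 0 = J := by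
  rw [mulPrimePow, primePow_zero]
  have : Submodule.map ((Algebra.linearMap F A).restrictScalars (𝓞 F)) 1 = 1 :=
    Submodule.map_one ((Algebra.ofId F A).restrictScalars (𝓞 F))
  rw [this, mul_one]

theorem leftMul_mulPrimePow (c : A) (J : Submodule (𝓞 F) A) (r : ℤ) :
    leftMul c (mulPrimePow J p r) = mulPrimePow (leftMul c J) p r := by
  apply le_antisymm
  · refine Submodule.map_le_iff_le_comap.2 (mulPrimePow_le.2 fun a ha f hf => ?_)
    have := smul_mem_mulPrimePow (p := p) (J := leftMul c J) (a := c * a) ⟨a, ha, rfl⟩ hf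
    simpa using this
  · refine mulPrimePow_le.2 ?_
    rintro _ ⟨a, ha, rfl⟩ f hf
    exact ⟨f • a, smul_mem_mulPrimePow ha hf, by simp⟩

omit [NumberField F] in
theorem leftMul_leftMul (c d : A) (J : Submodule (𝓞 F) A) :
    leftMul c (leftMul d J) = leftMul (c * d) J := by
  rw [leftMul, leftMul, leftMul, ← Submodule.map_comp]
  congr 1
  ext x
  simp

omit [NumberField F] in
theorem leftMul_one (J : Submodule (𝓞 F) A) : leftMul 1 J = J := by
  rw [leftMul, LinearMap.mulLeft_one, Submodule.map_id]

omit [NumberField F] in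
theorem rightOrder_leftMul (g : Aˣ) (J : Submodule (𝓞 F) A) :
    rightOrder (leftMul (g : A) J) = rightOrder J := by
  ext x
  constructor
  · intro h a ha
    obtain ⟨b, hb, hb'⟩ := h _ ⟨a, ha, rfl⟩
    simp only [LinearMap.mulLeft_apply, mul_assoc, Units.mul_right_inj] at hb'
    rwa [← hb']
  · rintro h _ ⟨a, ha, rfl⟩
    exact ⟨a * x, h a ha, by simp [mul_assoc]⟩

theorem rightOrder_le_mulPrimePow (J : Submodule (𝓞 F) A) (r : ℤ) :
    rightOrder J ≤ rightOrder (mulPrimePow J p r) := by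
  intro x hx
  have : mulPrimePow J p r ≤
      (mulPrimePow J p r).comap (LinearMap.mulRight (𝓞 F) x) := by
    refine mulPrimePow_le.2 fun a ha f hf => ?_
    have := smul_mem_mulPrimePow (p := p) (hx a ha) hf
    simpa using this
  exact fun a ha => this ha

theorem rightOrder_mulPrimePow (J : Submodule (𝓞 F) A) (r : ℤ) :
    rightOrder (mulPrimePow J p r) = rightOrder J := by
  refine le_antisymm ?_ (rightOrder_le_mulPrimePow J r)
  have := rightOrder_le_mulPrimePow (p := p) (mulPrimePow J p r) (-r)
  rwa [mulPrimePow_mulPrimePow, add_neg_cancel, mulPrimePow_zero] at this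

omit [NumberField F] in
theorem IsRightIdeal.leftMul {J : Submodule (𝓞 F) A} (hJ : IsRightIdeal O J) (g : Aˣ) :
    IsRightIdeal O (leftMul (g : A) J) := by
  refine ⟨⟨hJ.1.1.map _, ?_⟩, (rightOrder_leftMul g J).trans hJ.2⟩
  have h : (Quat.leftMul (g : A) J : Set A) = LinearMap.mulLeft F (g : A) '' (J : Set A) := rfl
  rw [h, Submodule.span_image, hJ.1.2, Submodule.map_top, LinearMap.range_eq_top]
  exact fun x => ⟨(g⁻¹ : Aˣ) * x, by simp⟩

theorem IsRightIdeal.mulPrimePow {J : Submodule (𝓞 F) A} (hJ : IsRightIdeal O J) (r : ℤ) :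
    IsRightIdeal O (mulPrimePow J p r) := by
  refine ⟨⟨hJ.1.1.mul (Submodule.FG.map _ ?_), ?_⟩, (rightOrder_mulPrimePow J r).trans hJ.2⟩
  · exact FractionalIdeal.fg_of_isNoetherianRing le_rfl _
  · obtain ⟨f, hf, hv⟩ := exists_mem_primePow p r
    have hf0 : f ≠ 0 := by
      rintro rfl
      rw [map_zero] at hv
      exact exp_ne_zero hv.symm
    rw [eq_top_iff, ← hJ.1.2, Submodule.span_le]
    intro a ha
    have := Submodule.smul_mem _ f⁻¹
      (Submodule.subset_span (R := F) (smul_mem_mulPrimePow (p := p) ha hf))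
    rwa [inv_smul_smul₀ hf0] at this

end MulPrimePow

/-! ### The valuation of a fractional ideal. -/

section Valuation

/-- The finitely many generators have denominators outside p; the product of these is a common one,
still outside p since p is prime. -/
theorem exists_smul_eq_of_forall_valuation_le {N : Submodule (𝓞 F) F} (hN : N.FG)
    (h : ∀ x ∈ N, p.valuation F x ≤ 1) :
    ∃ s ∉ p.asIdeal, ∀ x ∈ N, ∃ n : 𝓞 F, algebraMap (𝓞 F) F s * x = algebraMap (𝓞 F) F n := by
  obtain ⟨T, rfl⟩ := hN
  have h1 : ∀ x : F, ∃ s : 𝓞 F, s ∉ p.asIdeal ∧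
      (p.valuation F x ≤ 1 → ∃ n : 𝓞 F, algebraMap (𝓞 F) F s * x = algebraMap (𝓞 F) F n) := by
    intro x
    by_cases hx : p.valuation F x ≤ 1
    · obtain ⟨n, d, hd⟩ := HeightOneSpectrum.exists_primeCompl_mul_eq_of_integer p x hx
      exact ⟨d, d.2, fun _ => ⟨n, by rw [mul_comm, hd]⟩⟩
    · exact ⟨1, fun h => p.isPrime.ne_top ((Ideal.eq_top_iff_one _).2 h), fun h => absurd h hx⟩
  choose d hd hd' using h1
  refine ⟨∏ x ∈ T, d x, ?_, fun x hx => ?_⟩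
  · intro h
    obtain ⟨x, -, hx⟩ := (Ideal.IsPrime.prod_mem_iff (hp := p.isPrime)).1 h
    exact hd x hx
  · induction hx using Submodule.span_induction with
    | mem x hx =>
      obtain ⟨n, hn⟩ := hd' x (h x (Submodule.subset_span hx))
      obtain ⟨m, hm⟩ := Finset.dvd_prod_of_mem d hx
      refine ⟨m * n, ?_⟩
      rw [hm, map_mul, map_mul, ← hn]
      ring
    | zero => exact ⟨0, by simp⟩
    | add x y _ _ hx hy =>
      obtain ⟨n, hn⟩ := hx
      obtain ⟨m, hm⟩ := hy
      exact ⟨n + m, by rw [mul_add, hn, hm, map_add]⟩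
    | smul c x _ hx =>
      obtain ⟨n, hn⟩ := hx
      refine ⟨c * n, ?_⟩
      rw [Algebra.smul_def, mul_left_comm, hn, map_mul]

theorem count_span_of_notMem {s : 𝓞 F} (hs : s ∉ p.asIdeal) :
    FractionalIdeal.count F p (Ideal.span {s} : Ideal (𝓞 F)) = 0 := by
  have hs0 : Ideal.span {s} ≠ (0 : Ideal (𝓞 F)) := by
    rintro h
    rw [Ideal.zero_eq_bot, Ideal.span_singleton_eq_bot] at h
    exact hs (h ▸ p.asIdeal.zero_mem)
  rw [FractionalIdeal.count_coe F p hs0]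
  norm_cast
  by_contra h
  have := (Associates.count_ne_zero_iff_dvd hs0 p.irreducible).1 h
  rw [Ideal.dvd_span_singleton] at this
  exact hs this

/-- The valuation of a fractional ideal is the least valuation of its elements. -/
theorem ordAt_eq {M : Submodule (𝓞 F) F} (hM : IsFractional (𝓞 F)⁰ M) {d : ℤ}
    (h : ∀ x ∈ M, p.valuation F x ≤ exp (-d)) (h' : ∃ x ∈ M, p.valuation F x = exp (-d)) :
    ordAt p M = d := by
  rw [ordAt, dif_pos hM]
  obtain ⟨x, hx, hxv⟩ := h'
  have hx0 : x ≠ 0 := by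
    rintro rfl
    rw [map_zero] at hxv
    exact exp_ne_zero hxv.symm
  set N : FractionalIdeal (𝓞 F)⁰ F := ⟨M, hM⟩ with hN
  have hN0 : N ≠ 0 := fun h0 => hx0 (by
    have : x ∈ N := hx
    rw [h0] at this
    simpa using this)
  -- Twisting by p^(-d) reduces to valuation 0. The twist contains some s outside p, and another
  -- such s multiplies it into 𝓞 F; these give the two inequalities.
  have hP0 := zpow_ne_zero (-d) (coeIdeal_ne_zero p)
  have hc := FractionalIdeal.count_mul F p hN0 hP0
  rw [FractionalIdeal.count_zpow_self] at hc
  have hmem : ∀ y, y ∈ N * (p.asIdeal : FractionalIdeal (𝓞 F)⁰ F) ^ (-d) ↔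
      y ∈ M * primePow p (-d) := by
    intro y
    rw [← FractionalIdeal.mem_coe, FractionalIdeal.coe_mul]
    rfl
  set N' := N * (p.asIdeal : FractionalIdeal (𝓞 F)⁰ F) ^ (-d) with hN'
  have hN'0 : N' ≠ 0 := mul_ne_zero hN0 hP0
  have h1 : FractionalIdeal.count F p N' ≤ 0 := by
    obtain ⟨f, hf, hfv⟩ := exists_mem_primePow p (-d)
    have hf0 : f ≠ 0 := by
      rintro rfl
      rw [map_zero] at hfv
      exact exp_ne_zero hfv.symm
    have hv : p.valuation F (x * f)⁻¹ ≤ 1 := by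
      rw [map_inv₀, map_mul, hxv, hfv, ← exp_add]
      simp
    obtain ⟨n, s, hns⟩ := HeightOneSpectrum.exists_primeCompl_mul_eq_of_integer p _ hv
    rw [← count_span_of_notMem s.2]
    refine FractionalIdeal.count_mono F p ?_ ?_
    · rw [FractionalIdeal.coeIdeal_ne_zero, ne_eq, Ideal.span_singleton_eq_bot]
      intro h0
      exact s.2 (h0 ▸ p.asIdeal.zero_mem)
    · rw [FractionalIdeal.coeIdeal_span_singleton, FractionalIdeal.spanSingleton_le_iff_mem, hmem]
      have : algebraMap (𝓞 F) F s = n • (x * f) := by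
        rw [Algebra.smul_def, ← hns]
        field_simp
      rw [this]
      exact Submodule.smul_mem _ _ (Submodule.mul_mem_mul hx hf)
  have h2 : 0 ≤ FractionalIdeal.count F p N' := by
    have hv : ∀ y ∈ (N' : Submodule (𝓞 F) F), p.valuation F y ≤ 1 := by
      intro y hy
      have hy' := (hmem y).1 hy
      clear hy
      induction hy' using Submodule.mul_induction_on' with
      | mem_mul_mem a ha b hb =>
        have hb := valuation_le_of_mem_primePow hb
        have := mul_le_mul' (h a ha) hb
        rwa [← map_mul, ← exp_add, add_neg_cancel, exp_zero] at this
      | add x _ y _ hx hy => exact (Valuation.map_add _ x y).trans (max_le hx hy)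
    obtain ⟨s, hs, hs'⟩ := exists_smul_eq_of_forall_valuation_le
      (FractionalIdeal.fg_of_isNoetherianRing le_rfl N') hv
    have hs0 : ((Ideal.span {s} : Ideal (𝓞 F)) : FractionalIdeal (𝓞 F)⁰ F) ≠ 0 := by
      rw [FractionalIdeal.coeIdeal_ne_zero, ne_eq, Ideal.span_singleton_eq_bot]
      intro h0
      exact hs (h0 ▸ p.asIdeal.zero_mem)
    have hle : ((Ideal.span {s} : Ideal (𝓞 F)) : FractionalIdeal (𝓞 F)⁰ F) * N' ≤ 1 := by
      rw [FractionalIdeal.coeIdeal_span_singleton, FractionalIdeal.spanSingleton_mul_le_iff]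
      intro z hz
      obtain ⟨n, hn⟩ := hs' z hz
      rw [hn, FractionalIdeal.mem_one_iff]
      exact ⟨n, rfl⟩
    have := FractionalIdeal.count_mono F p (mul_ne_zero hs0 hN'0) hle
    rwa [FractionalIdeal.count_mul F p hs0 hN'0, count_span_of_notMem hs, zero_add,
      FractionalIdeal.count_one] at this
  omega

end Valuation

end Quat

namespace Quat

open BruhatTits WithZero

variable {F A : Type*} [Field F] [NumberField F] [Ring A] [Algebra F A]
variable {p : HeightOneSpectrum (𝓞 F)} {O : Subalgebra (𝓞 F) A}

/-! ### Reduced norms of ideals, and integrality away from p. -/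

section ReducedNorm

omit [NumberField F] in
theorem IsRightIdeal.mul_mem {J : Submodule (𝓞 F) A} (hJ : IsRightIdeal O J) {a b : A}
    (ha : a ∈ J) (hb : b ∈ O) : a * b ∈ J := by
  rw [← hJ.2] at hb
  exact hb a ha

theorem valuation_nrd_le_one [Module.Finite F A] (φ : Splitting A p) {a : A}
    (ha : loc φ a ∈ pInt p) : p.valuation F (nrd F a) ≤ 1 := by
  rw [← valued_algebraMap, algebraMap_nrd φ]
  exact mem_range_iff.1 (det_mem_of_mem_intMat ha)

theorem nrd_units_ne_zero [Module.Finite F A] (φ : Splitting A p) (y : Aˣ) :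
    nrd F (y : A) ≠ 0 := by
  have h := congrArg (nrd F) y.mul_inv
  rw [nrd_mul φ] at h
  rw [nrd_one φ] at h
  exact left_ne_zero_of_mul (h ▸ one_ne_zero)

theorem nrd_smul [Module.Finite F A] (φ : Splitting A p) (f : F) (a : A) :
    nrd F (f • a) = f ^ 2 * nrd F a := by
  apply (algebraMap F (p.adicCompletion F)).injective
  rw [algebraMap_nrd φ, loc_smul, Matrix.det_smul, map_mul, algebraMap_nrd φ, map_pow]
  simp

/-- `y` belongs to `J` and generates it over the integral matrices. -/
def IsGen (φ : Splitting A p) (J : Submodule (𝓞 F) A) (y : Aˣ) : Prop :=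
  (y : A) ∈ J ∧ ∀ a ∈ J, loc φ ((y⁻¹ : Aˣ) * a) ∈ pInt p

/-- Each element of `J` is y times an element of p-integral norm, so nrd y has the least order at p.
-/
theorem IsGen.ordAt_eq [Module.Finite F A] {φ : Splitting A p} {J : Submodule (𝓞 F) A}
    (hJ : J.FG) {y : Aˣ} (hy : IsGen φ J y) {d : ℤ} (hd : p.valuation F (nrd F (y : A)) = exp (-d)) :
    ordAt p (nrdIdeal J) = d := by
  refine Quat.ordAt_eq (isFractional_nrdIdeal hJ) (fun x hx => ?_)
    ⟨_, Submodule.subset_span ⟨_, hy.1, rfl⟩, hd⟩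
  induction hx using Submodule.span_induction with
  | mem x hx =>
    obtain ⟨a, ha, rfl⟩ := hx
    have h1 : a = y * ((y⁻¹ : Aˣ) * a) := by simp
    rw [h1, nrd_mul φ, map_mul, hd]
    exact mul_le_of_le_one_right' (valuation_nrd_le_one φ (hy.2 a ha))
  | zero => simp
  | add x z _ _ hx hz => exact (Valuation.map_add _ x z).trans (max_le hx hz)
  | smul c x _ hx =>
    rw [Algebra.smul_def, map_mul]
    exact (mul_le_of_le_one_left' (p.valuation_le_one c)).trans hx

theorem IsGen.leftMul {φ : Splitting A p} {J : Submodule (𝓞 F) A} {y : Aˣ} (hy : IsGen φ J y)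
    (g : Aˣ) : IsGen φ (leftMul (g : A) J) (g * y) := by
  refine ⟨⟨y, hy.1, rfl⟩, ?_⟩
  rintro _ ⟨a, ha, rfl⟩
  have : (((g * y)⁻¹ : Aˣ) : A) * LinearMap.mulLeft (𝓞 F) (g : A) a = (y⁻¹ : Aˣ) * a := by
    rw [mul_inv_rev, Units.val_mul, LinearMap.mulLeft_apply, mul_assoc, Units.inv_mul_cancel_left]
  rw [this]
  exact hy.2 a ha

/-- The unit `f y`, for a nonzero scalar `f`. -/
def scale (f : Fˣ) (y : Aˣ) : Aˣ := Units.map (algebraMap F A).toMonoidHom f * y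

omit [NumberField F] in
theorem coe_scale (f : Fˣ) (y : Aˣ) : (scale f y : A) = (f : F) • (y : A) := by
  rw [Algebra.smul_def]
  rfl

omit [NumberField F] in
theorem coe_scale_inv (f : Fˣ) (y : Aˣ) :
    ((scale f y)⁻¹ : Aˣ) = (f : F)⁻¹ • ((y⁻¹ : Aˣ) : A) := by
  rw [scale, mul_inv_rev, ← map_inv, Algebra.smul_def, Algebra.commutes, Units.val_mul]
  simp

theorem IsGen.mulPrimePow {φ : Splitting A p} {J : Submodule (𝓞 F) A} {y : Aˣ} (hy : IsGen φ J y)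
    {r : ℤ} {f : Fˣ} (hf : (f : F) ∈ primePow p r) (hfv : p.valuation F f = exp (-r)) :
    IsGen φ (mulPrimePow J p r) (scale f y) := by
  refine ⟨?_, fun a ha => ?_⟩
  · rw [coe_scale]
    exact smul_mem_mulPrimePow hy.1 hf
  · let N : Submodule (𝓞 F) A :=
      { carrier := {a | loc φ (((scale f y)⁻¹ : Aˣ) * a) ∈ pInt p}
        zero_mem' := by
          rw [Set.mem_ofPred_eq, mul_zero, map_zero]
          exact zero_mem _
        add_mem' := by
          intro a b ha hb
          rw [Set.mem_ofPred_eq, mul_add, map_add]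
          exact add_mem (Set.mem_ofPred_eq ▸ ha) (Set.mem_ofPred_eq ▸ hb)
        smul_mem' := by
          intro c a ha
          rw [Set.mem_ofPred_eq, mul_smul_comm, loc_smul_int]
          exact smul_mem_intMat (algebraMap_int_mem_range p c) ha }
    have : Quat.mulPrimePow J p r ≤ N := by
      refine mulPrimePow_le.2 fun a ha g hg => ?_
      change loc φ (((scale f y)⁻¹ : Aˣ) * g • a) ∈ pInt p
      rw [coe_scale_inv, mul_smul_comm, smul_mul_assoc, smul_smul, loc_smul]
      refine smul_mem_intMat ?_ (hy.2 a ha)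
      rw [mem_range_iff, valued_algebraMap, map_mul, map_inv₀, hfv]
      exact mul_inv_le_one_of_le₀ (valuation_le_of_mem_primePow hg) zero_le
    exact this ha

theorem exists_unit_mem_primePow (p : HeightOneSpectrum (𝓞 F)) (r : ℤ) :
    ∃ f : Fˣ, (f : F) ∈ primePow p r ∧ p.valuation F f = exp (-r) := by
  obtain ⟨f, hf, hv⟩ := exists_mem_primePow p r
  have hf0 : f ≠ 0 := by
    rintro rfl
    rw [map_zero] at hv
    exact exp_ne_zero hv.symm
  exact ⟨Units.mk0 f hf0, hf, hv⟩

theorem valuation_nrd_scale [Module.Finite F A] (φ : Splitting A p) {f : Fˣ} {y : Aˣ} {r d : ℤ}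
    (hf : p.valuation F f = exp (-r)) (hy : p.valuation F (nrd F (y : A)) = exp (-d)) :
    p.valuation F (nrd F (scale f y : A)) = exp (-(d + 2 * r)) := by
  rw [coe_scale, nrd_smul φ, map_mul, map_pow, hf, hy, ← exp_nsmul, ← exp_add]
  congr 1
  simp

theorem conj_mem [Module.Finite F A] (φ : Splitting A p) (hO : IsOrder O) {a : A} (ha : a ∈ O) :
    conj F a ∈ O := by
  obtain ⟨s, hs⟩ := trd_mem_of_isIntegral φ (isIntegral_of_mem_order hO ha)
  rw [conj, ← hs, ← IsScalarTower.algebraMap_apply]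
  exact sub_mem (O.algebraMap_mem s) ha

theorem exists_nrd_eq [Module.Finite F A] (φ : Splitting A p) (hO : IsOrder O) {a : A}
    (ha : a ∈ O) : ∃ n : 𝓞 F, algebraMap (𝓞 F) F n = nrd F a := by
  have h1 := isIntegral_of_mem_order hO (mul_mem ha (conj_mem φ hO ha))
  rw [mul_conj φ, isIntegral_algebraMap_iff (algebraMap_injective φ)] at h1
  exact IsIntegrallyClosed.isIntegral_iff.1 h1

/-- Away from its norm, an integral ideal contains scalars. -/
theorem exists_smul_one_mem [Module.Finite F A] (φ : Splitting A p) (hO : IsOrder O)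
    {I : Submodule (𝓞 F) A} (hI : IsIntegralRightIdeal O I) (hn : nrdIdeal I = primePow p 1)
    {q : HeightOneSpectrum (𝓞 F)} (hq : q ≠ p) : ∃ n ∉ q.asIdeal, n • (1 : A) ∈ I := by
  obtain ⟨t, htp, htq⟩ := exists_notMem_of_ne p hq
  have ht : algebraMap (𝓞 F) F t ∈ nrdIdeal I := by
    rw [hn]
    simpa using algebraMap_pow_mem_primePow htp 1
  by_contra! h
  -- For a in `I`, nrd a = a ā lies in `I`. If no such scalar were outside q, the norm of `I` would
  -- be contained in q, although it contains t.
  have key : ∀ x ∈ nrdIdeal I, q.valuation F x < 1 := by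
    intro x hx
    induction hx using Submodule.span_induction with
    | mem x hx =>
      obtain ⟨a, ha, rfl⟩ := hx
      obtain ⟨n, hn⟩ := exists_nrd_eq φ hO (hI.2 ha)
      rw [← hn, HeightOneSpectrum.valuation_lt_one_iff_mem]
      by_contra hnq
      refine h n hnq ?_
      have := hI.1.mul_mem ha (conj_mem φ hO (hI.2 ha))
      rwa [mul_conj φ, ← hn, ← IsScalarTower.algebraMap_apply, Algebra.algebraMap_eq_smul_one]
        at this
    | zero => simp
    | add x z _ _ hx hz => exact lt_of_le_of_lt (Valuation.map_add _ x z) (max_lt hx hz)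
    | smul c x _ hx =>
      rw [Algebra.smul_def, map_mul]
      exact lt_of_le_of_lt (mul_le_of_le_one_left' (q.valuation_le_one c)) hx
  have := key _ ht
  rw [HeightOneSpectrum.valuation_lt_one_iff_mem] at this
  exact htq this

/-- Away from p the left order lies in `O`: for a scalar n in `I`, the product u n is in `I`, hence
in `O`. -/
theorem exists_smul_mem_of_mem_leftOrder [Module.Finite F A] (φ : Splitting A p) (hO : IsOrder O)
    {I : Submodule (𝓞 F) A} (hI : IsIntegralRightIdeal O I) (hn : nrdIdeal I = primePow p 1)
    {q : HeightOneSpectrum (𝓞 F)} (hq : q ≠ p) {u : A} (hu : u ∈ leftOrder I) :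
    ∃ n ∉ q.asIdeal, n • u ∈ O := by
  obtain ⟨n, hnq, h⟩ := exists_smul_one_mem φ hO hI hn hq
  refine ⟨n, hnq, hI.2 ?_⟩
  have := hu _ h
  rwa [mul_smul_comm, mul_one] at this

/-- Multiplication by nrd u maps the fractional ideal nrd `I` into itself. This bounds norms on O₁,
which need not be integral for the splitting adapted to `O`. -/
theorem valuation_nrd_le_one_of_mem_leftOrder [Module.Finite F A] (φ : Splitting A p)
    {I : Submodule (𝓞 F) A} {r : ℤ} (hn : nrdIdeal I = primePow p r) {u : A}
    (hu : u ∈ leftOrder I) : p.valuation F (nrd F u) ≤ 1 := by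
  obtain ⟨f, hf, hv⟩ := exists_mem_primePow p r
  have h1 : nrd F u * f ∈ primePow p r := by
    rw [← hn] at hf ⊢
    clear hv
    induction hf using Submodule.span_induction with
    | mem x hx =>
      obtain ⟨a, ha, rfl⟩ := hx
      rw [← nrd_mul φ]
      exact Submodule.subset_span ⟨_, hu a ha, rfl⟩
    | zero =>
      rw [mul_zero]
      exact Submodule.zero_mem _
    | add x z _ _ hx hz =>
      rw [mul_add]
      exact Submodule.add_mem _ hx hz
    | smul c x _ hx =>
      rw [mul_smul_comm]
      exact Submodule.smul_mem _ c hx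
  have h2 := valuation_le_of_mem_primePow h1
  rw [map_mul, hv] at h2
  exact (mul_le_iff_le_one_left exp_pos).1 h2

theorem valuation_nrd_eq_one [Module.Finite F A] (φ : Splitting A p) {u : Aˣ}
    (h : p.valuation F (nrd F (u : A)) ≤ 1) (h' : p.valuation F (nrd F ((u⁻¹ : Aˣ) : A)) ≤ 1) :
    p.valuation F (nrd F (u : A)) = 1 := by
  have h2 := congrArg (p.valuation F) (congrArg (nrd F) u.mul_inv)
  rw [nrd_mul φ, nrd_one φ, map_one, map_mul] at h2
  refine le_antisymm h ?_
  rw [← h2]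
  exact mul_le_of_le_one_right' h'

/-- The test for dividing an ideal by p inside `O`: divisibility by t at p, and local membership in
`O` elsewhere, where p⁻¹ has integral elements. -/
theorem mulPrimePow_neg_one_le [Module.Finite F A] (φ : Splitting A p) (hO : IsMaximalOrder O)
    (hφ : ∀ a ∈ O, loc φ a ∈ pInt p) {t : 𝓞 F} (ht : p.intValuation t = exp (-1 : ℤ))
    {J : Submodule (𝓞 F) A}
    (hJ : ∀ a ∈ J, ∀ q : HeightOneSpectrum (𝓞 F), q ≠ p → ∃ s ∉ q.asIdeal, s • a ∈ O)
    (hJ' : ∀ a ∈ J, (toComp p t)⁻¹ • loc φ a ∈ pInt p) :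
    mulPrimePow J p (-1) ≤ Subalgebra.toSubmodule O := by
  refine mulPrimePow_le.2 fun a ha f hf => mem_of_mem_pInt φ hO hφ ?_ fun q hq => ?_
  · have h1 : loc φ (f • a) = (algebraMap F (p.adicCompletion F) f * toComp p t) •
        (toComp p t)⁻¹ • loc φ a := by
      rw [loc_smul, smul_smul, mul_inv_cancel_right₀ (toComp_ne_zero ht)]
    rw [h1]
    refine smul_mem_intMat ?_ (hJ' a ha)
    rw [mem_range_iff, map_mul, valued_algebraMap, valued_algebraMap_int, ht]
    have := mul_le_mul_left (valuation_le_of_mem_primePow hf) (exp (-1 : ℤ))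
    rwa [← exp_add, neg_neg, add_neg_cancel, exp_zero] at this
  · obtain ⟨s, hs, hsa⟩ := hJ a ha q hq
    obtain ⟨n, d, hd⟩ := HeightOneSpectrum.exists_primeCompl_mul_eq_of_integer q f
      (valuation_le_one_of_mem_primePow hf hq)
    refine ⟨s * d, mul_notMem hs d.2, ?_⟩
    have : (s * (d : 𝓞 F)) • f • a = n • s • a := by
      rw [← algebraMap_smul F (s * (d : 𝓞 F)), ← algebraMap_smul F n, ← algebraMap_smul F s,
        smul_smul, smul_smul, ← hd, map_mul]
      congr 1
      ring
    rw [this]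
    exact O.smul_mem hsa n

end ReducedNorm

/-! ### The action on the tree and elementary divisors. -/

section Action

theorem coe_toGL (φ : Splitting A p) (y : Aˣ) :
    (toGL φ y : Matrix (Fin 2) (Fin 2) (p.adicCompletion F)) = loc φ y := rfl

theorem toGL_conjSplitting (φ : Splitting A p) (h : GL (Fin 2) (p.adicCompletion F)) (y : Aˣ) :
    h * toGL (conjSplitting φ h) y = toGL φ y * h := by
  apply Units.ext
  rw [Units.val_mul, coe_toGL, loc_conjSplitting, Units.val_mul, coe_toGL, ← mul_assoc, ← mul_assoc,
    ← Units.val_mul, mul_inv_cancel, Units.val_one, one_mul]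

theorem act_act' (φ : Splitting A p) (x y : Aˣ) (P : PVertex p) :
    act φ x (act φ y P) = act φ (x * y) P := by
  rw [act, act, act, act_act, map_mul]

/-- Scalars act trivially on homothety classes; this is why Q is left alone when J is multiplied by
a power of p, even if p is not principal. -/
theorem act_scale (φ : Splitting A p) (f : Fˣ) (y : Aˣ) (P : PVertex p) :
    act φ (scale f y) P = act φ y P := by
  obtain ⟨g, rfl⟩ := exists_eq_vtx P
  rw [act, act, act_vtx, act_vtx, ← vtx_mul_diagGL_self (toGL φ y * g)
    (Units.map (algebraMap F (p.adicCompletion F)).toMonoidHom f)]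
  congr 1
  apply Units.ext
  have : ∀ c : (p.adicCompletion F)ˣ, (diagGL c c : Matrix (Fin 2) (Fin 2) (p.adicCompletion F)) =
      (c : p.adicCompletion F) • 1 := by
    intro c
    rw [coe_diagGL, Matrix.one_fin_two]
    simp
  rw [Units.val_mul, coe_toGL, coe_scale, loc_smul, Units.val_mul, Units.val_mul, coe_toGL, this,
    mul_smul_comm, mul_one, smul_mul_assoc]
  rfl

/-- The distance by which an element moves the vertex of an order. -/
theorem exists_dist_act_eq [Module.Finite F A] (φ : Splitting A p)
    (h : GL (Fin 2) (p.adicCompletion F)) {t : 𝓞 F} (ht : p.intValuation t = exp (-1 : ℤ))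
    (hπ : Irreducible (algebraMap (𝓞 F) (p.adicCompletionIntegers F) t)) (y : Aˣ) :
    ∃ i j : ℤ, (pTree p).dist (vtx _ h) (act φ y (vtx _ h)) = (i - j).natAbs ∧
      p.valuation F (nrd F (y : A)) = exp (-(i + j)) ∧
      ∀ n : ℤ, toComp p t ^ (-n) • loc (conjSplitting φ h) y ∈ pInt p ↔ n ≤ i ∧ n ≤ j := by
  obtain ⟨i, j, h1, ⟨u, h2⟩, h3⟩ := exists_dist_eq (K := p.adicCompletion F) hπ h
    (toGL (conjSplitting φ h) y)
  refine ⟨i, j, ?_, ?_, h3⟩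
  · rw [act, act_vtx, ← toGL_conjSplitting]
    exact h1
  · have hu : Valued.v (algebraMap (p.adicCompletionIntegers F) (p.adicCompletion F) u) = 1 :=
      HeightOneSpectrum.adicCompletionIntegers.isUnit_iff_valued_eq_one.1 u.isUnit
    have ht' : Valued.v (algebraMap (p.adicCompletionIntegers F) (p.adicCompletion F)
        (algebraMap (𝓞 F) (p.adicCompletionIntegers F) t)) = exp (-1 : ℤ) :=
      (valued_algebraMap_int p t).trans ht
    rw [← valued_algebraMap, algebraMap_nrd (conjSplitting φ h), ← coe_toGL, h2, map_mul, map_zpow₀,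
      hu, ht', one_mul, ← exp_zsmul]
    congr 1
    simp

end Action

end Quat

/-! ### The loop invariant, termination and correctness. -/

namespace Quat

open BruhatTits WithZero

variable {F A : Type*} [Field F] [NumberField F] [Ring A] [Algebra F A]
variable {p : HeightOneSpectrum (𝓞 F)} {O : Subalgebra (𝓞 F) A}

theorem mem_pInt_units {φ : Splitting A p} (hφ : ∀ a ∈ O, loc φ a ∈ pInt p) {u : Aˣ}
    (hu : u ∈ O.toSubmonoid.units) : toGL φ u ∈ pGL p :=
  mem_intGL.2 ⟨hφ _ hu.1, by rw [← map_inv]; exact hφ _ hu.2⟩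

/-- The vertex `P₀` is the one of the lattice stabilized by the order. -/
theorem PReductionStructure.point_zero_eq {φ : Splitting A p} (S : PReductionStructure O p φ)
    {h : GL (Fin 2) (p.adicCompletion F)}
    (hφ : ∀ a ∈ O, loc (conjSplitting φ h) a ∈ pInt p) : S.point 0 = vtx _ h := by
  refine eq_vtx_of_fixed (H := toGL φ '' {u | u ∈ O.toSubmonoid.units}) (P' := S.point 1) ?_ ?_ ?_
  · rintro _ ⟨u, hu, rfl⟩
    rw [mul_assoc, ← toGL_conjSplitting, inv_mul_cancel_left]
    exact mem_pInt_units hφ hu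
  · rintro _ ⟨u, hu, rfl⟩
    exact S.point_fixed 0 u (S.order_zero.symm ▸ hu)
  · intro V hV
    refine ⟨_, ⟨S.rot 0 V hV, ?_, rfl⟩, S.rot_act 0 V hV⟩
    have := S.rot_mem 0 V hV
    rwa [S.order_zero] at this

/-- The invariant of the loop of `PReduce`. -/
structure Invariant {φ : Splitting A p} (S : PReductionStructure O p φ)
    (h : GL (Fin 2) (p.adicCompletion F)) (I : Submodule (𝓞 F) A) (s : State A p) : Prop where
  integral : IsIntegralRightIdeal O s.J
  eq : leftMul (s.c : A) I = mulPrimePow s.J p s.r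
  gen : ∃ y : Aˣ, IsGen (conjSplitting φ h) s.J y ∧ s.Q = act φ y (S.point 0) ∧
    p.valuation F (nrd F (y : A)) = exp (-s.k)
  dist_zero : ((pTree p).dist (S.point 0) s.Q : ℤ) = s.k
  dist_one : s.i = 1 → ((pTree p).dist (S.point 1) s.Q : ℤ) = s.k - 1
  -- The distance from the current vertex Pᵢ to Q is k - i; its positivity is what provides the next
  -- vertex P.
  lt_of_not_halted : s.halted = false → (s.i.val : ℤ) < s.k
  lt_of_halted : s.halted = true → s.k < 2

section

variable [Module.Finite F A] {φ : Splitting A p} (S : PReductionStructure O p φ)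
  {h : GL (Fin 2) (p.adicCompletion F)} (hO : IsMaximalOrder O)
  (hφ : ∀ a ∈ O, loc (conjSplitting φ h) a ∈ pInt p) {I : Submodule (𝓞 F) A}

include hO hφ

/-- Exponents are bounded: if a fixed unit x of `I` lies in O p^r, then 2r is at most the order of
nrd x at p. -/
theorem exists_isGreatest (hI : IsIntegralRightIdeal O I) :
    ∃ r, IsGreatest {r : ℤ | I ≤ mulPrimePow (Subalgebra.toSubmodule O) p r} r := by
  obtain ⟨x, hx, -⟩ := exists_local_generator _ hO hφ hI.1.1 fun a ha b hb => hI.1.mul_mem ha hb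
  have hx0 := nrd_units_ne_zero (conjSplitting φ h) x
  obtain ⟨t, htp, ht, -⟩ := exists_uniformizer p
  have hbdd : ∃ b : ℤ, ∀ r : ℤ, I ≤ mulPrimePow (Subalgebra.toSubmodule O) p r → r ≤ b := by
    have hlog := exp_log ((Valuation.ne_zero_iff (p.valuation F)).2 hx0)
    set d := log (p.valuation F (nrd F (x : A)))
    refine ⟨d.natAbs, fun r hr => ?_⟩
    obtain ⟨f, hf, hfv⟩ := exists_unit_mem_primePow p (-r)
    have h1 : (f : F) • (x : A) ∈ O := by
      have := mulPrimePow_mono (p := p) hr (-r)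
      rw [mulPrimePow_mulPrimePow, add_neg_cancel, mulPrimePow_zero] at this
      exact this (smul_mem_mulPrimePow hx hf)
    have h2 := valuation_nrd_le_one _ (hφ _ h1)
    rw [nrd_smul (conjSplitting φ h), map_mul, map_pow, hfv, ← exp_nsmul, ← hlog, ← exp_add, ← exp_zero, exp_le_exp] at h2
    simp at h2
    omega
  obtain ⟨r, hr, hr'⟩ := Int.exists_greatest_of_bdd hbdd
    ⟨0, by rw [mulPrimePow_zero]; exact hI.2⟩
  exact ⟨r, hr, fun z hz => hr' z hz⟩

theorem exists_init (hI : IsIntegralRightIdeal O I) : ∃ s, Init S I s := by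
  obtain ⟨r, hr⟩ := exists_isGreatest hO hφ hI
  have hIR : ∀ a ∈ I, ∀ b ∈ O, a * b ∈ I := fun a ha b hb => hI.1.mul_mem ha hb
  obtain ⟨x, hx⟩ := exists_local_generator _ hO hφ hI.1.1 hIR
  exact ⟨⟨1, mulPrimePow I p (-r), act φ x (S.point 0), r,
    ordAt p (nrdIdeal (mulPrimePow I p (-r))), 0,
    decide (ordAt p (nrdIdeal (mulPrimePow I p (-r))) = 0)⟩, hr, rfl, rfl, rfl, rfl,
    ⟨x, (isLocalGenerator_iff _ hO hφ hIR).2 hx, rfl⟩, rfl⟩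

theorem invariant_of_init (hI : IsIntegralRightIdeal O I) {s : State A p} (hs : Init S I s) :
    Invariant S h I s := by
  obtain ⟨c, J, Q, r, k, i, b⟩ := s
  obtain ⟨hr, hJ, hk, hc, hi, ⟨x, hx, hQ⟩, hb⟩ := hs
  dsimp only at hr hJ hk hc hi hQ hb
  subst hi hc
  have hP := S.point_zero_eq hφ
  have hIR : ∀ a ∈ I, ∀ b ∈ O, a * b ∈ I := fun a ha b hb => hI.1.mul_mem ha hb
  rw [isLocalGenerator_iff _ hO hφ hIR] at hx
  obtain ⟨t, htp, ht, hπ⟩ := exists_uniformizer p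
  obtain ⟨f, hf, hfv⟩ := exists_unit_mem_primePow p (-r)
  have hgen : IsGen (conjSplitting φ h) J (scale f x) := by
    rw [hJ]
    exact IsGen.mulPrimePow hx hf hfv
  have hJI : IsIntegralRightIdeal O J := by
    rw [hJ]
    refine ⟨hI.1.mulPrimePow _, ?_⟩
    have := mulPrimePow_mono (p := p) hr.1 (-r)
    rwa [mulPrimePow_mulPrimePow, add_neg_cancel, mulPrimePow_zero] at this
  have hIJ : I = mulPrimePow J p r := by
    rw [hJ, mulPrimePow_mulPrimePow, neg_add_cancel, mulPrimePow_zero]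
  have hQ' : Q = act φ (scale f x) (S.point 0) := by rw [hQ, act_scale]
  obtain ⟨i, j, h1, h2, h3⟩ := exists_dist_act_eq φ h ht hπ (scale f x)
  have hk' : k = i + j := by rw [hk, hgen.ordAt_eq hJI.1.1.1 h2]
  have hnn := (h3 0).1 (by
    rw [neg_zero, zpow_zero, one_smul]
    exact hφ _ (hJI.2 hgen.1))
  -- If π divided the local generator, `J` would lie in O p, against the maximality of r. Hence
  -- min(i, j) = 0 and |i - j| = i + j = k.
  have hmin : ¬ (1 ≤ i ∧ 1 ≤ j) := by
    rw [← h3 1]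
    intro hdiv
    have h4 : mulPrimePow J p (-1) ≤ Subalgebra.toSubmodule O := by
      refine mulPrimePow_neg_one_le _ hO hφ ht
        (fun a ha q _ => ⟨1, fun h => q.isPrime.ne_top ((Ideal.eq_top_iff_one _).2 h), by
          rw [one_smul]
          exact hJI.2 ha⟩) fun a ha => ?_
      have h5 : a = scale f x * (((scale f x)⁻¹ : Aˣ) * a) := by simp
      rw [h5, map_mul, ← smul_mul_assoc, ← zpow_neg_one]
      exact mul_mem hdiv (hgen.2 a ha)
    have h6 := mulPrimePow_mono (p := p) h4 (r + 1)
    rw [mulPrimePow_mulPrimePow, neg_add_cancel_comm_assoc, ← hIJ] at h6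
    have := hr.2 h6
    omega
  have hdist : ((pTree p).dist (S.point 0) Q : ℤ) = k := by
    rw [hQ', hP, h1, hk']
    omega
  refine ⟨hJI, ?_, ⟨_, hgen, hQ', by rw [h2, hk']⟩, hdist, fun h => absurd h (by simp), ?_, ?_⟩
  · rw [Units.val_one, leftMul_one]
    exact hIJ
  · intro hb'
    dsimp only at hb' ⊢
    rw [hb'] at hb
    have : k ≠ 0 := by simpa using hb
    rw [Fin.val_zero]
    omega
  · intro hb'
    dsimp only at hb' ⊢
    rw [hb'] at hb
    have : k = 0 := by simpa using hb
    omega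

theorem Invariant.step {s s' : State A p} (hs : Invariant S h I s) (H : Step S s s') :
    Invariant S h I s' ∧ s'.k - s'.i.val = s.k - s.i.val - 1 := by
  obtain ⟨c, J, Q, r, k, i, b⟩ := s
  obtain ⟨c', J', Q', r', k', i', b'⟩ := s'
  obtain ⟨hb, P, hadj, hP, hc', hQ', h0, h1, hi', hb'⟩ := H
  obtain ⟨hint, heq, ⟨y, hy, hQ, hk⟩, hd0, hd1, hnh, -⟩ := hs
  dsimp only at *
  have hP0 := S.point_zero_eq hφ
  have hkpos := hnh hb
  have hseg : (pTree p).dist (S.point i) Q = (pTree p).dist P Q + 1 :=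
    dist_of_adj_of_mem_segment hadj hP
  set g := S.rot i P hadj with hg
  have hgP : act φ g P = S.point (1 - i) := S.rot_act i P hadj
  have hfix : act φ g (S.point i) = S.point i := S.point_fixed i g (S.rot_mem i P hadj)
  -- The rotation is an isometry that carries P to the other base vertex and fixes the current one.
  have hdP : (pTree p).dist (S.point (1 - i)) Q' = (pTree p).dist P Q := by
    rw [hQ', ← hgP]
    exact dist_act _ _ _
  have hdi : (pTree p).dist (S.point i) Q' = (pTree p).dist (S.point i) Q := by
    rw [hQ']
    nth_rw 1 [← hfix]
    exact dist_act _ _ _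
  have hyg := hy.leftMul g
  have hQg : Q' = act φ (g * y) (S.point 0) := by rw [hQ', hQ, act_act']
  have hmem : g ∈ (S.order i).toSubmonoid.units := S.rot_mem i P hadj
  obtain rfl | rfl : i = 0 ∨ i = 1 := by omega
  · obtain ⟨rfl, rfl, rfl⟩ := h0 rfl
    rw [S.order_zero] at hmem
    have hi1 : i' = 1 := hi'
    subst hi1
    have hv : p.valuation F (nrd F (g : A)) = 1 :=
      valuation_nrd_eq_one φ (valuation_nrd_le_one _ (hφ _ hmem.1))
        (valuation_nrd_le_one _ (hφ _ hmem.2))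
    refine ⟨⟨⟨hint.1.leftMul g, ?_⟩, ?_, ⟨_, hyg, hQg, ?_⟩, ?_, ?_, ?_, ?_⟩, ?_⟩
    · rintro _ ⟨a, ha, rfl⟩
      exact O.mul_mem hmem.1 (hint.2 ha)
    · dsimp only
      rw [hc', Units.val_mul, ← leftMul_leftMul, heq, leftMul_mulPrimePow]
    · rw [Units.val_mul, nrd_mul φ, map_mul, hv, one_mul, hk]
    · rw [hdi, hd0]
    · intro _
      dsimp only
      change (pTree p).dist (S.point 1) Q' = _ at hdP
      rw [hdP]
      omega
    · intro hh
      dsimp only at hh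
      rw [hh] at hb'
      have : ¬ k' < 2 := by simpa using hb'
      rw [Fin.val_one]
      dsimp only
      omega
    · intro hh
      dsimp only at hh
      rw [hh] at hb'
      simpa using hb'
    · simp
  · obtain ⟨rfl, rfl, rfl⟩ := h1 rfl
    have hi0 : i' = 0 := hi'
    subst hi0
    rw [Fin.val_one] at hkpos
    have hd1 := hd1 rfl
    obtain ⟨I₁, hI₁, hn, ho⟩ := S.order_one
    rw [ho] at hmem
    have hv : p.valuation F (nrd F (g : A)) = 1 :=
      valuation_nrd_eq_one φ (valuation_nrd_le_one_of_mem_leftOrder φ hn hmem.1)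
        (valuation_nrd_le_one_of_mem_leftOrder φ hn hmem.2)
    have hdist : ((pTree p).dist (S.point 0) Q' : ℤ) = k - 2 := by
      change (pTree p).dist (S.point 0) Q' = _ at hdP
      rw [hdP]
      omega
    have hkg : p.valuation F (nrd F ((g * y : Aˣ) : A)) = exp (-k) := by
      rw [Units.val_mul, nrd_mul φ, map_mul, hv, one_mul, hk]
    obtain ⟨t, htp, ht, hπ⟩ := exists_uniformizer p
    obtain ⟨f, hf, hfv⟩ := exists_unit_mem_primePow p (-1)
    -- Here the exponents have sum k and difference k - 2 in absolute value, so the smaller one is 1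
    -- and π divides the generator g y.
    have hdiv : toComp p t ^ (-1 : ℤ) • loc (conjSplitting φ h) ((g * y : Aˣ) : A) ∈ pInt p := by
      obtain ⟨i, j, h1, h2, h3⟩ := exists_dist_act_eq φ h ht hπ (g * y)
      rw [hQg, hP0, h1] at hdist
      rw [hkg, exp_inj] at h2
      rw [h3 1]
      omega
    have hle : mulPrimePow (leftMul (g : A) J) p (-1) ≤ Subalgebra.toSubmodule O := by
      refine mulPrimePow_neg_one_le _ hO hφ ht ?_ fun a ha => ?_
      -- Away from p, the unit g of O₁ lies locally in `O`, so gJ does too.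
      · rintro _ ⟨a, ha, rfl⟩ q hq
        obtain ⟨n, hnq, hng⟩ := exists_smul_mem_of_mem_leftOrder φ hO.1 hI₁ hn hq hmem.1
        refine ⟨n, hnq, ?_⟩
        rw [LinearMap.mulLeft_apply, ← smul_mul_assoc]
        exact O.mul_mem hng (hint.2 ha)
      · have h5 : a = (g * y : Aˣ) * (((g * y)⁻¹ : Aˣ) * a) := (Units.mul_inv_cancel_left _ _).symm
        rw [h5, map_mul, ← smul_mul_assoc, ← zpow_neg_one]
        exact mul_mem hdiv (hyg.2 a ha)
    refine ⟨⟨⟨(hint.1.leftMul g).mulPrimePow _, hle⟩, ?_,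
      ⟨_, hyg.mulPrimePow hf hfv, ?_, ?_⟩, hdist, fun h => absurd h (by simp), ?_, ?_⟩, ?_⟩
    · dsimp only
      rw [hc', Units.val_mul, ← leftMul_leftMul, heq, leftMul_mulPrimePow, mulPrimePow_mulPrimePow]
      congr 1
      ring
    · rw [act_scale]
      exact hQg
    · rw [valuation_nrd_scale φ hfv hkg]
      congr 1
    · intro hh
      dsimp only at hh
      rw [hh] at hb'
      have : ¬ k - 2 < 2 := by simpa using hb'
      rw [Fin.val_zero]
      dsimp only
      omega
    · intro hh
      dsimp only at hh
      rw [hh] at hb'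
      simpa using hb'
    · simp only [Fin.val_zero, Fin.val_one]
      push_cast
      ring

omit hO hφ [Module.Finite F A] in
theorem Invariant.exists_step {s : State A p} (hs : Invariant S h I s) (hb : s.halted = false) :
    ∃ s', Step S s s' := by
  have hk := hs.lt_of_not_halted hb
  have hd : (pTree p).dist (S.point s.i) s.Q ≠ 0 := by
    have h0 := hs.dist_zero
    have h1 := hs.dist_one
    obtain hi | hi : s.i = 0 ∨ s.i = 1 := by omega
    · rw [hi]
      omega
    · have h1 := h1 hi
      rw [hi] at hk ⊢
      rw [Fin.val_one] at hk
      omega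
  obtain ⟨P, hadj, hP⟩ := exists_adj_mem_segment hd
  obtain hi | hi : s.i = 0 ∨ s.i = 1 := by omega
  · exact ⟨⟨S.rot s.i P hadj * s.c, leftMul (S.rot s.i P hadj : A) s.J,
      act φ (S.rot s.i P hadj) s.Q, s.r, s.k, 1 - s.i,
      decide (s.k < 2)⟩, hb, P, hadj, hP, rfl, rfl,
      fun _ => ⟨rfl, rfl, rfl⟩, fun h => absurd (hi.symm.trans h) (by simp), rfl, rfl⟩
  · exact ⟨⟨S.rot s.i P hadj * s.c, mulPrimePow (leftMul (S.rot s.i P hadj : A) s.J) p (-1),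
      act φ (S.rot s.i P hadj) s.Q, s.r + 1, s.k - 2, 1 - s.i,
      decide (s.k - 2 < 2)⟩, hb, P, hadj, hP, rfl, rfl,
      fun h => absurd (hi.symm.trans h) (by simp), fun _ => ⟨rfl, rfl, rfl⟩, rfl, rfl⟩

theorem Reachable.invariant (hI : IsIntegralRightIdeal O I) {s : State A p}
    (hs : Reachable S I s) : Invariant S h I s := by
  obtain ⟨s₀, h0, hs⟩ := hs
  induction hs with
  | refl => exact invariant_of_init S hO hφ hI h0
  | tail _ hstep ih => exact (Invariant.step S hO hφ ih hstep).1

/-- The integer k - i falls by exactly one per step and is positive whenever a step is executed, so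
an infinite run is impossible. -/
theorem not_forall_step (hI : IsIntegralRightIdeal O I) (σ : ℕ → State A p)
    (h0 : Init S I (σ 0)) : ¬ ∀ n, Step S (σ n) (σ (n + 1)) := by
  intro H
  have key : ∀ n : ℕ, Invariant S h I (σ n) ∧
      (σ n).k - (σ n).i.val = (σ 0).k - (σ 0).i.val - n := by
    intro n
    induction n with
    | zero => exact ⟨invariant_of_init S hO hφ hI h0, by simp⟩
    | succ n ih =>
      obtain ⟨h1, h2⟩ := Invariant.step S hO hφ ih.1 (H n)
      refine ⟨h1, ?_⟩
      rw [h2, ih.2]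
      push_cast
      ring
  obtain ⟨h1, h2⟩ := key ((σ 0).k - (σ 0).i.val).natAbs
  have := h1.lt_of_not_halted (H _).1
  omega

end

end Quat

/-- Correctness of `PReduce`: it can be started, it never gets stuck, it terminates, and its output
`c`, `J`, `r` satisfies the specification. -/
theorem mainTheorem4 {F : Type*} [Field F] [NumberField F] 
    {A : Type*} [Ring A] [Algebra F A] (hA : Quat.IsQuaternion F A)
    (O : Subalgebra (𝓞 F) A) (hO : Quat.IsMaximalOrder O)
    (p : IsDedekindDomain.HeightOneSpectrum (𝓞 F)) (φ : Quat.Splitting A p)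
    (S : Quat.PReductionStructure O p φ)
    (I : Submodule (𝓞 F) A) (hI : Quat.IsIntegralRightIdeal O I) :
    (∃ s, Quat.Init S I s) ∧
    (∀ s, Quat.Reachable S I s → s.halted = false → ∃ s', Quat.Step S s s') ∧
    (∀ σ : ℕ → Quat.State A p, Quat.Init S I (σ 0) → ¬ ∀ n, Quat.Step S (σ n) (σ (n + 1))) ∧
    (∀ s, Quat.Reachable S I s → s.halted = true →
      Quat.IsIntegralRightIdeal O s.J ∧
      Quat.leftMul (s.c : A) I = Quat.mulPrimePow s.J p s.r ∧
      (Quat.ordAt p (Quat.nrdIdeal s.J) = 0 ∨ Quat.ordAt p (Quat.nrdIdeal s.J) = 1)) := by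
  have : Module.Finite F A := Module.finite_of_finrank_pos (by rw [hA.finrank_eq]; norm_num)
  obtain ⟨h, hφ⟩ := Quat.exists_forall_mem_pInt φ hO.1
  refine ⟨Quat.exists_init S hO hφ hI, fun s hs hb => ?_, fun σ h0 => ?_, fun s hs hb => ?_⟩
  · exact (Quat.Reachable.invariant S hO hφ hI hs).exists_step S hb
  · exact Quat.not_forall_step S hO hφ hI σ h0
  · have hinv := Quat.Reachable.invariant S hO hφ hI hs
    refine ⟨hinv.integral, hinv.eq, ?_⟩
    obtain ⟨y, hy, -, hk⟩ := hinv.gen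
    rw [hy.ordAt_eq hinv.integral.1.1.1 hk]
    have h1 := hinv.lt_of_halted hb
    -- As k is a distance it is nonnegative; with k < 2 this leaves 0 and 1.
    have h2 := hinv.dist_zero
    omega
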